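/- Let $\Omega$ be a finite nonempty state space with energy function $E:\Omega\to[0,\infty)$, let $0=\beta_0\le\beta_1\le\dots\le\beta_\ell$ ($\ell\ge1$) be a fixed (non-adaptive) schedule of inverse temperatures $\beta_i=1/(kT_i)$ (so $T_0=\infty$ and $T_\ell=T_F$ is the target temperature), and put $$Z_i=\sum_{\sigma\in\Omega}e^{-\beta_iE(\sigma)},\qquad \pi_i(\sigma)=\frac{e^{-\beta_iE(\sigma)}}{Z_i},\qquad y_i(\sigma)=e^{-(\beta_{i+1}-\beta_i)E(\sigma)}.$$ Assume that $\alpha_i=Z_{i+1}/Z_i\ge\frac12$ for $0\le i<\ell$, and that for $1\le i\le\ell-1$ we are given an ergodic Markov chain $P_i$ on $\Omega$, reversible with respect to $\pi_i$, all of whose eigenvalues $\mu\ne1$ satisfy $|\mu|\le1-\delta$, where $0<\delta\le1$. Fix a state $0\in\Omega$ and, for each such $i$, a unitary $U_i$ on $\mathbb C^\Omega\otimes\mathbb C^\Omega$ with $U_i|x\rangle|0\rangle=\sum_y\sqrt{P_i(x,y)}\,|x\rangle|y\rangle$ for all $x$. The quantum walk is $W(P_i)=R_{\mathcal B_i}R_{\mathcal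 A}$, the product of the reflections about $\mathcal A=\mathrm{span}\{|x\rangle|0\rangle:x\in\Omega\}$ and $\mathcal B_i=U_i^\dagger SU_i\mathcal A$, where $S$ swaps the two registers. A quantum approximation scheme consists of finitely many circuits, each run independently on two $\Omega$-registers in the state $|\pi_0\rangle|0\rangle$ and a number of qubits in the state $|0\rangle$, each followed by a measurement of all the qubits in the computational basis, and of a classical arithmetic computation from the measured bits (rational constants, $\pi$, $+$, $\cdot$, $\cos$, branching on $\le$), whose result times $Z_0=|\Omega|$ is the output $\hat Z$. The gates are: one-qubit gates with at most two control qubits; the controlled reflections about $\mathcal A$ and about $|\pi_0\rangle|0\rangle$; the rotations $V_i=\sum_\sigma|\sigma\rangle\langle\sigma|\otimes\begin{pmatrix}\sqrt{y_i(\sigma)}&\sqrt{1-y_i(\sigma)}\\-\sqrt{1-y_i(\sigma)}&\sqrt{y_i(\sigma)}\end{pmatrix}$, $0\le i<\ell$, of a qubit, conditioned on the first $\Omega$-register; and the controlled walks $W(P_i)$, $1\le i\le\ell-1$. Then there are absolute constants $C,k$ such that for all $\ell\ge1$, $\delta\in(0,1]$ and $\varepsilon\in(0,1]$ there is a quantum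 approximation scheme, depending only on $\ell,\delta,\varepsilon$, which for every system as above outputs $\hat Z$ with $$\Pr\big[(1-\varepsilon)Z_\ell\le\hat Z\le(1+\varepsilon)Z_\ell\big]\ge\tfrac34,$$ which uses at most $C f\,(1+\log f)^k$ applications of controlled walk operators from $\{W(P_1),\dots,W(P_{\ell-1})\}$, where $f=\dfrac{\ell^2}{\sqrt\delta\,\varepsilon}$ (that is, $\tilde O\big(\ell^2/(\sqrt\delta\,\varepsilon)\big)$ applications), and whose total number of circuit runs, qubits, gates of every kind and classical operations is at most $Cf^k$, hence polynomial in $\ell$, $1/\delta$ and $1/\varepsilon$. -/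

import Mathlib

open scoped BigOperators

noncomputable section

namespace QuantumAnnealing

universe u

/-- The two-register space `ℂ^Ω ⊗ ℂ^Ω`, with basis vectors `|x⟩|y⟩` indexed by pairs. -/
abbrev Reg (Ω : Type u) [Fintype Ω] := EuclideanSpace ℂ (Ω × Ω)

/-- The data of an annealing problem: energies, inverse temperatures `β i = 1 / (k T i)`,
transition matrices `P i` (rows sum to one), the reference state `0 ∈ Ω` and, for every `i`,
the unitary quantum update `U i`. -/
structure System (Ω : Type u) [Fintype Ω] where
  energy : Ω → ℝ
  β : ℕ → ℝ
  P : ℕ → Matrix Ω Ω ℝ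
  zero : Ω
  U : ℕ → (Reg Ω ≃ₗᵢ[ℂ] Reg Ω)

namespace System

variable {Ω : Type u} [Fintype Ω] [DecidableEq Ω] (S : System Ω)

/-- The Gibbs partition function `Z_i` at the `i`-th temperature. -/
def Z (i : ℕ) : ℝ := ∑ σ : Ω, Real.exp (-(S.β i * S.energy σ))

/-- The Boltzmann distribution `π_i`. -/
def boltzmann (i : ℕ) (σ : Ω) : ℝ := Real.exp (-(S.β i * S.energy σ)) / S.Z i

/-- The basis vector `|x⟩|y⟩`. -/
def ket (x y : Ω) : Reg Ω := EuclideanSpace.single (x, y) 1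

/-- The subspace `𝒜 = span {|x⟩|0⟩ : x ∈ Ω}`. -/
def spaceA : Submodule ℂ (Reg Ω) := Submodule.span ℂ (Set.range fun x : Ω => ket x S.zero)

/-- The swap of the two registers. -/
def swap : Reg Ω ≃ₗᵢ[ℂ] Reg Ω :=
  LinearIsometryEquiv.piLpCongrLeft 2 ℂ ℂ (Equiv.prodComm Ω Ω)

/-- The subspace `ℬ = U† S U 𝒜` for the `i`-th chain. -/
def spaceB (i : ℕ) : Submodule ℂ (Reg Ω) :=
  S.spaceA.map (((S.U i).trans swap).trans (S.U i).symm).toLinearEquiv.toLinearMap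

/-- The quantum walk `W(P_i) = R_ℬ R_𝒜`. -/
def walk (i : ℕ) : Reg Ω ≃ₗᵢ[ℂ] Reg Ω :=
  S.spaceA.reflection.trans (S.spaceB i).reflection

/-- The state `|π_0⟩|0⟩`, where `π_0` is the uniform distribution (infinite temperature). -/
def start : Reg Ω := ∑ x : Ω, ((1 / Real.sqrt (Fintype.card Ω) : ℝ) : ℂ) • ket x S.zero

/-- The value `y_i(σ) = exp (-(β_{i+1} - β_i) E(σ))`. -/
def weight (i : ℕ) (σ : Ω) : ℝ := Real.exp (-((S.β (i + 1) - S.β i) * S.energy σ))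

/-- The rotation `[[√y, √(1-y)], [-√(1-y), √y]]` with `y = y_i(σ)`; the basis state `|0⟩` of a
qubit is `false` and `|1⟩` is `true`. -/
def rotation (i : ℕ) (σ : Ω) : Matrix Bool Bool ℝ := Matrix.of fun a b =>
  if a = b then Real.sqrt (S.weight i σ)
  else if a then -Real.sqrt (1 - S.weight i σ)
  else Real.sqrt (1 - S.weight i σ)

/-- `P_i` is an ergodic Markov chain, reversible with respect to `π_i`, whose spectral gap
`1 - max {|μ| : μ ≠ 1 an eigenvalue}` is at least `δ`, and `U_i` is a quantum update for it. -/
structure IsChain (δ : ℝ) (i : ℕ) : Prop where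
  stochastic : S.P i ∈ Matrix.rowStochastic ℝ Ω
  ergodic : (S.P i).IsPrimitive
  reversible : ∀ x y, S.boltzmann i x * S.P i x y = S.boltzmann i y * S.P i y x
  gap : ∀ μ : ℝ, Module.End.HasEigenvalue (Matrix.toLin' (S.P i)) μ → μ ≠ 1 → |μ| ≤ 1 - δ
  update : ∀ x, S.U i (ket x S.zero) = ∑ y : Ω, ((Real.sqrt (S.P i x y) : ℝ) : ℂ) • ket x y

/-- The assumptions on the classical scheme with `ℓ` cooling steps. -/
structure IsAnnealing (ℓ : ℕ) (δ : ℝ) : Prop where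
  energy_nonneg : ∀ σ, 0 ≤ S.energy σ
  start_temperature : S.β 0 = 0
  cooling : ∀ i < ℓ, S.β i ≤ S.β (i + 1)
  ratio : ∀ i < ℓ, 1 / 2 ≤ S.Z (i + 1) / S.Z i
  chain : ∀ i, 1 ≤ i → i < ℓ → S.IsChain δ i

end System

/-- Gates of circuits on the two `Ω`-registers and `m` qubits. No gate depends on the system: the
system enters only when a gate is interpreted. -/
inductive Gate (ℓ m : ℕ) : Type
  /-- An arbitrary one-qubit gate on `t`, with at most two control qubits. -/
  | qubit (ctrl : Finset (Fin m)) (t : Fin m) (hcard : ctrl.card ≤ 2) (ht : t ∉ ctrl)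
      (v : Matrix.unitaryGroup Bool ℂ)
  /-- The reflection about `𝒜`, that is, about `|0⟩` in the second register, controlled by `c`. -/
  | reflectZero (c : Fin m)
  /-- The reflection about the start state `|π_0⟩|0⟩`, controlled by `c`. -/
  | reflectStart (c : Fin m)
  /-- The rotation `V_i` of the qubit `t`, controlled by the first register. -/
  | rotate (i : ℕ) (hi : i < ℓ) (t : Fin m)
  /-- The quantum walk `W(P_i)`, `1 ≤ i ≤ ℓ - 1`, controlled by `c`. -/
  | walk (i : ℕ) (hi : 1 ≤ i) (hi' : i < ℓ) (c : Fin m)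

/-- Whether a gate is a controlled walk operator. -/
def Gate.isWalk {ℓ m : ℕ} : Gate ℓ m → Bool
  | .walk _ _ _ _ => true
  | _ => false

/-- Vectors of `(ℂ²)^{⊗m} ⊗ ℂ^Ω ⊗ ℂ^Ω`, decomposed along the computational basis of the
qubits. -/
abbrev QState (Ω : Type u) [Fintype Ω] (m : ℕ) := (Fin m → Bool) → Reg Ω

section Semantics

variable {Ω : Type u} [Fintype Ω] [DecidableEq Ω] (S : System Ω) {ℓ m : ℕ}

/-- The action of a gate on a vector. -/
def Gate.apply : Gate ℓ m → QState Ω m → QState Ω m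
  | .qubit ctrl t _ _ v, ψ => fun b =>
      if ∀ c ∈ ctrl, b c = true then
        ∑ a : Bool, (v : Matrix Bool Bool ℂ) (b t) a • ψ (Function.update b t a)
      else ψ b
  | .reflectZero c, ψ => fun b => if b c then S.spaceA.reflection (ψ b) else ψ b
  | .reflectStart c, ψ => fun b =>
      if b c then (Submodule.span ℂ {S.start}).reflection (ψ b) else ψ b
  | .rotate i _ t, ψ => fun b => WithLp.toLp 2 fun z =>
      ∑ a : Bool, ((S.rotation i z.1 (b t) a : ℝ) : ℂ) * ψ (Function.update b t a) z
  | .walk i _ _ c, ψ => fun b => if b c then S.walk i (ψ b) else ψ b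

/-- The initial vector: all qubits in `|0⟩`, the registers in `|π_0⟩|0⟩`. -/
def initial : QState Ω m := fun b => if b = fun _ => false then S.start else 0

/-- The vector after the gates of the list have been applied in order. -/
def runCircuit (c : List (Gate ℓ m)) : QState Ω m :=
  c.foldl (fun ψ g => g.apply S ψ) (initial S)

/-- The probability that measuring all qubits after the circuit yields `b`. -/
def outcomeProb (c : List (Gate ℓ m)) (b : Fin m → Bool) : ℝ := ‖runCircuit S c b‖ ^ 2

end Semantics

/-- Real arithmetic expressions in measured bits, used for the classical post-processing. -/
inductive Expr (ι : Type) : Type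
  | const (q : ℚ)
  | pi
  | bit (j : ι)
  | add (e f : Expr ι)
  | mul (e f : Expr ι)
  | cos (e : Expr ι)
  /-- `if e ≤ f then g else h` -/
  | ifLe (e f g h : Expr ι)

namespace Expr

variable {ι : Type}

def eval (ω : ι → Bool) : Expr ι → ℝ
  | const q => (q : ℝ)
  | pi => Real.pi
  | bit j => if ω j then 1 else 0
  | add e f => e.eval ω + f.eval ω
  | mul e f => e.eval ω * f.eval ω
  | cos e => Real.cos (e.eval ω)
  | ifLe e f g h => if e.eval ω ≤ f.eval ω then g.eval ω else h.eval ω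

/-- The number of operations of an expression. -/
def size : Expr ι → ℕ
  | const _ => 1
  | pi => 1
  | bit _ => 1
  | add e f => e.size + f.size + 1
  | mul e f => e.size + f.size + 1
  | cos e => e.size + 1
  | ifLe e f g h => e.size + f.size + g.size + h.size + 1

end Expr

/-- A quantum approximation scheme for `ℓ` cooling steps: finitely many circuits, each run on a
fresh initial state and measured, followed by a classical computation on all measured bits. -/
structure Scheme (ℓ : ℕ) where
  runs : ℕ
  qubits : ℕ
  circuit : Fin runs → List (Gate ℓ qubits)
  post : Expr (Fin runs × Fin qubits)

namespace Scheme

variable {ℓ : ℕ} (A : Scheme ℓ)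

/-- The number of applications of controlled walk operators. -/
def walkCount : ℕ := ∑ r, (A.circuit r).countP Gate.isWalk

/-- The total resources: runs, qubits, gates of every kind, and classical operations. -/
def size : ℕ := A.runs + A.qubits + (∑ r, (A.circuit r).length) + A.post.size

variable {Ω : Type u} [Fintype Ω] [DecidableEq Ω]

/-- The estimate of the partition function: `Z_0 = |Ω|` times the computed number. -/
def estimate (Ω : Type u) [Fintype Ω] (ω : Fin A.runs → Fin A.qubits → Bool) : ℝ :=
  (Fintype.card Ω : ℝ) * A.post.eval fun j => ω j.1 j.2

open scoped Classical in
/-- The probability that the estimate lies in `T`; the runs are independent. -/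
def prob (S : System Ω) (T : Set ℝ) : ℝ :=
  ∑ ω : Fin A.runs → Fin A.qubits → Bool,
    if A.estimate Ω ω ∈ T then ∏ r, outcomeProb S (A.circuit r) (ω r) else 0

end Scheme

end QuantumAnnealing

end

open scoped BigOperators

noncomputable section

namespace QuantumAnnealing

universe u

set_option linter.unusedSectionVars false

/-! The partition function telescopes as `Z_ℓ = |Ω| ∏ α_i`, and `α_i` is the mean of `y_i` under
`π_i`. Relative precision `ε / (2ℓ)` in each factor suffices (`prod_mem_Icc_of_relative_error`).
Amplitude estimation reaches it with about `ℓ / ε` reflections about `|π_i⟩|0⟩`, each costing about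
`1 / √δ` walk steps. The `ℓ` factors together give `ℓ² / (√δ ε)`, up to logarithms from repetition
and error control.

Reflections. Let `Π` be the projection onto `𝒜` and `F = U†SU`. On `𝒜` the compression `ΠF` is the
symmetrized transition matrix `D`: it fixes `|π_i⟩|0⟩` and shrinks the orthogonal complement within
`𝒜` by `1 - δ`. The identity `(2 - W - W⁻¹) / 4 = 1 - D²` on `𝒜` (`System.gapOp_walk_apply`) carries
this gap over to the walk `W` without diagonalizing it. Up to a unitary factor its left side is `(1
- W)² / 4`. The average `K` of the first `2^n` powers of `W` satisfies `K (1 - W) = (1 - W^(2^n)) /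
2^n`, so `K² (2 - W - W⁻¹) / 4` has norm at most `4^(-n)`; this square is the source of `√δ` in
place of `δ`. Inverting `1 - D²` on the complement shows that `K^(2s)` shrinks it by `4^(-s)` once
`2^n ≥ 2 / √δ` (`norm_halfSumProd_pow_le`). A phase-estimation bit found in `|0⟩` applies `(1 +
W^(2^j)) / 2`, so the branch with all bits `0` carries `K^(2s)`. A phase on that branch, conjugated
by phase estimation, is a reflection up to `2 · 4^(-s)` (`approx_reflector`).

Preparation. Consecutive Gibbs states have squared overlap at least `α_i ≥ 1/2`
(`System.overlap_gibbs`). The `π/3` fixed-point search cubes the failure probability and needs only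
a lower bound on the overlap, so logarithmically many reflections per cooling step suffice.

Estimation. Rotating one qubit by `V_i` and tilting another marks the state with probability `α_i /
4`. Hence `k` Grover iterations lead to the marked probability `(1 + cos ((2k + 1) φ)) / 2` with
`cos φ = α_i / 2 - 1` and `φ ∈ [2, 5/2]`. For `k = 2^j` and `k = 2^j - 1`, `j ≤ J`, this probability
is measured to constant precision, and a search over a grid selects a `φ` consistent with all
measurements. By `two_pow_mul_abs_sub_le` every consistent candidate is within `2^(-J)` of the true
angle. A Chernoff bound and a union bound over the tests give the success probability. -/

/-- The Hilbert space of the qubits and the two registers, with its Euclidean norm. -/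
abbrev HState (Ω : Type u) [Fintype Ω] (m : ℕ) := PiLp 2 fun _ : Fin m → Bool => Reg Ω

/-! ### Gates and circuits as unitary operators -/

section GateMaps

variable {Ω : Type u} [Fintype Ω] [DecidableEq Ω] (S : System Ω) {ℓ m : ℕ}

/-- Each pattern arises from itself and from its flip at `t`. Summing over both values of the target
bit turns norm preservation of a one-qubit gate into a statement about each pair of patterns. -/
theorem sum_bits_update (t : Fin m) (f : (Fin m → Bool) → ℝ) :
    ∑ b, ∑ a : Bool, f (Function.update b t a) = 2 * ∑ b, f b := by
  have hinv : Function.Involutive fun b : Fin m → Bool => Function.update b t (!b t) := by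
    intro b; simp
  have h1 : ∀ b : Fin m → Bool, ∑ a : Bool, f (Function.update b t a)
      = f b + f (Function.update b t (!b t)) := by
    intro b
    rw [Fintype.sum_bool]
    cases h : b t
    · have : Function.update b t false = b := by rw [← h]; simp
      rw [this, add_comm]; simp
    · have : Function.update b t true = b := by rw [← h]; simp
      rw [this]; simp
  simp_rw [h1, Finset.sum_add_distrib]
  have := Equiv.sum_comp hinv.toPerm f
  simp only [Function.Involutive.coe_toPerm] at this
  rw [this]; ring

theorem sum_sq_norm_unitary (v : Matrix.unitaryGroup Bool ℂ) (x : Bool → ℂ) :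
    ∑ b : Bool, ‖∑ a : Bool, (v : Matrix Bool Bool ℂ) b a * x a‖ ^ 2 = ∑ a : Bool, ‖x a‖ ^ 2 := by
  have h := Matrix.UnitaryGroup.star_mul_self v
  have key : star ((v : Matrix Bool Bool ℂ).mulVec x) ⬝ᵥ ((v : Matrix Bool Bool ℂ).mulVec x)
      = star x ⬝ᵥ x := by
    rw [Matrix.star_mulVec, Matrix.dotProduct_mulVec, Matrix.vecMul_vecMul]
    rw [← Matrix.star_eq_conjTranspose, h, Matrix.vecMul_one]
  have conv : ∀ y : Bool → ℂ, star y ⬝ᵥ y = ((∑ a, ‖y a‖ ^ 2 : ℝ) : ℂ) := by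
    intro y
    simp only [dotProduct, Pi.star_apply, Complex.ofReal_sum]
    refine Finset.sum_congr rfl fun a _ => ?_
    simp [Complex.conj_mul']
  rw [conv, conv] at key
  exact_mod_cast key

theorem sum_sq_norm_coordinatewise (t : Fin m)
    (cond : (Fin m → Bool) → Prop) [DecidablePred cond]
    (hcond : ∀ b a, cond (Function.update b t a) ↔ cond b)
    (u : Ω × Ω → Matrix.unitaryGroup Bool ℂ) (ψ φ : QState Ω m)
    (h : ∀ b z, φ b z = if cond b then ∑ a : Bool, (u z : Matrix Bool Bool ℂ) (b t) a *
      ψ (Function.update b t a) z else ψ b z) :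
    ∑ b, ‖φ b‖ ^ 2 = ∑ b, ‖ψ b‖ ^ 2 := by
  have h2 : 2 * ∑ b, ‖φ b‖ ^ 2 = 2 * ∑ b, ‖ψ b‖ ^ 2 := by
    rw [← sum_bits_update t fun b => ‖φ b‖ ^ 2, ← sum_bits_update t fun b => ‖ψ b‖ ^ 2]
    refine Finset.sum_congr rfl fun b _ => ?_
    simp_rw [EuclideanSpace.norm_sq_eq]
    rw [Finset.sum_comm, Finset.sum_comm (s := Finset.univ (α := Bool))]
    refine Finset.sum_congr rfl fun z _ => ?_
    by_cases hc : cond b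
    · rw [← sum_sq_norm_unitary (u z) fun a => ψ (Function.update b t a) z]
      refine Finset.sum_congr rfl fun a _ => ?_
      rw [h, if_pos ((hcond b a).2 hc)]
      simp
    · refine Finset.sum_congr rfl fun a _ => ?_
      rw [h, if_neg (fun h' => hc ((hcond b a).1 h'))]
  linarith

/-- Every rotation conditioned on the first register has angles given by numbers in `[0, 1]`. -/
def System.WeightsLeOne (ℓ : ℕ) : Prop := ∀ i < ℓ, ∀ σ, S.weight i σ ≤ 1

variable {S}

theorem System.IsAnnealing.weightsLeOne {δ : ℝ} (h : S.IsAnnealing ℓ δ) : S.WeightsLeOne ℓ := by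
  intro i hi σ
  rw [System.weight, Real.exp_le_one_iff]
  have := mul_nonneg (sub_nonneg.2 (h.cooling i hi)) (h.energy_nonneg σ)
  linarith

theorem System.weight_pos (i : ℕ) (σ : Ω) : 0 < S.weight i σ := Real.exp_pos _

theorem System.rotation_mem_unitary {i : ℕ} {σ : Ω} (h : S.weight i σ ≤ 1) :
    (S.rotation i σ).map (fun x : ℝ => (x : ℂ)) ∈ Matrix.unitaryGroup Bool ℂ := by
  have h0 := (S.weight_pos i σ).le
  have hs : Real.sqrt (S.weight i σ) * Real.sqrt (S.weight i σ)
      + Real.sqrt (1 - S.weight i σ) * Real.sqrt (1 - S.weight i σ) = 1 := by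
    rw [Real.mul_self_sqrt h0, Real.mul_self_sqrt (by linarith)]; ring
  have hs' : (Real.sqrt (S.weight i σ) : ℂ) * Real.sqrt (S.weight i σ)
      + Real.sqrt (1 - S.weight i σ) * Real.sqrt (1 - S.weight i σ) = 1 := by exact_mod_cast hs
  rw [Matrix.mem_unitaryGroup_iff]
  ext a b
  cases a <;> cases b <;>
    simp [Matrix.mul_apply, System.rotation, Matrix.star_apply] <;>
    first | linear_combination hs' | ring

theorem Gate.sum_sq_norm_apply (hS : S.WeightsLeOne ℓ) (g : Gate ℓ m) (ψ : QState Ω m) :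
    ∑ b, ‖g.apply S ψ b‖ ^ 2 = ∑ b, ‖ψ b‖ ^ 2 := by
  cases g with
  | qubit ctrl t hcard ht v =>
    refine sum_sq_norm_coordinatewise t (fun b => ∀ c ∈ ctrl, b c = true) ?_ (fun _ => v) ψ _ ?_
    · intro b a
      refine forall₂_congr fun c hc => ?_
      rw [Function.update_of_ne]
      rintro rfl; exact ht hc
    · intro b z
      simp only [Gate.apply]
      split_ifs <;> simp
  | reflectZero c =>
    refine Finset.sum_congr rfl fun b _ => ?_
    simp only [Gate.apply]; split_ifs <;> simp
  | reflectStart c =>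
    refine Finset.sum_congr rfl fun b _ => ?_
    simp only [Gate.apply]; split_ifs <;> simp
  | rotate i hi t =>
    refine sum_sq_norm_coordinatewise t (fun _ => True) (by simp)
      (fun z => ⟨_, System.rotation_mem_unitary (hS i hi z.1)⟩) ψ _ ?_
    intro b z
    simp [Gate.apply]
  | walk i hi hi' c =>
    refine Finset.sum_congr rfl fun b _ => ?_
    simp only [Gate.apply]; split_ifs <;> simp

theorem Gate.apply_add (g : Gate ℓ m) (ψ φ : QState Ω m) :
    g.apply S (ψ + φ) = g.apply S ψ + g.apply S φ := by
  funext b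
  cases g with
  | qubit => simp only [Gate.apply, Pi.add_apply]; split_ifs <;> simp [add_add_add_comm]
  | reflectZero c => simp only [Gate.apply, Pi.add_apply]; split_ifs <;> simp
  | reflectStart c => simp only [Gate.apply, Pi.add_apply]; split_ifs <;> simp
  | rotate i hi t => ext z; simp [Gate.apply]; ring
  | walk i hi hi' c => simp only [Gate.apply, Pi.add_apply]; split_ifs <;> simp

theorem Gate.apply_smul (g : Gate ℓ m) (r : ℂ) (ψ : QState Ω m) :
    g.apply S (r • ψ) = r • g.apply S ψ := by
  funext b
  cases g with
  | qubit =>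
    simp only [Gate.apply, Pi.smul_apply]; split_ifs
    · rw [Finset.smul_sum]
      exact Finset.sum_congr rfl fun a _ => smul_comm _ _ _
    · rfl
  | reflectZero c => simp only [Gate.apply, Pi.smul_apply]; split_ifs <;> simp
  | reflectStart c => simp only [Gate.apply, Pi.smul_apply]; split_ifs <;> simp
  | rotate i hi t => ext z; simp [Gate.apply]; ring
  | walk i hi hi' c => simp only [Gate.apply, Pi.smul_apply]; split_ifs <;> simp

/-- A gate as a unitary operator. -/
def Gate.toIso (hS : S.WeightsLeOne ℓ) (g : Gate ℓ m) : HState Ω m ≃ₗᵢ[ℂ] HState Ω m :=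
  LinearIsometry.toLinearIsometryEquiv
    { toFun := fun ψ => WithLp.toLp 2 (g.apply S ψ.ofLp)
      map_add' := fun ψ φ => by simp [Gate.apply_add]
      map_smul' := fun r ψ => by simp [Gate.apply_smul]
      norm_map' := fun ψ => by
        rw [← sq_eq_sq₀ (norm_nonneg _) (norm_nonneg _)]
        rw [PiLp.norm_sq_eq_of_L2, PiLp.norm_sq_eq_of_L2]
        exact Gate.sum_sq_norm_apply hS g ψ.ofLp } rfl

theorem Gate.toIso_apply (hS : S.WeightsLeOne ℓ) (g : Gate ℓ m) (ψ : HState Ω m)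
    (b : Fin m → Bool) : g.toIso hS ψ b = g.apply S ψ.ofLp b := rfl

/-- A circuit as a unitary operator. -/
def circ (hS : S.WeightsLeOne ℓ) : List (Gate ℓ m) → (HState Ω m ≃ₗᵢ[ℂ] HState Ω m)
  | [] => 1
  | g :: c => circ hS c * g.toIso hS

variable (hS : S.WeightsLeOne ℓ)

@[simp] theorem circ_nil : circ hS ([] : List (Gate ℓ m)) = 1 := rfl

theorem circ_cons (g : Gate ℓ m) (c : List (Gate ℓ m)) :
    circ hS (g :: c) = circ hS c * g.toIso hS := rfl

theorem circ_append (c d : List (Gate ℓ m)) : circ hS (c ++ d) = circ hS d * circ hS c := by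
  induction c with
  | nil => simp
  | cons g c ih => rw [List.cons_append, circ_cons, ih, circ_cons, mul_assoc]

theorem circ_singleton (g : Gate ℓ m) : circ hS [g] = g.toIso hS := by simp [circ_cons]

theorem circ_foldl (c : List (Gate ℓ m)) (ψ : QState Ω m) :
    c.foldl (fun ψ g => g.apply S ψ) ψ = (circ hS c (WithLp.toLp 2 ψ)).ofLp := by
  induction c generalizing ψ with
  | nil => rfl
  | cons g c ih => rw [List.foldl_cons, ih, circ_cons]; rfl

theorem runCircuit_eq (c : List (Gate ℓ m)) (b : Fin m → Bool) :
    runCircuit S c b = circ hS c (WithLp.toLp 2 (initial S)) b := by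
  rw [runCircuit, circ_foldl hS]

end GateMaps

/-! ### The symmetrized transition matrix and its spectral gap -/

section Discriminant

variable {Ω : Type u} [Fintype Ω] [DecidableEq Ω]

/-- A maximum principle: at a maximum of `g`, the average of `g` with the strictly positive weights
of a row of `P ^ k` equals that maximum, so `g` equals it everywhere. -/
theorem eq_of_mulVec_eq_self {P : Matrix Ω Ω ℝ} (hP : P ∈ Matrix.rowStochastic ℝ Ω)
    (hprim : P.IsPrimitive) {g : Ω → ℝ} (hg : P.mulVec g = g) (x y : Ω) : g x = g y := by
  obtain ⟨k, -, hk⟩ := hprim.exists_pos_pow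
  have hpow : ∀ n : ℕ, (P ^ n).mulVec g = g := by
    intro n
    induction n with
    | zero => simp
    | succ n ih => rw [pow_succ, ← Matrix.mulVec_mulVec, hg, ih]
  have hst : P ^ k ∈ Matrix.rowStochastic ℝ Ω := pow_mem hP k
  have hne : Nonempty Ω := ⟨x⟩
  obtain ⟨z, hz⟩ := Finite.exists_max g
  have hsum : ∑ w, (P ^ k) z w * (g z - g w) = 0 := by
    have h1 : ∑ w, (P ^ k) z w * g w = g z := congrFun (hpow k) z
    simp_rw [mul_sub, Finset.sum_sub_distrib, ← Finset.sum_mul,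
      Matrix.sum_row_of_mem_rowStochastic hst, h1]
    ring
  have hall : ∀ w, g w = g z := by
    intro w
    have := (Finset.sum_eq_zero_iff_of_nonneg
      (fun w _ => mul_nonneg (hk z w).le (sub_nonneg.2 (hz w)))).1 hsum w (Finset.mem_univ w)
    rcases mul_eq_zero.1 this with h | h
    · exact absurd h (hk z w).ne'
    · linarith
  rw [hall x, hall y]

/-- The symmetrized transition matrix of a reversible chain. -/
def discriminant (P : Matrix Ω Ω ℝ) : Matrix Ω Ω ℝ :=
  Matrix.of fun x y => Real.sqrt (P x y) * Real.sqrt (P y x)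

theorem discriminant_isHermitian (P : Matrix Ω Ω ℝ) : (discriminant P).IsHermitian := by
  ext x y
  simp [discriminant, mul_comm]

variable {P : Matrix Ω Ω ℝ} {p : Ω → ℝ} {δ : ℝ}

theorem discriminant_eq (hP : P ∈ Matrix.rowStochastic ℝ Ω) (hp : ∀ x, 0 < p x)
    (hrev : ∀ x y, p x * P x y = p y * P y x) (x y : Ω) :
    discriminant P x y = Real.sqrt (p x) * P x y / Real.sqrt (p y) := by
  have hx := Real.sqrt_pos.2 (hp x)
  have hy := Real.sqrt_pos.2 (hp y)
  have h0 := hP.1 x y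
  simp only [discriminant, Matrix.of_apply]
  rw [← Real.sqrt_mul h0, Real.sqrt_eq_iff_mul_self_eq (mul_nonneg h0 (hP.1 y x)) (by positivity)]
  have h1 : Real.sqrt (p x) * P x y / Real.sqrt (p y) * (Real.sqrt (p x) * P x y / Real.sqrt (p y))
      = (Real.sqrt (p x) * Real.sqrt (p x)) * P x y * P x y
        / (Real.sqrt (p y) * Real.sqrt (p y)) := by
    field_simp
  rw [h1, Real.mul_self_sqrt (hp x).le, Real.mul_self_sqrt (hp y).le, eq_div_iff (hp y).ne']
  linear_combination -(P x y) * hrev x y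

/-- By detailed balance `D = p^(1/2) P p^(-1/2)`, so dividing an eigenvector of `D` by `√p` gives an
eigenvector of `P` with the same eigenvalue. For eigenvalue `1` the quotient is constant, so the
eigenvector is a multiple of `√p` and orthogonal to `f`; all other eigenvalues obey the gap. The
bound follows by expanding `f` in an eigenbasis. -/
theorem sum_sq_discriminant_real_le (hP : P ∈ Matrix.rowStochastic ℝ Ω) (hprim : P.IsPrimitive)
    (hp : ∀ x, 0 < p x) (hrev : ∀ x y, p x * P x y = p y * P y x)
    (hgap : ∀ μ : ℝ, Module.End.HasEigenvalue (Matrix.toLin' P) μ → μ ≠ 1 → |μ| ≤ 1 - δ)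
    (f : Ω → ℝ) (hf : ∑ x, Real.sqrt (p x) * f x = 0) :
    ∑ x, (∑ y, discriminant P x y * f y) ^ 2 ≤ (1 - δ) ^ 2 * ∑ x, f x ^ 2 := by
  have hD := discriminant_isHermitian P
  set e := hD.eigenvectorBasis with he
  set F : EuclideanSpace ℝ Ω := WithLp.toLp 2 f with hF
  set DF : EuclideanSpace ℝ Ω := WithLp.toLp 2 ((discriminant P).mulVec f) with hDF
  have hsq : ∀ x, Real.sqrt (p x) ≠ 0 := fun x => (Real.sqrt_pos.2 (hp x)).ne'
  have hinner : ∀ j, inner ℝ (e j) DF = hD.eigenvalues j * inner ℝ (e j) F := by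
    intro j
    rw [EuclideanSpace.inner_eq_star_dotProduct, EuclideanSpace.inner_eq_star_dotProduct]
    simp only [star_trivial, hDF, hF]
    have h1 := hD.mulVec_eigenvectorBasis j
    rw [dotProduct_comm, Matrix.dotProduct_mulVec, ← Matrix.mulVec_transpose]
    have h2 : (discriminant P).transpose = discriminant P := by simpa using! hD
    rw [h2, h1, smul_dotProduct, dotProduct_comm, smul_eq_mul]
  have hPg : ∀ j, P.mulVec (fun x => e j x / Real.sqrt (p x))
      = hD.eigenvalues j • fun x => e j x / Real.sqrt (p x) := by
    intro j
    funext x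
    have h1 := congrFun (hD.mulVec_eigenvectorBasis j) x
    simp only [Matrix.mulVec, dotProduct, Pi.smul_apply, smul_eq_mul] at h1 ⊢
    rw [← mul_div_assoc, eq_div_iff (hsq x), ← h1, Finset.sum_mul]
    refine Finset.sum_congr rfl fun y _ => ?_
    rw [discriminant_eq hP hp hrev]
    ring
  have hbound : ∀ j, ‖inner ℝ (e j) DF‖ ^ 2 ≤ (1 - δ) ^ 2 * ‖inner ℝ (e j) F‖ ^ 2 := by
    intro j
    rw [hinner j]
    by_cases h1 : hD.eigenvalues j = 1
    · have hc := hPg j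
      rw [h1, one_smul] at hc
      have hconst := eq_of_mulVec_eq_self hP hprim hc
      have h0 : inner ℝ (e j) F = 0 := by
        rw [EuclideanSpace.inner_eq_star_dotProduct]
        simp only [star_trivial, hF, dotProduct]
        rcases isEmpty_or_nonempty Ω with hΩ | ⟨⟨x₀⟩⟩
        · simp
        · have : ∀ x, f x * e j x = (e j x₀ / Real.sqrt (p x₀)) * (Real.sqrt (p x) * f x) := by
            intro x
            rw [← hconst x x₀]
            field_simp [hsq x]
          simp_rw [this, ← Finset.mul_sum, hf, mul_zero]
      rw [h0]; simp
    · have hne : (fun x => e j x / Real.sqrt (p x)) ≠ 0 := by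
        intro h0
        have : e j = 0 := by
          ext x
          have := congrFun h0 x
          simpa [hsq x] using this
        have hn := e.orthonormal.1 j
        rw [this] at hn; simp at hn
      have hev : Module.End.HasEigenvalue (Matrix.toLin' P) (hD.eigenvalues j) := by
        refine Module.End.hasEigenvalue_of_hasEigenvector
          (x := fun x => e j x / Real.sqrt (p x)) ⟨?_, hne⟩
        rw [Module.End.mem_eigenspace_iff, Matrix.toLin'_apply]
        exact hPg j
      have h2 := hgap _ hev h1
      rw [norm_mul, mul_pow]
      refine mul_le_mul_of_nonneg_right ?_ (by positivity)
      rw [Real.norm_eq_abs]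
      exact pow_le_pow_left₀ (abs_nonneg _) h2 2
  have h1 := e.sum_sq_norm_inner_right DF
  have h2 := e.sum_sq_norm_inner_right F
  have h3 : ‖DF‖ ^ 2 ≤ (1 - δ) ^ 2 * ‖F‖ ^ 2 := by
    rw [← h1, ← h2, Finset.mul_sum]
    exact Finset.sum_le_sum fun j _ => hbound j
  rw [EuclideanSpace.norm_sq_eq, EuclideanSpace.norm_sq_eq] at h3
  simpa [hDF, hF, Matrix.mulVec, dotProduct] using h3

theorem sum_sq_discriminant_le (hP : P ∈ Matrix.rowStochastic ℝ Ω) (hprim : P.IsPrimitive)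
    (hp : ∀ x, 0 < p x) (hrev : ∀ x y, p x * P x y = p y * P y x)
    (hgap : ∀ μ : ℝ, Module.End.HasEigenvalue (Matrix.toLin' P) μ → μ ≠ 1 → |μ| ≤ 1 - δ)
    (f : Ω → ℂ) (hf : ∑ x, (Real.sqrt (p x) : ℂ) * f x = 0) :
    ∑ x, ‖∑ y, (discriminant P x y : ℂ) * f y‖ ^ 2 ≤ (1 - δ) ^ 2 * ∑ x, ‖f x‖ ^ 2 := by
  have hre := sum_sq_discriminant_real_le hP hprim hp hrev hgap (fun x => (f x).re)
    (by simpa using congrArg Complex.re hf)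
  have him := sum_sq_discriminant_real_le hP hprim hp hrev hgap (fun x => (f x).im)
    (by simpa using congrArg Complex.im hf)
  have hn : ∀ z : ℂ, ‖z‖ ^ 2 = z.re ^ 2 + z.im ^ 2 := by
    intro z; rw [Complex.sq_norm, Complex.normSq_apply]; ring
  simp_rw [hn, Finset.sum_add_distrib, mul_add]
  refine add_le_add ?_ ?_
  · simpa using hre
  · simpa using him

end Discriminant

/-! ### Gibbs states, the walk and the subspace `𝒜` -/

namespace System

variable {Ω : Type u} [Fintype Ω] [DecidableEq Ω] (S : System Ω)

theorem Z_pos (i : ℕ) : 0 < S.Z i :=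
  have : Nonempty Ω := ⟨S.zero⟩
  Finset.sum_pos (fun _ _ => Real.exp_pos _) Finset.univ_nonempty

theorem boltzmann_pos (i : ℕ) (σ : Ω) : 0 < S.boltzmann i σ :=
  div_pos (Real.exp_pos _) (S.Z_pos i)

theorem sum_boltzmann (i : ℕ) : ∑ σ, S.boltzmann i σ = 1 := by
  simp_rw [boltzmann, ← Finset.sum_div]
  exact div_self (S.Z_pos i).ne'

theorem inner_ket (x y : Ω) (v : Reg Ω) : inner ℂ (ket x y) v = v (x, y) := by
  simp [ket, EuclideanSpace.inner_single_left]

theorem ket_apply (x y : Ω) (z : Ω × Ω) : (ket x y : Reg Ω) z = if z = (x, y) then 1 else 0 := by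
  simp [ket]

theorem eq_sum_ket {v : Reg Ω} (h : ∀ z : Ω × Ω, z.2 ≠ S.zero → v z = 0) :
    v = ∑ x, v (x, S.zero) • ket x S.zero := by
  ext ⟨x, y⟩
  simp only [WithLp.ofLp_sum, WithLp.ofLp_smul, Finset.sum_apply, Pi.smul_apply, ket_apply,
    smul_eq_mul, Prod.mk.injEq]
  by_cases hy : y = S.zero
  · subst hy; simp
  · rw [h (x, y) hy]; simp [hy]

theorem mem_spaceA {v : Reg Ω} : v ∈ S.spaceA ↔ ∀ z : Ω × Ω, z.2 ≠ S.zero → v z = 0 := by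
  constructor
  · intro hv z hz
    refine Submodule.span_induction (p := fun v _ => v z = 0) ?_ ?_ ?_ ?_ hv
    · rintro _ ⟨x, rfl⟩
      rw [ket_apply, if_neg]
      rintro rfl; exact hz rfl
    · simp
    · intro a b _ _ ha hb; simp [ha, hb]
    · intro c a _ ha; simp [ha]
  · intro h
    rw [S.eq_sum_ket h]
    exact Submodule.sum_mem _ fun x _ => Submodule.smul_mem _ _ (Submodule.subset_span ⟨x, rfl⟩)

theorem starProjection_spaceA_apply (v : Reg Ω) (z : Ω × Ω) :
    S.spaceA.starProjection v z = if z.2 = S.zero then v z else 0 := by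
  have : S.spaceA.starProjection v
      = WithLp.toLp 2 fun z : Ω × Ω => if z.2 = S.zero then v z else 0 := by
    refine Submodule.eq_starProjection_of_mem_orthogonal (K := S.spaceA) ?_ ?_
    · rw [mem_spaceA]; intro z hz; simp [hz]
    · rw [Submodule.mem_orthogonal]
      intro w hw
      rw [mem_spaceA] at hw
      rw [EuclideanSpace.inner_eq_star_dotProduct, dotProduct]
      refine Finset.sum_eq_zero fun z _ => ?_
      by_cases hz : z.2 = S.zero
      · simp [hz]
      · simp [hw z hz]
  rw [this]

/-- The state `|π_i⟩|0⟩`. -/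
def gibbs (i : ℕ) : Reg Ω := ∑ x : Ω, ((Real.sqrt (S.boltzmann i x) : ℝ) : ℂ) • ket x S.zero

theorem gibbs_apply (i : ℕ) (z : Ω × Ω) :
    S.gibbs i z = if z.2 = S.zero then ((Real.sqrt (S.boltzmann i z.1) : ℝ) : ℂ) else 0 := by
  obtain ⟨x, y⟩ := z
  simp only [gibbs, WithLp.ofLp_sum, WithLp.ofLp_smul, Finset.sum_apply, Pi.smul_apply, ket_apply,
    smul_eq_mul, Prod.mk.injEq]
  by_cases hy : y = S.zero
  · subst hy; simp
  · simp [hy]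

theorem gibbs_mem (i : ℕ) : S.gibbs i ∈ S.spaceA := by
  rw [mem_spaceA]; intro z hz; rw [gibbs_apply, if_neg hz]

theorem sum_spaceA {M : Type*} [AddCommMonoid M] (f : Ω × Ω → M)
    (hf : ∀ z : Ω × Ω, z.2 ≠ S.zero → f z = 0) : ∑ z, f z = ∑ x, f (x, S.zero) := by
  rw [Fintype.sum_prod_type]
  refine Finset.sum_congr rfl fun x _ => ?_
  exact Fintype.sum_eq_single _ fun y hy => hf (x, y) hy

theorem norm_sq_of_mem_spaceA {v : Reg Ω} (hv : v ∈ S.spaceA) :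
    ‖v‖ ^ 2 = ∑ x, ‖v (x, S.zero)‖ ^ 2 := by
  rw [EuclideanSpace.norm_sq_eq]
  refine S.sum_spaceA _ fun z hz => ?_
  rw [S.mem_spaceA.1 hv z hz]; simp

theorem inner_gibbs (i : ℕ) (v : Reg Ω) :
    inner ℂ (S.gibbs i) v = ∑ x, (Real.sqrt (S.boltzmann i x) : ℂ) * v (x, S.zero) := by
  rw [gibbs, sum_inner]
  refine Finset.sum_congr rfl fun x _ => ?_
  rw [inner_smul_left, inner_ket]
  simp

theorem norm_gibbs (i : ℕ) : ‖S.gibbs i‖ = 1 := by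
  have h : ‖S.gibbs i‖ ^ 2 = 1 := by
    rw [S.norm_sq_of_mem_spaceA (S.gibbs_mem i), ← S.sum_boltzmann i]
    refine Finset.sum_congr rfl fun x _ => ?_
    simp [gibbs_apply, Real.sq_sqrt (S.boltzmann_pos i x).le]
  nlinarith [norm_nonneg (S.gibbs i)]

/-- The swap conjugated by the quantum update. -/
def flip (i : ℕ) : Reg Ω ≃ₗᵢ[ℂ] Reg Ω := ((S.U i).trans swap).trans (S.U i).symm

theorem swap_apply (v : Reg Ω) (z : Ω × Ω) : swap v z = v (z.2, z.1) := rfl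

theorem flip_flip (i : ℕ) (v : Reg Ω) : S.flip i (S.flip i v) = v := by
  have : ∀ w : Reg Ω, swap (swap w) = w := by intro w; ext z; rfl
  simp [flip, this]

theorem flip_symm (i : ℕ) (v : Reg Ω) : (S.flip i).symm v = S.flip i v := by
  rw [LinearIsometryEquiv.symm_apply_eq, flip_flip]

theorem walk_apply (i : ℕ) (v : Reg Ω) :
    S.walk i v = S.flip i (S.spaceA.reflection (S.flip i (S.spaceA.reflection v))) := by
  have := Submodule.reflection_map_apply (S.flip i) S.spaceA (S.spaceA.reflection v)
  rw [flip_symm] at this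
  exact this

/-- Conjugating a product of two reflections by one of them reverses their order. Inverse walks
therefore cost no gates beyond walks and reflections about `𝒜`. -/
theorem walk_inv_apply (i : ℕ) (v : Reg Ω) :
    (S.walk i)⁻¹ v = S.spaceA.reflection (S.walk i (S.spaceA.reflection v)) := by
  refine (S.walk i).symm_apply_eq.2 ?_
  simp [walk_apply, flip_flip]

variable {S} {δ : ℝ} {i : ℕ}

theorem update_apply (h : S.IsChain δ i) {v : Reg Ω} (hv : v ∈ S.spaceA) (z : Ω × Ω) :
    S.U i v z = (Real.sqrt (S.P i z.1 z.2) : ℂ) * v (z.1, S.zero) := by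
  have hv' := S.eq_sum_ket (S.mem_spaceA.1 hv)
  obtain ⟨x, y⟩ := z
  conv_lhs => rw [hv']
  simp only [map_sum, map_smul, h.update, WithLp.ofLp_sum, WithLp.ofLp_smul, Finset.sum_apply,
    Pi.smul_apply, ket_apply, smul_eq_mul, Prod.mk.injEq]
  rw [Finset.sum_eq_single x]
  · simp [mul_comm]
  · intro w _ hw; simp [hw.symm]
  · simp

/-- Detailed balance makes the amplitudes `√(π_i(x) P_i(x, y))` of the updated Gibbs state symmetric
under the swap. -/
theorem flip_gibbs (h : S.IsChain δ i) : S.flip i (S.gibbs i) = S.gibbs i := by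
  have : swap (S.U i (S.gibbs i)) = S.U i (S.gibbs i) := by
    ext z
    rw [swap_apply, update_apply h (S.gibbs_mem i), update_apply h (S.gibbs_mem i)]
    simp only [gibbs_apply, if_true]
    norm_cast
    rw [← Real.sqrt_mul (h.stochastic.1 _ _), ← Real.sqrt_mul (h.stochastic.1 _ _), mul_comm,
      ← h.reversible, mul_comm]
  simp [flip, this]

theorem walk_gibbs (h : S.IsChain δ i) : S.walk i (S.gibbs i) = S.gibbs i := by
  rw [walk_apply, Submodule.reflection_mem_subspace_eq_self (S.gibbs_mem i), flip_gibbs h,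
    Submodule.reflection_mem_subspace_eq_self (S.gibbs_mem i), flip_gibbs h]

/-- This is the link from the walk to the chain: compressed to `𝒜`, the conjugated swap becomes the
symmetrized transition matrix. -/
theorem starProjection_flip_apply (h : S.IsChain δ i) {v : Reg Ω} (hv : v ∈ S.spaceA) (x : Ω) :
    S.spaceA.starProjection (S.flip i v) (x, S.zero)
      = ∑ y, (discriminant (S.P i) x y : ℂ) * v (y, S.zero) := by
  rw [starProjection_spaceA_apply, if_pos rfl, ← inner_ket]
  have h1 : inner ℂ (ket x S.zero) (S.flip i v)
      = inner ℂ (S.U i (ket x S.zero)) (swap (S.U i v)) := by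
    rw [← LinearIsometryEquiv.inner_map_map (S.U i)]
    simp [flip]
  rw [h1, h.update, sum_inner]
  refine Finset.sum_congr rfl fun y _ => ?_
  rw [inner_smul_left, inner_ket, swap_apply, update_apply h hv]
  simp [discriminant]
  ring

theorem norm_starProjection_flip_le (h : S.IsChain δ i) (hδ : δ ≤ 1) {v : Reg Ω}
    (hv : v ∈ S.spaceA) (hvg : inner ℂ (S.gibbs i) v = 0) :
    ‖S.spaceA.starProjection (S.flip i v)‖ ≤ (1 - δ) * ‖v‖ := by
  refine le_of_sq_le_sq ?_ (mul_nonneg (by linarith) (norm_nonneg _))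
  rw [mul_pow, S.norm_sq_of_mem_spaceA (Submodule.starProjection_apply_mem _ _),
    S.norm_sq_of_mem_spaceA hv]
  simp_rw [starProjection_flip_apply h hv]
  refine sum_sq_discriminant_le h.stochastic h.ergodic (S.boltzmann_pos i) h.reversible h.gap _ ?_
  rw [← inner_gibbs, hvg]

theorem inner_gibbs_starProjection_flip (h : S.IsChain δ i) (v : Reg Ω) :
    inner ℂ (S.gibbs i) (S.spaceA.starProjection (S.flip i v)) = inner ℂ (S.gibbs i) v := by
  rw [← Submodule.inner_starProjection_left_eq_right,
    Submodule.starProjection_eq_self_iff.2 (S.gibbs_mem i)]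
  conv_lhs => rw [← flip_gibbs h, LinearIsometryEquiv.inner_map_map]

end System

/-! ### Averages of powers of a unitary operator -/

section Averages

variable {E : Type*} [NormedAddCommGroup E] [InnerProductSpace ℂ E]

/-- The operator `∏_{k < j} (1 + T k) / 2`, later factors applied last. -/
def halfSumProd (T : ℕ → (E ≃ₗᵢ[ℂ] E)) : ℕ → Module.End ℂ E
  | 0 => 1
  | j + 1 => ((1 / 2 : ℂ) • (1 + (T j).toLinearEquiv.toLinearMap)) * halfSumProd T j

/-- The operator of a linear isometry in the ring of endomorphisms. -/
abbrev toEnd (W : E ≃ₗᵢ[ℂ] E) : Module.End ℂ E := W.toLinearEquiv.toLinearMap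

theorem toEnd_mul (V W : E ≃ₗᵢ[ℂ] E) : toEnd (V * W) = toEnd V * toEnd W := rfl

theorem toEnd_one : toEnd (1 : E ≃ₗᵢ[ℂ] E) = 1 := rfl

theorem toEnd_pow (W : E ≃ₗᵢ[ℂ] E) (n : ℕ) : toEnd (W ^ n) = toEnd W ^ n := by
  induction n with
  | zero => rfl
  | succ n ih => rw [pow_succ, pow_succ, toEnd_mul, ih]

theorem toEnd_mul_inv (W : E ≃ₗᵢ[ℂ] E) : toEnd W * toEnd W⁻¹ = 1 := by
  rw [← toEnd_mul, mul_inv_cancel, toEnd_one]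

theorem toEnd_inv_mul (W : E ≃ₗᵢ[ℂ] E) : toEnd W⁻¹ * toEnd W = 1 := by
  rw [← toEnd_mul, inv_mul_cancel, toEnd_one]

theorem halfSumProd_succ (T : ℕ → (E ≃ₗᵢ[ℂ] E)) (j : ℕ) :
    halfSumProd T (j + 1) = ((1 / 2 : ℂ) • (1 + toEnd (T j))) * halfSumProd T j := rfl

theorem halfSumProd_add (T : ℕ → (E ≃ₗᵢ[ℂ] E)) (n k : ℕ) :
    halfSumProd T (n + k) = halfSumProd (fun j => T (n + j)) k * halfSumProd T n := by
  induction k with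
  | zero => simp [halfSumProd]
  | succ k ih => rw [← add_assoc, halfSumProd_succ, ih, halfSumProd_succ, mul_assoc]

theorem halfSumProd_congr {T T' : ℕ → (E ≃ₗᵢ[ℂ] E)} {n : ℕ} (h : ∀ j < n, T j = T' j) :
    halfSumProd T n = halfSumProd T' n := by
  induction n with
  | zero => rfl
  | succ n ih =>
    rw [halfSumProd_succ, halfSumProd_succ, h n n.lt_succ_self,
      ih fun j hj => h j (hj.trans n.lt_succ_self)]

theorem halfSumProd_mul {T : ℕ → (E ≃ₗᵢ[ℂ] E)} {n : ℕ} (h : ∀ j, T j = T (j % n)) (r : ℕ) :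
    halfSumProd T (n * r) = halfSumProd T n ^ r := by
  induction r with
  | zero => rfl
  | succ r ih =>
    rw [mul_add, mul_one, halfSumProd_add, ih, pow_succ']
    congr 1
    refine halfSumProd_congr fun j hj => ?_
    rw [h (n * r + j), h j, Nat.mul_add_mod]

theorem halfSumProd_apply_of_fixed {T : ℕ → (E ≃ₗᵢ[ℂ] E)} {v : E} (h : ∀ j, T j v = v) (n : ℕ) :
    halfSumProd T n v = v := by
  induction n with
  | zero => rfl
  | succ n ih =>
    rw [halfSumProd_succ, Module.End.mul_apply, ih]
    simp only [LinearMap.smul_apply, LinearMap.add_apply, Module.End.one_apply,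
      LinearEquiv.coe_coe, LinearIsometryEquiv.coe_toLinearEquiv, h]
    module

variable (W : E ≃ₗᵢ[ℂ] E)

theorem commute_halfSumProd (n : ℕ) {x : Module.End ℂ E} (hx : Commute x (toEnd W)) :
    Commute x (halfSumProd (fun j => W ^ 2 ^ j) n) := by
  induction n with
  | zero => exact Commute.one_right x
  | succ n ih =>
    rw [halfSumProd_succ, toEnd_pow]
    exact (((Commute.one_right x).add_right (hx.pow_right _)).smul_right _).mul_right ih

/-- The product telescopes through `(1 + W^(2^n)) (1 - W^(2^n)) = 1 - W^(2^(n + 1))`. -/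
theorem halfSumProd_mul_one_sub (n : ℕ) :
    halfSumProd (fun j => W ^ 2 ^ j) n * (1 - toEnd W)
      = (1 / 2 ^ n : ℂ) • (1 - toEnd W ^ 2 ^ n) := by
  induction n with
  | zero => simp [halfSumProd]
  | succ n ih =>
    rw [halfSumProd_succ, mul_assoc, ih, toEnd_pow, smul_mul_smul_comm]
    congr 1
    · rw [pow_succ]; field_simp
    · rw [pow_succ 2 n, pow_mul]; noncomm_ring

/-- The operator `(2 - W - W⁻¹) / 4`. -/
def gapOp : Module.End ℂ E := (1 / 4 : ℂ) • (1 + 1 - toEnd W - toEnd W⁻¹)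

/-- The square of `1 - W` is exposed so that each of two copies of the average can absorb one
factor. -/
theorem gapOp_eq : gapOp W = (-(1 / 4) : ℂ) • (toEnd W⁻¹ * (1 - toEnd W) ^ 2) := by
  have h : toEnd W⁻¹ * (1 - toEnd W) ^ 2
      = toEnd W⁻¹ - 2 * (toEnd W⁻¹ * toEnd W) + (toEnd W⁻¹ * toEnd W) * toEnd W := by
    noncomm_ring
  rw [h, toEnd_inv_mul, gapOp, neg_smul, ← smul_neg]
  congr 1
  noncomm_ring

theorem commute_gapOp : Commute (gapOp W) (toEnd W) := by
  have h : Commute (toEnd W⁻¹) (toEnd W) := by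
    rw [Commute, SemiconjBy, toEnd_inv_mul, toEnd_mul_inv]
  exact (((((Commute.one_left _).add_left (Commute.one_left _))).sub_left (Commute.refl _)).sub_left h).smul_left _

/-- Each factor `K (1 - W)` is `2^(-n)` times an operator of norm at most `2`; the two factors `2`
cancel the `1/4` in `gapOp`. -/
theorem norm_halfSumProd_sq_gapOp_le (n : ℕ) (x : E) :
    ‖(halfSumProd (fun j => W ^ 2 ^ j) n ^ 2 * gapOp W : Module.End ℂ E) x‖ ≤ 1 / (2 ^ n) ^ 2 * ‖x‖ := by
  set K := halfSumProd (fun j => W ^ 2 ^ j) n with hK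
  have hc : Commute (1 - toEnd W) K :=
    commute_halfSumProd W n ((Commute.one_left _).sub_left (Commute.refl _))
  have hci : Commute (toEnd W⁻¹) K := commute_halfSumProd W n (by
    rw [Commute, SemiconjBy, toEnd_inv_mul, toEnd_mul_inv])
  have h1 : K ^ 2 * gapOp W = (-(1 / 4) : ℂ) • (toEnd W⁻¹ * (K * (1 - toEnd W)) ^ 2) := by
    rw [gapOp_eq, mul_smul_comm, hc.symm.mul_pow, ← mul_assoc, ← (hci.pow_right 2).eq, mul_assoc]
  rw [h1, halfSumProd_mul_one_sub, smul_pow, mul_smul_comm, smul_smul]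
  set V : Module.End ℂ E := 1 - toEnd W ^ 2 ^ n with hV
  rw [sq V]
  have h2 : ∀ y : E, ‖V y‖ ≤ 2 * ‖y‖ := by
    intro y
    rw [hV, ← toEnd_pow]
    calc ‖y - (W ^ 2 ^ n) y‖ ≤ ‖y‖ + ‖(W ^ 2 ^ n) y‖ := norm_sub_le _ _
      _ = 2 * ‖y‖ := by rw [LinearIsometryEquiv.norm_map]; ring
  have h3 : ‖(toEnd W⁻¹ * (V * V)) x‖ ≤ 4 * ‖x‖ := by
    simp only [Module.End.mul_apply]
    calc ‖W⁻¹ (V (V x))‖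
        = ‖V (V x)‖ := LinearIsometryEquiv.norm_map _ _
      _ ≤ 2 * ‖V x‖ := h2 _
      _ ≤ 2 * (2 * ‖x‖) := by gcongr; exact h2 x
      _ = 4 * ‖x‖ := by ring
  rw [LinearMap.smul_apply, norm_smul]
  have h4 : ‖(-(1 / 4) * (1 / 2 ^ n) ^ 2 : ℂ)‖ = 1 / 4 * (1 / (2 ^ n) ^ 2) := by
    simp
  rw [h4]
  calc _ ≤ 1 / 4 * (1 / (2 ^ n) ^ 2) * (4 * ‖x‖) := by gcongr
    _ = _ := by ring

theorem norm_pow_apply_le {N : Module.End ℂ E} {c : ℝ} (hc : 0 ≤ c) (h : ∀ x, ‖N x‖ ≤ c * ‖x‖)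
    (s : ℕ) (x : E) : ‖(N ^ s) x‖ ≤ c ^ s * ‖x‖ := by
  induction s with
  | zero => simp
  | succ s ih =>
    rw [pow_succ', Module.End.mul_apply]
    calc _ ≤ c * ‖(N ^ s) x‖ := h _
      _ ≤ c * (c ^ s * ‖x‖) := by gcongr
      _ = _ := by ring

variable [FiniteDimensional ℂ E]

/-- On a subspace on which `(2 - W - W⁻¹) / 4` is invertible with inverse of norm `1 / δ`, averages
over `2 ^ n ≥ 2 / √δ` powers of `W` are contractions in the mean. -/
theorem norm_halfSumProd_pow_le (A : Submodule ℂ E) {δ : ℝ} (hδ : 0 < δ)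
    (hA : ∀ v ∈ A, gapOp W v ∈ A) (hgap : ∀ v ∈ A, δ * ‖v‖ ≤ ‖gapOp W v‖) {n : ℕ}
    (hn : 4 ≤ (2 ^ n) ^ 2 * δ) (s : ℕ) {v : E} (hv : v ∈ A) :
    ‖(halfSumProd (fun j => W ^ 2 ^ j) n ^ (2 * s)) v‖ ≤ (1 / 4) ^ s * ‖v‖ := by
  -- The lower bound makes `gapOp W` injective on `A`, hence surjective there in finite dimension.
  have hpre : ∀ v ∈ A, ∃ w ∈ A, gapOp W w = v := by
    have hinj : Function.Injective ((gapOp W).restrict hA) := by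
      rw [← LinearMap.ker_eq_bot, LinearMap.ker_eq_bot']
      intro w hw
      have h1 : gapOp W w = 0 := by simpa using congrArg Subtype.val hw
      have h2 := hgap w w.2
      rw [h1, norm_zero] at h2
      have : ‖(w : E)‖ = 0 := by nlinarith [norm_nonneg (w : E)]
      exact Subtype.ext (norm_eq_zero.1 this)
    intro v hv
    obtain ⟨w, hw⟩ := LinearMap.injective_iff_surjective.1 hinj ⟨v, hv⟩
    exact ⟨w, w.2, by simpa using congrArg Subtype.val hw⟩
  -- The averages are not assumed to preserve `A`, so a one-step contraction could not be iterated
  -- on it. Instead all `s` inverses of `gapOp W` are taken first, inside `A`; the factors `K²` then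
  -- pair up with them by commutation, on the whole space.
  have hpow : ∀ s : ℕ, ∀ v ∈ A, ∃ w ∈ A, (gapOp W ^ s) w = v ∧ δ ^ s * ‖w‖ ≤ ‖v‖ := by
    intro s
    induction s with
    | zero => intro v hv; exact ⟨v, hv, by simp⟩
    | succ s ih =>
      intro v hv
      obtain ⟨w, hw, hwv, hle⟩ := ih v hv
      obtain ⟨z, hz, hzw⟩ := hpre w hw
      refine ⟨z, hz, by rw [pow_succ, Module.End.mul_apply, hzw, hwv], ?_⟩
      have := hgap z hz
      rw [hzw] at this
      calc δ ^ (s + 1) * ‖z‖ = δ ^ s * (δ * ‖z‖) := by ring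
        _ ≤ δ ^ s * ‖w‖ := by gcongr
        _ ≤ ‖v‖ := hle
  obtain ⟨w, -, hwv, hle⟩ := hpow s v hv
  set K := halfSumProd (fun j => W ^ 2 ^ j) n with hK
  have hc : Commute (K ^ 2) (gapOp W) :=
    ((commute_halfSumProd W n (commute_gapOp W)).pow_right 2).symm
  have h1 : (K ^ (2 * s)) v = ((K ^ 2 * gapOp W) ^ s) w := by
    rw [← hwv, hc.mul_pow, Module.End.mul_apply, pow_mul]
  rw [h1]
  have hM : (0 : ℝ) < (2 ^ n) ^ 2 := by positivity
  calc _ ≤ (1 / (2 ^ n) ^ 2) ^ s * ‖w‖ :=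
        norm_pow_apply_le (by positivity) (norm_halfSumProd_sq_gapOp_le W n) s w
    _ ≤ (1 / 4 * δ) ^ s * ‖w‖ := by
        gcongr
        rw [div_le_iff₀ hM]; linarith
    _ = (1 / 4) ^ s * (δ ^ s * ‖w‖) := by rw [mul_pow]; ring
    _ ≤ _ := by gcongr

end Averages

/-! ### The gap of the chain as a contraction for the walk -/

namespace System

variable {Ω : Type u} [Fintype Ω] [DecidableEq Ω] {S : System Ω} {δ : ℝ} {i : ℕ}

/-- With `R = 2Π - 1` and `F² = 1`, a vector `v ∈ 𝒜` satisfies `W v = 2FΠF v - v` and `W⁻¹ v = 2ΠW v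
- W v`; substituting cancels everything outside `𝒜`. The right side is `(1 - D²) v`. -/
theorem gapOp_walk_apply {v : Reg Ω} (hv : v ∈ S.spaceA) :
    gapOp (S.walk i) v
      = v - S.spaceA.starProjection (S.flip i (S.spaceA.starProjection (S.flip i v))) := by
  have hr := Submodule.reflection_mem_subspace_eq_self hv
  have h1 : S.walk i v = (2 : ℂ) • S.flip i (S.spaceA.starProjection (S.flip i v)) - v := by
    rw [walk_apply, hr, Submodule.reflection_apply, map_sub, map_nsmul, flip_flip]
    simp [two_smul]
  have h2 : (S.walk i)⁻¹ v = (2 : ℂ) • S.spaceA.starProjection (S.walk i v) - S.walk i v := by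
    rw [walk_inv_apply, hr, Submodule.reflection_apply]
    simp [two_smul]
  have h3 : gapOp (S.walk i) v = (1 / 4 : ℂ) • ((2 : ℂ) • v - S.walk i v - (S.walk i)⁻¹ v) := by
    simp only [gapOp, LinearMap.smul_apply, LinearMap.sub_apply, LinearMap.add_apply, two_smul]
    rfl
  rw [h3, h2, h1, map_sub, map_smul, Submodule.starProjection_eq_self_iff.2 hv]
  module

/-- The invariant subspace is the complement of the Gibbs state inside `𝒜`. There `1 - D²` is
bounded below by `1 - (1 - δ)²`, of which only the part `δ` is used. -/
theorem norm_halfSumProd_walk_le (h : S.IsChain δ i) (hδ : 0 < δ) (hδ1 : δ ≤ 1) {n : ℕ}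
    (hn : 4 ≤ (2 ^ n) ^ 2 * δ) (s : ℕ) {v : Reg Ω} (hv : v ∈ S.spaceA)
    (hvg : inner ℂ (S.gibbs i) v = 0) :
    ‖(halfSumProd (fun j => S.walk i ^ 2 ^ (j % n)) (n * (2 * s))) v‖ ≤ (1 / 4) ^ s * ‖v‖ := by
  rw [halfSumProd_mul (n := n) (by intro j; simp)]
  rw [halfSumProd_congr (T' := fun j => S.walk i ^ 2 ^ j)
    (by intro j hj; simp [Nat.mod_eq_of_lt hj])]
  let A' : Submodule ℂ (Reg Ω) := S.spaceA ⊓ (ℂ ∙ S.gibbs i)ᗮ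
  have hmem : ∀ {w : Reg Ω}, w ∈ A' ↔ w ∈ S.spaceA ∧ inner ℂ (S.gibbs i) w = 0 := by
    intro w
    rw [Submodule.mem_inf, Submodule.mem_orthogonal_singleton_iff_inner_right]
  refine norm_halfSumProd_pow_le (S.walk i) A' hδ ?_ ?_ hn s (hmem.2 ⟨hv, hvg⟩)
  · intro w hw
    obtain ⟨h1, h2⟩ := hmem.1 hw
    rw [gapOp_walk_apply h1, hmem]
    refine ⟨Submodule.sub_mem _ h1 (Submodule.starProjection_apply_mem _ _), ?_⟩
    rw [inner_sub_right, inner_gibbs_starProjection_flip h, inner_gibbs_starProjection_flip h, h2,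
      sub_zero]
  · intro w hw
    obtain ⟨h1, h2⟩ := hmem.1 hw
    rw [gapOp_walk_apply h1]
    have h3 := norm_starProjection_flip_le h hδ1 h1 h2
    have h4 := norm_starProjection_flip_le h hδ1
      (Submodule.starProjection_apply_mem S.spaceA (S.flip i w))
      (by rw [inner_gibbs_starProjection_flip h, h2])
    have h5 := norm_sub_norm_le w
      (S.spaceA.starProjection (S.flip i (S.spaceA.starProjection (S.flip i w))))
    have h6 : (1 - δ) * ‖S.spaceA.starProjection (S.flip i w)‖ ≤ 1 * ((1 - δ) * ‖w‖) := by
      gcongr; linarith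
    nlinarith

end System

/-! ### Phase reflections, fixed-point search and Grover rotation -/

section PhaseReflections

variable {E : Type*} [NormedAddCommGroup E] [InnerProductSpace ℂ E]

theorem inner_self_of_norm_one {e : E} (he : ‖e‖ = 1) : inner ℂ e e = 1 := by
  rw [inner_self_eq_norm_sq_to_K, he]; simp

theorem Circle.conj_mul_self (ω : Circle) : (starRingEnd ℂ) (ω : ℂ) * ω = 1 := by
  rw [← Complex.normSq_eq_conj_mul_self]; simp

/-- The unitary operator with eigenvalue `ω` on the unit vector `e` and `1` on its orthogonal
complement. -/
def phaseRefl (e : E) (he : ‖e‖ = 1) (ω : Circle) : E ≃ₗᵢ[ℂ] E where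
  toFun x := x - ((1 - (ω : ℂ)) * inner ℂ e x) • e
  invFun x := x - ((1 - (ω⁻¹ : Circle)) * inner ℂ e x) • e
  map_add' x y := by rw [inner_add_right]; module
  map_smul' c x := by rw [inner_smul_right, RingHom.id_apply]; module
  left_inv x := by
    have h : (ω⁻¹ : Circle) * (ω : ℂ) = 1 := by simp
    simp only [inner_sub_right, inner_smul_right, inner_self_of_norm_one he]
    rw [sub_sub, ← add_smul]
    have : (1 - (ω : ℂ)) * inner ℂ e x + (1 - (ω⁻¹ : Circle))
        * (inner ℂ e x - (1 - (ω : ℂ)) * inner ℂ e x * 1) = 0 := by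
      linear_combination (-inner ℂ e x) * h
    rw [this, zero_smul, sub_zero]
  right_inv x := by
    have h : (ω⁻¹ : Circle) * (ω : ℂ) = 1 := by simp
    simp only [inner_sub_right, inner_smul_right, inner_self_of_norm_one he]
    rw [sub_sub, ← add_smul]
    have : (1 - (ω⁻¹ : Circle)) * inner ℂ e x + (1 - (ω : ℂ))
        * (inner ℂ e x - (1 - (ω⁻¹ : Circle)) * inner ℂ e x * 1) = 0 := by
      linear_combination (-inner ℂ e x) * h
    rw [this, zero_smul, sub_zero]
  norm_map' x := by
    have key : inner ℂ (x - ((1 - (ω : ℂ)) * inner ℂ e x) • e)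
        (x - ((1 - (ω : ℂ)) * inner ℂ e x) • e) = inner ℂ x x := by
      simp only [inner_sub_right, inner_sub_left, inner_smul_right, inner_smul_left,
        inner_self_of_norm_one he, map_mul, map_sub, map_one, inner_conj_symm]
      linear_combination (inner ℂ e x * inner ℂ x e) * Circle.conj_mul_self ω
    rw [inner_self_eq_norm_sq_to_K, inner_self_eq_norm_sq_to_K] at key
    have key' : ‖x - ((1 - (ω : ℂ)) * inner ℂ e x) • e‖ ^ 2 = ‖x‖ ^ 2 := by exact_mod_cast key
    exact (sq_eq_sq₀ (norm_nonneg _) (norm_nonneg _)).1 key'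

theorem phaseRefl_apply (e : E) (he : ‖e‖ = 1) (ω : Circle) (x : E) :
    phaseRefl e he ω x = x - ((1 - (ω : ℂ)) * inner ℂ e x) • e := rfl

theorem phaseRefl_inv (e : E) (he : ‖e‖ = 1) (ω : Circle) :
    (phaseRefl e he ω)⁻¹ = phaseRefl e he ω⁻¹ :=
  LinearIsometryEquiv.ext fun _ => rfl

/-- Fixed-point search from `s` to `t`, with `3 ^ n - 1` phase reflections. -/
def fixedPoint (s t : E) (hs : ‖s‖ = 1) (ht : ‖t‖ = 1) (ω : Circle) : ℕ → (E ≃ₗᵢ[ℂ] E)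
  | 0 => 1
  | n + 1 => fixedPoint s t hs ht ω n * (phaseRefl s hs ω * ((fixedPoint s t hs ht ω n)⁻¹ *
      (phaseRefl t ht ω * fixedPoint s t hs ht ω n)))

/-- The phase `exp (i π / 3)`. -/
def sixthRoot : Circle := Circle.exp (Real.pi / 3)

theorem sixthRoot_coe : (sixthRoot : ℂ) = 1 / 2 + (Real.sqrt 3 / 2 : ℝ) * Complex.I := by
  rw [sixthRoot, Circle.coe_exp, Complex.exp_mul_I, ← Complex.ofReal_cos, ← Complex.ofReal_sin,
    Real.cos_pi_div_three, Real.sin_pi_div_three]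
  push_cast; ring

/-- Since `⟨s, U⁻¹ t⟩` is the conjugate of `a = ⟨t, U s⟩`, the new amplitude is `a` times an
expression in `‖a‖²` alone. -/
theorem inner_fixedPoint_step (s t : E) (hs : ‖s‖ = 1) (ht : ‖t‖ = 1) (ω : Circle)
    (U : E ≃ₗᵢ[ℂ] E) :
    inner ℂ t ((U * (phaseRefl s hs ω * (U⁻¹ * (phaseRefl t ht ω * U)))) s)
      = inner ℂ t (U s) * (1 - 2 * (1 - (ω : ℂ))
        + (1 - (ω : ℂ)) ^ 2 * (‖inner ℂ t (U s)‖ ^ 2 : ℝ)) := by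
  set a := inner ℂ t (U s) with ha
  have h1 : inner ℂ s (U⁻¹ t) = (starRingEnd ℂ) a := by
    rw [ha, inner_conj_symm, ← LinearIsometryEquiv.inner_map_map U]
    congr 1
    exact U.apply_symm_apply t
  have h2 : U (U⁻¹ t) = t := U.apply_symm_apply t
  have h3 : U⁻¹ (U s) = s := U.symm_apply_apply s
  have h4 : (‖a‖ ^ 2 : ℝ) = (starRingEnd ℂ) a * a := by
    rw [Complex.conj_mul']; push_cast; rfl
  simp only [LinearIsometryEquiv.coe_mul, Function.comp_apply, phaseRefl_apply, map_sub, map_smul,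
    h2, h3, inner_sub_right, inner_smul_right, ← ha, h1, inner_self_of_norm_one ht,
    inner_self_of_norm_one hs]
  rw [h4]
  ring

/-- For the phase `exp (iπ/3)` the factor in the recursion has squared modulus `q² - 3q + 3`, and `1
- q (q² - 3q + 3) = (1 - q)³`. Failure is cubed for every `q`, so the search cannot overshoot. -/
theorem norm_sq_inner_fixedPoint (s t : E) (hs : ‖s‖ = 1) (ht : ‖t‖ = 1) (n : ℕ) :
    1 - ‖inner ℂ t (fixedPoint s t hs ht sixthRoot n s)‖ ^ 2
      = (1 - ‖inner ℂ t s‖ ^ 2) ^ 3 ^ n := by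
  induction n with
  | zero => simp [fixedPoint]
  | succ n ih =>
    rw [pow_succ 3 n, pow_mul, ← ih, fixedPoint, inner_fixedPoint_step, norm_mul, mul_pow]
    set q := ‖inner ℂ t (fixedPoint s t hs ht sixthRoot n s)‖ ^ 2
    have h3 : Real.sqrt 3 * Real.sqrt 3 = 3 := Real.mul_self_sqrt (by norm_num)
    have hz : (1 : ℂ) - 2 * (1 - (sixthRoot : ℂ)) + (1 - (sixthRoot : ℂ)) ^ 2 * (q : ℝ)
        = ((-q / 2 : ℝ) : ℂ) + ((Real.sqrt 3 - q * Real.sqrt 3 / 2 : ℝ) : ℂ) * Complex.I := by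
      rw [sixthRoot_coe]
      have h3' : (Real.sqrt 3 : ℂ) * Real.sqrt 3 = 3 := by exact_mod_cast h3
      push_cast
      linear_combination ((Real.sqrt 3 : ℂ) ^ 2 / 4 * q) * Complex.I_sq - q / 4 * h3'
    have hq : ‖(1 : ℂ) - 2 * (1 - (sixthRoot : ℂ)) + (1 - (sixthRoot : ℂ)) ^ 2 * (q : ℝ)‖ ^ 2
        = q ^ 2 - 3 * q + 3 := by
      rw [hz, Complex.sq_norm, Complex.normSq_add_mul_I]
      linear_combination (1 - q / 2) ^ 2 * h3
    rw [hq]; ring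

/-- Fixed-point search reaches `t` up to a phase. -/
theorem exists_phase_norm_fixedPoint_sub_le (s t : E) (hs : ‖s‖ = 1) (ht : ‖t‖ = 1)
    (hst : 1 / 2 ≤ ‖inner ℂ t s‖ ^ 2) (n : ℕ) :
    ∃ c : ℂ, ‖c‖ = 1 ∧
      ‖fixedPoint s t hs ht sixthRoot n s - c • t‖ ^ 2 ≤ 2 * (1 / 2) ^ 3 ^ n := by
  set y := fixedPoint s t hs ht sixthRoot n s with hy
  have hyn : ‖y‖ = 1 := by rw [hy, LinearIsometryEquiv.norm_map, hs]
  set a := inner ℂ t y with ha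
  have hle1 : ‖inner ℂ t s‖ ≤ 1 := by simpa [hs, ht] using norm_inner_le_norm (𝕜 := ℂ) t s
  have hale : ‖a‖ ≤ 1 := by simpa [hyn, ht] using norm_inner_le_norm (𝕜 := ℂ) t y
  have h0 : 0 ≤ 1 - ‖inner ℂ t s‖ ^ 2 := by nlinarith [norm_nonneg (inner ℂ t s)]
  have hpow : 1 - ‖a‖ ^ 2 ≤ (1 / 2) ^ 3 ^ n := by
    rw [ha, hy, norm_sq_inner_fixedPoint]
    exact pow_le_pow_left₀ h0 (by linarith) _
  have ha0 : a ≠ 0 := by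
    intro h
    rw [h, norm_zero] at hpow
    have : (1 / 2 : ℝ) ^ 3 ^ n < 1 :=
      pow_lt_one₀ (by norm_num) (by norm_num) (by positivity)
    norm_num at hpow this
    linarith
  have hna : ‖a‖ ≠ 0 := norm_ne_zero_iff.2 ha0
  refine ⟨a / ‖a‖, ?_, ?_⟩
  · rw [norm_div, Complex.norm_real, norm_norm, div_self hna]
  · have h1 : ‖y - (a / ‖a‖) • t‖ ^ 2
        = ‖y‖ ^ 2 - 2 * RCLike.re (inner ℂ y ((a / (‖a‖ : ℂ)) • t)) + ‖(a / (‖a‖ : ℂ)) • t‖ ^ 2 :=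
      norm_sub_sq (𝕜 := ℂ) _ _
    have h2 : inner ℂ y ((a / (‖a‖ : ℂ)) • t) = ((‖a‖ : ℝ) : ℂ) := by
      rw [inner_smul_right, ← inner_conj_symm, ← ha, div_mul_eq_mul_div, Complex.mul_conj']
      have : (‖a‖ : ℂ) ≠ 0 := by exact_mod_cast hna
      field_simp
    have h3 : ‖(a / (‖a‖ : ℂ)) • t‖ = 1 := by
      rw [norm_smul, ht, norm_div, Complex.norm_real, norm_norm, div_self hna, one_mul]
    rw [h1, h2, h3, hyn]
    simp only [RCLike.re_to_complex, Complex.ofReal_re]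
    -- The squared distance is `2 - 2‖a‖ ≤ 2 (1 - ‖a‖²)`, because `‖a‖ ≤ 1`.
    nlinarith [norm_nonneg a]

/-- Iterating the product of the reflection about `g + h` and a reflection negating `g` rotates in
the plane of `g` and `h`. -/
theorem grover_iterate {g h : E} {θ : ℝ} (hgh : inner ℂ g h = 0)
    (hg : ‖g‖ ^ 2 = Real.cos θ ^ 2) (hh : ‖h‖ ^ 2 = Real.sin θ ^ 2) (hc : Real.cos θ ≠ 0)
    (hs : Real.sin θ ≠ 0) (hn : ‖g + h‖ = 1) {ω : Circle} (hω : (ω : ℂ) = -1)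
    {C : E ≃ₗᵢ[ℂ] E} (hCg : C g = -g) (hCh : C h = h) (k : ℕ) :
    ((phaseRefl (g + h) hn ω * C) ^ k) (g + h)
      = ((Real.cos ((2 * k + 1) * θ) / Real.cos θ : ℝ) : ℂ) • g
        + ((Real.sin ((2 * k + 1) * θ) / Real.sin θ : ℝ) : ℂ) • h := by
  have hhg : inner ℂ h g = 0 := by rw [← inner_conj_symm, hgh, map_zero]
  have hgg : inner ℂ g g = ((Real.cos θ ^ 2 : ℝ) : ℂ) := by
    rw [inner_self_eq_norm_sq_to_K, ← hg]; simp
  have hhh : inner ℂ h h = ((Real.sin θ ^ 2 : ℝ) : ℂ) := by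
    rw [inner_self_eq_norm_sq_to_K, ← hh]; simp
  induction k with
  | zero => simp [div_self hc, div_self hs]
  | succ k ih =>
    rw [pow_succ']
    simp only [LinearIsometryEquiv.coe_mul, Function.comp_apply] at ih ⊢
    rw [ih, map_add, map_smul, map_smul, hCg, hCh, phaseRefl_apply, hω]
    set x := (2 * (k : ℝ) + 1) * θ with hx
    have hx' : (2 * ((k + 1 : ℕ) : ℝ) + 1) * θ = x + 2 * θ := by rw [hx]; push_cast; ring
    rw [hx', Real.cos_add, Real.sin_add, Real.cos_two_mul, Real.sin_two_mul]
    set c := Real.cos θ with hc'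
    set d := Real.sin θ with hd'
    have hcd : c ^ 2 + d ^ 2 = 1 := Real.cos_sq_add_sin_sq θ
    simp only [inner_add_left, inner_add_right, inner_smul_right, inner_neg_right, hgg, hhh, hgh,
      hhg]
    have e1 : (Real.cos x * (2 * c ^ 2 - 1) - Real.sin x * (2 * d * c)) / c
        = -(Real.cos x / c) + 2 * (Real.cos x / c * c ^ 2 - Real.sin x / d * d ^ 2) := by
      field_simp; ring
    have e2 : (Real.sin x * (2 * c ^ 2 - 1) + Real.cos x * (2 * d * c)) / d
        = Real.sin x / d + 2 * (Real.cos x / c * c ^ 2 - Real.sin x / d * d ^ 2) := by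
      field_simp
      linear_combination (2 * Real.sin x) * hcd
    rw [e1, e2]
    push_cast
    module

end PhaseReflections

/-! ### Elementary gates and their inverses -/

section BasicGates

variable {ℓ m : ℕ}

/-- The controlled one-qubit gate; without admissible controls, the uncontrolled gate. -/
def ctrlGate (ctrl : Finset (Fin m)) (t : Fin m) (v : Matrix.unitaryGroup Bool ℂ) : Gate ℓ m :=
  if h : ctrl.card ≤ 2 ∧ t ∉ ctrl then .qubit ctrl t h.1 h.2 v
  else .qubit ∅ t (by simp) (by simp) v

theorem isWalk_ctrlGate (ctrl : Finset (Fin m)) (t : Fin m) (v : Matrix.unitaryGroup Bool ℂ) :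
    (ctrlGate ctrl t v : Gate ℓ m).isWalk = false := by
  rw [ctrlGate]; split_ifs <;> rfl

/-- The Hadamard gate. -/
def hadamard : Matrix.unitaryGroup Bool ℂ :=
  ⟨Matrix.of fun a b => if a && b then -((Real.sqrt 2)⁻¹ : ℝ) else ((Real.sqrt 2)⁻¹ : ℝ), by
    have h : (Real.sqrt 2 : ℂ)⁻¹ * (Real.sqrt 2 : ℂ)⁻¹ = 1 / 2 := by
      rw [← mul_inv]; norm_cast; rw [Real.mul_self_sqrt (by norm_num)]; norm_num
    rw [Matrix.mem_unitaryGroup_iff]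
    ext a b
    cases a <;> cases b <;> simp [Matrix.mul_apply, Matrix.star_apply, h]; norm_num⟩

/-- The NOT gate. -/
def notGate : Matrix.unitaryGroup Bool ℂ :=
  ⟨Matrix.of fun a b => if a = b then 0 else 1, by
    rw [Matrix.mem_unitaryGroup_iff]
    ext a b
    cases a <;> cases b <;> simp [Matrix.mul_apply, Matrix.star_apply]⟩

/-- The phase gate `|1⟩ ↦ ω |1⟩`. -/
def phaseGate (ω : Circle) : Matrix.unitaryGroup Bool ℂ :=
  ⟨Matrix.diagonal fun a => if a then (ω : ℂ) else 1, by
    rw [Matrix.mem_unitaryGroup_iff]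
    ext a b
    cases a <;> cases b <;> simp [Matrix.star_eq_conjTranspose, Matrix.diagonal_conjTranspose,
      Complex.mul_conj]⟩

/-- The rotation by `π / 3`, which sends `|1⟩` to `(√3 |0⟩ + |1⟩) / 2`. -/
def tiltGate : Matrix.unitaryGroup Bool ℂ :=
  ⟨Matrix.of fun a b => if a = b then 1 / 2
      else if a then -(Real.sqrt 3 / 2 : ℝ) else (Real.sqrt 3 / 2 : ℝ), by
    have h : (Real.sqrt 3 : ℂ) * (Real.sqrt 3 : ℂ) = 3 := by
      exact_mod_cast Real.mul_self_sqrt (by norm_num : (0 : ℝ) ≤ 3)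
    rw [Matrix.mem_unitaryGroup_iff]
    ext a b
    cases a <;> cases b <;> simp [Matrix.mul_apply, Matrix.star_apply, Complex.conj_ofNat] <;>
      first | linear_combination h / 4 | ring⟩

/-- The unit complex number `-1`. -/
def negOne : Circle := ⟨-1, by simp [Submonoid.unitSphere]⟩

theorem negOne_coe : (negOne : ℂ) = -1 := rfl

/-- The action of a controlled NOT gate on the computational basis. -/
def flipIf (ctrl : Finset (Fin m)) (t : Fin m) (b : Fin m → Bool) : Fin m → Bool :=
  if ∀ c ∈ ctrl, b c = true then Function.update b t (!b t) else b

theorem flipIf_flipIf {ctrl : Finset (Fin m)} {t : Fin m} (ht : t ∉ ctrl) (b : Fin m → Bool) :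
    flipIf ctrl t (flipIf ctrl t b) = b := by
  by_cases h : ∀ c ∈ ctrl, b c = true
  · have h1 : flipIf ctrl t b = Function.update b t (!b t) := if_pos h
    have h2 : ∀ c ∈ ctrl, Function.update b t (!b t) c = true := by
      intro c hc
      rw [Function.update_of_ne (by rintro rfl; exact ht hc)]
      exact h c hc
    rw [h1, flipIf, if_pos h2]
    simp
  · have h1 : flipIf ctrl t b = b := if_neg h
    rw [h1, h1]

theorem flipIf_of_ne {ctrl : Finset (Fin m)} {t w : Fin m} (hw : w ≠ t) (b : Fin m → Bool) :
    flipIf ctrl t b w = b w := by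
  rw [flipIf]
  split_ifs
  · exact Function.update_of_ne hw _ _
  · rfl

theorem flipIf_self {ctrl : Finset (Fin m)} {t : Fin m} (b : Fin m → Bool) :
    flipIf ctrl t b t = xor (b t) (decide (∀ c ∈ ctrl, b c = true)) := by
  by_cases h : ∀ c ∈ ctrl, b c = true
  · rw [flipIf, if_pos h, decide_eq_true h]; simp
  · rw [flipIf, if_neg h, decide_eq_false h]; simp

variable {Ω : Type u} [Fintype Ω] [DecidableEq Ω] {S : System Ω} (hS : S.WeightsLeOne ℓ)

theorem ctrlGate_apply {ctrl : Finset (Fin m)} {t : Fin m} (hc : ctrl.card ≤ 2) (ht : t ∉ ctrl)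
    (v : Matrix.unitaryGroup Bool ℂ) (ψ : HState Ω m) (b : Fin m → Bool) :
    circ hS [ctrlGate ctrl t v] ψ b = if ∀ c ∈ ctrl, b c = true then
        ∑ a : Bool, (v : Matrix Bool Bool ℂ) (b t) a • ψ (Function.update b t a)
      else ψ b := by
  rw [circ_singleton, Gate.toIso_apply, ctrlGate, dif_pos ⟨hc, ht⟩]
  rfl

theorem ctrlGate_mul {ctrl : Finset (Fin m)} {t : Fin m} (hc : ctrl.card ≤ 2) (ht : t ∉ ctrl)
    (v w : Matrix.unitaryGroup Bool ℂ) :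
    circ hS [ctrlGate ctrl t v] * circ hS [ctrlGate ctrl t w]
      = circ hS [ctrlGate ctrl t (v * w)] := by
  refine LinearIsometryEquiv.ext fun ψ => ?_
  ext1 b
  rw [LinearIsometryEquiv.coe_mul, Function.comp_apply, ctrlGate_apply hS hc ht v,
    ctrlGate_apply hS hc ht (v * w)]
  by_cases h : ∀ c ∈ ctrl, b c = true
  · have h2 : ∀ a, ∀ c ∈ ctrl, Function.update b t a c = true := by
      intro a c hc
      rw [Function.update_of_ne (by rintro rfl; exact ht hc)]
      exact h c hc
    rw [if_pos h, if_pos h]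
    simp only [ctrlGate_apply hS hc ht, if_pos (h2 _), Function.update_self, Function.update_idem,
      Matrix.UnitaryGroup.mul_val, Matrix.mul_apply, Finset.smul_sum, Finset.sum_smul, smul_smul]
    rw [Finset.sum_comm]
  · rw [if_neg h, if_neg h, ctrlGate_apply hS hc ht, if_neg h]

theorem ctrlGate_one {ctrl : Finset (Fin m)} {t : Fin m} (hc : ctrl.card ≤ 2) (ht : t ∉ ctrl) :
    circ hS [ctrlGate ctrl t 1] = 1 := by
  refine LinearIsometryEquiv.ext fun ψ => ?_
  ext1 b
  rw [ctrlGate_apply hS hc ht]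
  split_ifs
  · simp [Matrix.one_apply]
  · rfl

theorem ctrlGate_inv {ctrl : Finset (Fin m)} {t : Fin m} (hc : ctrl.card ≤ 2) (ht : t ∉ ctrl)
    (v : Matrix.unitaryGroup Bool ℂ) :
    circ hS [ctrlGate ctrl t v⁻¹] = (circ hS [ctrlGate ctrl t v])⁻¹ := by
  rw [eq_inv_iff_mul_eq_one, ctrlGate_mul hS hc ht, inv_mul_cancel, ctrlGate_one hS hc ht]

theorem ctrlGate_not_apply {ctrl : Finset (Fin m)} {t : Fin m} (hc : ctrl.card ≤ 2) (ht : t ∉ ctrl)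
    (ψ : HState Ω m) (b : Fin m → Bool) :
    circ hS [ctrlGate ctrl t notGate] ψ b = ψ (flipIf ctrl t b) := by
  rw [ctrlGate_apply hS hc ht, flipIf]
  by_cases h : ∀ c ∈ ctrl, b c = true
  · rw [if_pos h, if_pos h, Fintype.sum_bool]
    cases hb : b t <;> simp [notGate]
  · rw [if_neg h, if_neg h]

theorem ctrlGate_phase_apply {ctrl : Finset (Fin m)} {t : Fin m} (hc : ctrl.card ≤ 2)
    (ht : t ∉ ctrl) (ω : Circle) (ψ : HState Ω m) (b : Fin m → Bool) :
    circ hS [ctrlGate ctrl t (phaseGate ω)] ψ b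
      = (if (∀ c ∈ ctrl, b c = true) ∧ b t = true then (ω : ℂ) else 1) • ψ b := by
  rw [ctrlGate_apply hS hc ht]
  by_cases h : ∀ c ∈ ctrl, b c = true
  · rw [if_pos h, Fintype.sum_bool]
    cases hb : b t
    · have : Function.update b t false = b := by rw [← hb]; simp
      simp [phaseGate, this]
    · have : Function.update b t true = b := by rw [← hb]; simp
      rw [if_pos ⟨h, rfl⟩]
      simp [phaseGate, this]
  · rw [if_neg h, if_neg (fun h' => h h'.1), one_smul]

theorem hadamard_inv : hadamard⁻¹ = hadamard := by
  ext a b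
  rw [Matrix.UnitaryGroup.inv_val, Matrix.star_apply]
  cases a <;> cases b <;> simp [hadamard]

/-- Conjugating a diagonal operator by a controlled NOT gate. -/
theorem circ_conj_not {ctrl : Finset (Fin m)} {t : Fin m} (hc : ctrl.card ≤ 2) (ht : t ∉ ctrl)
    {Q : List (Gate ℓ m)} {d : (Fin m → Bool) → ℂ}
    (hQ : ∀ (ψ : HState Ω m) b, circ hS Q ψ b = d b • ψ b) (ψ : HState Ω m) (b : Fin m → Bool) :
    circ hS ([ctrlGate ctrl t notGate] ++ Q ++ [ctrlGate ctrl t notGate]) ψ b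
      = d (flipIf ctrl t b) • ψ b := by
  rw [circ_append, circ_append]
  simp only [LinearIsometryEquiv.coe_mul, Function.comp_apply]
  rw [ctrlGate_not_apply hS hc ht, hQ, ctrlGate_not_apply hS hc ht, flipIf_flipIf ht]

end BasicGates

/-! ### Controlled walks and single phase bits -/

section ControlledWalks

variable {ℓ m : ℕ}

/-- The `n`-fold controlled walk `W(P_t)`, or the controlled reflection about the start state if
there is no `t`-th walk. -/
def ctrlWalk (t n : ℕ) (c : Fin m) : List (Gate ℓ m) :=
  -- No chain belongs to `t = 0`. There the reflection `R` about the start state stands in for the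
  -- walk; `(1 + R) / 2` is exactly the projection onto that state.
  if h : 1 ≤ t ∧ t < ℓ then List.replicate n (.walk t h.1 h.2 c) else [.reflectStart c]

/-- The inverse of `ctrlWalk`. -/
def ctrlWalkInv (t n : ℕ) (c : Fin m) : List (Gate ℓ m) :=
  [.reflectZero c] ++ ctrlWalk t n c ++ [.reflectZero c]

variable {Ω : Type u} [Fintype Ω] [DecidableEq Ω] {S : System Ω} (hS : S.WeightsLeOne ℓ)

variable (S ℓ) in
/-- The operator on the registers controlled by `ctrlWalk`. -/
def walkPower (t n : ℕ) : Reg Ω ≃ₗᵢ[ℂ] Reg Ω :=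
  if 1 ≤ t ∧ t < ℓ then S.walk t ^ n else (Submodule.span ℂ {S.start}).reflection

theorem ctrlWalk_apply (t n : ℕ) (c : Fin m) (ψ : HState Ω m) (b : Fin m → Bool) :
    circ hS (ctrlWalk t n c) ψ b = if b c then walkPower ℓ S t n (ψ b) else ψ b := by
  rw [ctrlWalk, walkPower]
  by_cases h : 1 ≤ t ∧ t < ℓ
  · rw [dif_pos h, if_pos h]
    induction n generalizing ψ with
    | zero => simp
    | succ n ih =>
      rw [List.replicate_succ, circ_cons, LinearIsometryEquiv.coe_mul, Function.comp_apply, ih,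
        Gate.toIso_apply, pow_succ]
      simp only [Gate.apply]
      split_ifs <;> rfl
  · rw [dif_neg h, if_neg h, circ_singleton, Gate.toIso_apply]
    rfl

theorem walk_conj_reflection (t n : ℕ) (v : Reg Ω) :
    S.spaceA.reflection ((S.walk t ^ n) (S.spaceA.reflection v)) = (S.walk t ^ n)⁻¹ v := by
  have h : S.spaceA.reflection * S.walk t * S.spaceA.reflection⁻¹ = (S.walk t)⁻¹ := by
    refine LinearIsometryEquiv.ext fun v => ?_
    rw [System.walk_inv_apply, Submodule.reflection_inv]
    rfl
  have h2 : S.spaceA.reflection * S.walk t ^ n * S.spaceA.reflection⁻¹ = (S.walk t ^ n)⁻¹ := by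
    rw [← conj_pow, h, inv_pow]
  rw [← h2, Submodule.reflection_inv]
  rfl

theorem start_mem : S.start ∈ S.spaceA :=
  Submodule.sum_mem _ fun x _ => Submodule.smul_mem _ _ (Submodule.subset_span ⟨x, rfl⟩)

/-- The start state lies in `𝒜`, so the two reflections commute, and the inversion recipe for walks
also covers the substitute for `t = 0`. -/
theorem reflection_start_conj_reflection (v : Reg Ω) :
    S.spaceA.reflection ((Submodule.span ℂ {S.start}).reflection (S.spaceA.reflection v))
      = (Submodule.span ℂ {S.start}).reflection⁻¹ v := by
  have hA := Submodule.reflection_mem_subspace_eq_self (start_mem (S := S))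
  have h := Submodule.reflection_map_apply S.spaceA.reflection (Submodule.span ℂ {S.start}) v
  have h2 : (Submodule.span ℂ {S.start}).map
      (S.spaceA.reflection.toLinearEquiv : Reg Ω →ₗ[ℂ] Reg Ω) = Submodule.span ℂ {S.start} := by
    rw [Submodule.map_span, Set.image_singleton]
    simp [hA]
  rw [Submodule.reflection_symm] at h
  rw [← h, Submodule.reflection_inv]
  congr 1
  simp_rw [h2]

theorem ctrlWalkInv_apply (t n : ℕ) (c : Fin m) (ψ : HState Ω m) (b : Fin m → Bool) :
    circ hS (ctrlWalkInv t n c) ψ b = if b c then (walkPower ℓ S t n)⁻¹ (ψ b) else ψ b := by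
  rw [ctrlWalkInv, circ_append, circ_append]
  simp only [LinearIsometryEquiv.coe_mul, Function.comp_apply]
  rw [circ_singleton, Gate.toIso_apply]
  simp only [Gate.apply]
  rw [ctrlWalk_apply, Gate.toIso_apply]
  simp only [Gate.apply]
  by_cases hb : b c = true
  · simp only [if_pos hb, walkPower]
    split_ifs
    · exact walk_conj_reflection t n _
    · exact reflection_start_conj_reflection _
  · simp only [if_neg hb]

theorem ctrlWalkInv_eq (t n : ℕ) (c : Fin m) :
    circ hS (ctrlWalkInv t n c) = (circ hS (ctrlWalk t n c))⁻¹ := by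
  rw [eq_inv_iff_mul_eq_one]
  refine LinearIsometryEquiv.ext fun ψ => ?_
  ext1 b
  rw [LinearIsometryEquiv.coe_mul, Function.comp_apply, ctrlWalkInv_apply, ctrlWalk_apply]
  split_ifs
  · exact (walkPower ℓ S t n).symm_apply_apply _
  · rfl

/-- One bit of phase estimation for the `n`-th power of the walk. -/
def phaseBit (t n : ℕ) (c : Fin m) : List (Gate ℓ m) :=
  [ctrlGate ∅ c hadamard] ++ ctrlWalk t n c ++ [ctrlGate ∅ c hadamard]

/-- The inverse of `phaseBit`. -/
def phaseBitInv (t n : ℕ) (c : Fin m) : List (Gate ℓ m) :=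
  [ctrlGate ∅ c hadamard] ++ ctrlWalkInv t n c ++ [ctrlGate ∅ c hadamard]

theorem phaseBitInv_eq (t n : ℕ) (c : Fin m) :
    circ hS (phaseBitInv t n c) = (circ hS (phaseBit t n c))⁻¹ := by
  have h := ctrlGate_inv hS (ctrl := ∅) (t := c) (by simp) (by simp) hadamard
  rw [hadamard_inv] at h
  simp only [phaseBit, phaseBitInv, circ_append, ctrlWalkInv_eq, mul_inv_rev]
  rw [← h, mul_assoc]

/-- The two Hadamard gates turn the control into an interferometer: outcome `0` applies `(1 + W^n) /
2` and outcome `1` applies `(1 - W^n) / 2`. -/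
theorem phaseBit_apply (t n : ℕ) (c : Fin m) {ψ : HState Ω m} (hψ : ∀ b, b c = true → ψ b = 0)
    (b : Fin m → Bool) :
    circ hS (phaseBit t n c) ψ b = (1 / 2 : ℂ) • (ψ (Function.update b c false)
      + (if b c then (-1 : ℂ) else 1) •
        walkPower ℓ S t n (ψ (Function.update b c false))) := by
  have h2 : (Real.sqrt 2 : ℂ)⁻¹ * (Real.sqrt 2 : ℂ)⁻¹ = 1 / 2 := by
    rw [← mul_inv]; norm_cast; rw [Real.mul_self_sqrt (by norm_num)]; norm_num
  have hH : ∀ (φ : HState Ω m) b, circ hS [ctrlGate ∅ c hadamard] φ b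
      = ∑ a : Bool, (hadamard : Matrix Bool Bool ℂ) (b c) a • φ (Function.update b c a) := by
    intro φ b
    rw [ctrlGate_apply hS (by simp) (by simp)]
    simp
  rw [phaseBit, circ_append, circ_append]
  simp only [LinearIsometryEquiv.coe_mul, Function.comp_apply, hH, ctrlWalk_apply,
    Fintype.sum_bool, Function.update_self, Function.update_idem]
  rw [hψ (Function.update b c true) (by simp)]
  cases hb : b c
  · simp only [hadamard, Matrix.of_apply, Bool.and_true, Bool.and_false, Bool.false_eq_true,
      if_false, if_true, smul_zero, zero_add, map_smul, smul_smul]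
    push_cast
    rw [h2]
    module
  · simp only [hadamard, Matrix.of_apply, Bool.and_true, Bool.and_false, Bool.false_eq_true,
      if_false, if_true, smul_zero, zero_add, map_smul, smul_smul]
    push_cast
    rw [neg_mul, h2]
    module

end ControlledWalks

/-! ### Numbering of the qubits -/

section Layout

variable {a : ℕ}

/-- The qubits are the work qubits `0` and `1`, the flags `2 j + 2` and the phase bits `2 j + 3`. -/
def wire (a n : ℕ) : Fin (2 * a + 3) := Fin.ofNat (2 * a + 3) n

/-- The `j`-th flag, for `j ≤ a`. -/
abbrev flag (a j : ℕ) : Fin (2 * a + 3) := wire a (2 * j + 2)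

/-- The `j`-th phase bit, for `j < a`. -/
abbrev phaseWire (a j : ℕ) : Fin (2 * a + 3) := wire a (2 * j + 3)

theorem wire_val {n : ℕ} (h : n < 2 * a + 3) : (wire a n).val = n := Nat.mod_eq_of_lt h

theorem wire_ne {n k : ℕ} (hn : n < 2 * a + 3) (hk : k < 2 * a + 3) (h : n ≠ k) :
    wire a n ≠ wire a k := by
  intro h'
  have := congrArg Fin.val h'
  rw [wire_val hn, wire_val hk] at this
  exact h this

theorem eq_wire (w : Fin (2 * a + 3)) : w = wire a w.val := Fin.ext (wire_val w.2).symm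

/-- The pattern with both work qubits in `|1⟩` and all other qubits in `|0⟩`. -/
def workOnes (a : ℕ) : Fin (2 * a + 3) → Bool := fun w => decide (w.val < 2)

theorem workOnes_of_le {w : Fin (2 * a + 3)} (h : 2 ≤ w.val) : workOnes a w = false := by
  exact decide_eq_false (by omega)

theorem workOnes_wire_zero : workOnes a (wire a 0) = true := by
  simp [workOnes, wire_val (a := a) (n := 0) (by omega)]

theorem workOnes_wire_one : workOnes a (wire a 1) = true := by
  simp [workOnes, wire_val (a := a) (n := 1) (by omega)]

theorem eq_workOnes {b : Fin (2 * a + 3) → Bool} (h0 : b (wire a 0) = true)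
    (h1 : b (wire a 1) = true) (h : ∀ w, 2 ≤ w.val → b w = false) : b = workOnes a := by
  funext w
  by_cases hw : 2 ≤ w.val
  · rw [h w hw, workOnes_of_le hw]
  · have h2 : w.val = 0 ∨ w.val = 1 := by omega
    rw [eq_wire w]
    rcases h2 with h2 | h2
    · rw [h2, h0, workOnes_wire_zero]
    · rw [h2, h1, workOnes_wire_one]

end Layout

/-! ### Phase estimation -/

section PhaseEstimation

variable {ℓ a : ℕ}

/-- Phase estimation with `j` phase bits. -/
def phaseEst (ℓ a n t : ℕ) : ℕ → List (Gate ℓ (2 * a + 3))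
  | 0 => []
  | j + 1 => phaseEst ℓ a n t j ++ phaseBit t (2 ^ (j % n)) (phaseWire a j)

/-- The inverse of `phaseEst`. -/
def phaseEstInv (ℓ a n t : ℕ) : ℕ → List (Gate ℓ (2 * a + 3))
  | 0 => []
  | j + 1 => phaseBitInv t (2 ^ (j % n)) (phaseWire a j) ++ phaseEstInv ℓ a n t j

variable {Ω : Type u} [Fintype Ω] [DecidableEq Ω] {S : System Ω} (hS : S.WeightsLeOne ℓ)

theorem phaseEstInv_eq (n t j : ℕ) :
    circ hS (phaseEstInv ℓ a n t j) = (circ hS (phaseEst ℓ a n t j))⁻¹ := by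
  induction j with
  | zero => simp [phaseEst, phaseEstInv]
  | succ j ih => rw [phaseEst, phaseEstInv, circ_append, circ_append, ih, phaseBitInv_eq, mul_inv_rev]

/-- All qubits but the two work qubits are in the state `|0⟩`. -/
def IsClean (ψ : HState Ω (2 * a + 3)) : Prop := ∀ b w, 2 ≤ w.val → b w = true → ψ b = 0

/-- Qubits not yet touched stay in `|0⟩`. This supplies the fresh-bit hypothesis of `phaseBit_apply`
and later the unset flags that the ladder needs. -/
theorem phaseEst_eq_zero (n t : ℕ) {ψ : HState Ω (2 * a + 3)} (hψ : IsClean ψ) {j : ℕ} (hj : j ≤ a)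
    {b : Fin (2 * a + 3) → Bool} {w : Fin (2 * a + 3)} (hw : 2 ≤ w.val) (hb : b w = true)
    (hwj : ∀ k < j, w ≠ phaseWire a k) : circ hS (phaseEst ℓ a n t j) ψ b = 0 := by
  induction j generalizing b w with
  | zero => exact hψ b w hw hb
  | succ j ih =>
    rw [phaseEst, circ_append, LinearIsometryEquiv.coe_mul, Function.comp_apply, phaseBit_apply]
    · rw [ih (by omega) hw (w := w) _ fun k hk => hwj k (by omega)]
      · simp
      · rw [Function.update_of_ne (hwj j (by omega)), hb]
    · intro b' hb'
      refine ih (by omega) (w := phaseWire a j) ?_ hb' fun k hk => ?_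
      · rw [wire_val (by omega)]; omega
      · exact wire_ne (by omega) (by omega) (by omega)

/-- Only the branch with all phase bits `0` is followed, since the reflection puts its phase on no
other. Each further bit multiplies that branch by one more half-sum. -/
theorem phaseEst_apply (n t : ℕ) {ψ : HState Ω (2 * a + 3)} (hψ : IsClean ψ) {j : ℕ} (hj : j ≤ a)
    {b : Fin (2 * a + 3) → Bool} (hb : ∀ w, 2 ≤ w.val → b w = false) :
    circ hS (phaseEst ℓ a n t j) ψ b
      = halfSumProd (fun k => walkPower ℓ S t (2 ^ (k % n))) j (ψ b) := by
  induction j with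
  | zero => rfl
  | succ j ih =>
    have hbj : b (phaseWire a j) = false := hb _ (by rw [wire_val (by omega)]; omega)
    have hup : Function.update b (phaseWire a j) false = b := by rw [← hbj]; simp
    rw [phaseEst, circ_append, LinearIsometryEquiv.coe_mul, Function.comp_apply, phaseBit_apply,
      hup, hbj, ih (by omega), halfSumProd_succ]
    · simp
    · intro b' hb'
      refine phaseEst_eq_zero hS n t hψ (by omega) (w := phaseWire a j) ?_ hb' fun k hk => ?_
      · rw [wire_val (by omega)]; omega
      · exact wire_ne (by omega) (by omega) (by omega)

/-- On a fixed vector the interferometers have branch operators `(1 + 1) / 2` and `(1 - 1) / 2`, so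
every bit returns to `|0⟩` with certainty. -/
theorem phaseEst_single_of_fixed (n t : ℕ) {v : Reg Ω} (hv : ∀ k, walkPower ℓ S t k v = v) {j : ℕ}
    (hj : j ≤ a) :
    circ hS (phaseEst ℓ a n t j) (WithLp.toLp 2 (Pi.single (workOnes a) v))
      = WithLp.toLp 2 (Pi.single (workOnes a) v) := by
  induction j with
  | zero => rfl
  | succ j ih =>
    have hwj : workOnes a (phaseWire a j) = false :=
      workOnes_of_le (by rw [wire_val (by omega)]; omega)
    rw [phaseEst, circ_append, LinearIsometryEquiv.coe_mul, Function.comp_apply, ih (by omega)]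
    ext1 b
    rw [phaseBit_apply]
    · have hfix : walkPower ℓ S t (2 ^ (j % n)) ((Pi.single (workOnes a) v :
          (Fin (2 * a + 3) → Bool) → Reg Ω) (Function.update b (phaseWire a j) false))
          = (Pi.single (workOnes a) v : (Fin (2 * a + 3) → Bool) → Reg Ω)
            (Function.update b (phaseWire a j) false) := by
        rw [Pi.single_apply]
        split_ifs
        · exact hv _
        · simp
      simp only [hfix]
      cases hb : b (phaseWire a j)
      · have hup : Function.update b (phaseWire a j) false = b := by rw [← hb]; simp
        rw [hup]
        simp only [Bool.false_eq_true, if_false]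
        module
      · have hne : b ≠ workOnes a := by rintro rfl; rw [hwj] at hb; cases hb
        rw [Pi.single_eq_of_ne hne]
        simp
    · intro b' hb'
      have hne : b' ≠ workOnes a := by rintro rfl; rw [hwj] at hb'; cases hb'
      exact Pi.single_eq_of_ne hne _

end PhaseEstimation

/-! ### Testing many bits with at most two controls -/

section Ladder

variable {ℓ a : ℕ}

/-- Compute in the `j`-th flag whether both work qubits are `1` and the first `j` phase bits are
`0`. -/
def ladder (ℓ a : ℕ) : ℕ → List (Gate ℓ (2 * a + 3))
  | 0 => [ctrlGate {wire a 0, wire a 1} (flag a 0) notGate]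
  | j + 1 => ladder ℓ a j ++ [ctrlGate {flag a j, phaseWire a j} (flag a (j + 1)) notGate,
      ctrlGate {flag a j} (flag a (j + 1)) notGate]

/-- The inverse of `ladder`. -/
def ladderInv (ℓ a : ℕ) : ℕ → List (Gate ℓ (2 * a + 3))
  | 0 => [ctrlGate {wire a 0, wire a 1} (flag a 0) notGate]
  | j + 1 => [ctrlGate {flag a j} (flag a (j + 1)) notGate,
      ctrlGate {flag a j, phaseWire a j} (flag a (j + 1)) notGate] ++ ladderInv ℓ a j

/-- The action of `ladder` on the computational basis. -/
def ladderBits (a : ℕ) : ℕ → (Fin (2 * a + 3) → Bool) → (Fin (2 * a + 3) → Bool)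
  | 0, b => flipIf {wire a 0, wire a 1} (flag a 0) b
  | j + 1, b => flipIf {flag a j} (flag a (j + 1))
      (flipIf {flag a j, phaseWire a j} (flag a (j + 1)) (ladderBits a j b))

theorem ladderBits_of_ne {j : ℕ} {w : Fin (2 * a + 3)} (hw : ∀ k ≤ j, w ≠ flag a k)
    (b : Fin (2 * a + 3) → Bool) : ladderBits a j b w = b w := by
  induction j with
  | zero => exact flipIf_of_ne (hw 0 le_rfl) b
  | succ j ih =>
    rw [ladderBits, flipIf_of_ne (hw _ le_rfl), flipIf_of_ne (hw _ le_rfl),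
      ih fun k hk => hw k (by omega)]

theorem ladderBits_flag {j : ℕ} (hj : j ≤ a) {b : Fin (2 * a + 3) → Bool}
    (hb : ∀ k ≤ a, b (flag a k) = false) :
    ladderBits a j b (flag a j) = true ↔
      b (wire a 0) = true ∧ b (wire a 1) = true ∧ ∀ k < j, b (phaseWire a k) = false := by
  induction j with
  | zero =>
    rw [ladderBits, flipIf_self, hb 0 hj]
    simp
  | succ j ih =>
    have ih' := ih (by omega)
    have hne : flag a j ≠ flag a (j + 1) := wire_ne (by omega) (by omega) (by omega)
    have hf : ladderBits a j b (flag a (j + 1)) = false := by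
      rw [ladderBits_of_ne (fun k hk => wire_ne (by omega) (by omega) (by omega)), hb _ hj]
    have hp : ladderBits a j b (phaseWire a j) = b (phaseWire a j) :=
      ladderBits_of_ne (fun k hk => wire_ne (by omega) (by omega) (by omega)) b
    -- Two NOT gates, controlled by flag and phase bit and by the flag alone, add `f ∧ p` and `f` to
    -- the new flag; modulo two this is `f ∧ ¬p`.
    have key : ladderBits a (j + 1) b (flag a (j + 1))
        = (ladderBits a j b (flag a j) && !b (phaseWire a j)) := by
      rw [ladderBits, flipIf_self, flipIf_self, hf]
      simp only [Finset.mem_singleton, Finset.mem_insert, forall_eq, forall_eq_or_imp,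
        flipIf_of_ne hne, hp]
      cases ladderBits a j b (flag a j) <;> cases b (phaseWire a j) <;> rfl
    rw [key, Bool.and_eq_true, ih', Bool.not_eq_true']
    constructor
    · rintro ⟨⟨h0, h1, h2⟩, h3⟩
      refine ⟨h0, h1, fun k hk => ?_⟩
      rcases Nat.lt_succ_iff_lt_or_eq.1 hk with h | rfl
      · exact h2 k h
      · exact h3
    · rintro ⟨h0, h1, h2⟩
      exact ⟨⟨h0, h1, fun k hk => h2 k (by omega)⟩, h2 j (by omega)⟩

variable {Ω : Type u} [Fintype Ω] [DecidableEq Ω] {S : System Ω} (hS : S.WeightsLeOne ℓ)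

/-- The ladder permutes the computational basis, so conjugation keeps a diagonal operator diagonal.
The induction absorbs the innermost gate pair into the diagonal part, which is why `Q` and `d` vary.
-/
theorem circ_conj_ladder {j : ℕ} (hj : j ≤ a) {Q : List (Gate ℓ (2 * a + 3))}
    {d : (Fin (2 * a + 3) → Bool) → ℂ}
    (hQ : ∀ (ψ : HState Ω (2 * a + 3)) b, circ hS Q ψ b = d b • ψ b)
    (ψ : HState Ω (2 * a + 3)) (b : Fin (2 * a + 3) → Bool) :
    circ hS (ladder ℓ a j ++ Q ++ ladderInv ℓ a j) ψ b = d (ladderBits a j b) • ψ b := by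
  induction j generalizing Q d ψ b with
  | zero =>
    refine circ_conj_not hS (Finset.card_le_two) ?_ hQ ψ b
    simp only [Finset.mem_insert, Finset.mem_singleton, not_or]
    exact ⟨wire_ne (by omega) (by omega) (by omega), wire_ne (by omega) (by omega) (by omega)⟩
  | succ j ih =>
    have h1 := circ_conj_not hS (ctrl := {flag a j}) (t := flag a (j + 1)) (by simp)
      (by rw [Finset.mem_singleton]; exact wire_ne (by omega) (by omega) (by omega)) hQ
    have h2 := circ_conj_not hS (ctrl := {flag a j, phaseWire a j}) (t := flag a (j + 1))
      Finset.card_le_two (by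
        simp only [Finset.mem_insert, Finset.mem_singleton, not_or]
        exact ⟨wire_ne (by omega) (by omega) (by omega), wire_ne (by omega) (by omega) (by omega)⟩)
      h1
    have h3 := ih (by omega) h2 ψ b
    simpa [ladder, ladderInv, ladderBits, List.append_assoc] using h3

end Ladder

/-! ### The approximate reflection about a Gibbs state -/

section Reflector

variable {ℓ a : ℕ}

/-- The approximate reflection about `|π_t⟩|0⟩` with both work qubits in `|1⟩`, with phase `ω`. -/
def reflector (ℓ a n t : ℕ) (ω : Circle) : List (Gate ℓ (2 * a + 3)) :=
  phaseEst ℓ a n t a ++ (ladder ℓ a a ++ [ctrlGate ∅ (flag a a) (phaseGate ω)] ++ ladderInv ℓ a a)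
    ++ phaseEstInv ℓ a n t a

variable {Ω : Type u} [Fintype Ω] [DecidableEq Ω] {S : System Ω} (hS : S.WeightsLeOne ℓ)

/-- On vectors with all flags unset the last flag detects exactly one pattern, `workOnes a`; the
diagonal operator therefore differs from the identity in that component only. -/
theorem flag_phase_apply (ω : Circle) {φ : HState Ω (2 * a + 3)}
    (hφ : ∀ b k, k ≤ a → b (flag a k) = true → φ b = 0) :
    circ hS (ladder ℓ a a ++ [ctrlGate ∅ (flag a a) (phaseGate ω)] ++ ladderInv ℓ a a) φ
      = φ - (1 - (ω : ℂ)) • WithLp.toLp 2 (Pi.single (workOnes a) (φ (workOnes a))) := by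
  ext1 b
  rw [circ_conj_ladder hS le_rfl
    (fun ψ b => ctrlGate_phase_apply hS (ctrl := ∅) (by simp) (by simp) ω ψ b)]
  simp only [PiLp.sub_apply, PiLp.smul_apply]
  by_cases hb : ∀ k ≤ a, b (flag a k) = false
  · have hiff := ladderBits_flag le_rfl hb
    by_cases h : b = workOnes a
    · subst h
      rw [if_pos, Pi.single_eq_same]
      · module
      · refine ⟨by simp, hiff.2 ⟨workOnes_wire_zero, workOnes_wire_one, fun k hk => ?_⟩⟩
        exact workOnes_of_le (by rw [wire_val (by omega)]; omega)
    · rw [if_neg, Pi.single_eq_of_ne h]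
      · simp
      · rintro ⟨-, h2⟩
        obtain ⟨h0, h1, h3⟩ := hiff.1 h2
        refine h (eq_workOnes h0 h1 fun w hw => ?_)
        have hw2 := w.2
        rcases Nat.even_or_odd' w.val with ⟨k, hk | hk⟩
        · have := hb (k - 1) (by omega)
          rwa [show flag a (k - 1) = w by
            rw [eq_wire w, flag]; congr 1; omega] at this
        · have := h3 (k - 1) (by omega)
          rwa [show phaseWire a (k - 1) = w by
            rw [eq_wire w, phaseWire]; congr 1; omega] at this
  · push Not at hb
    obtain ⟨k, hk, hbk⟩ := hb
    have hbk' : b (flag a k) = true := by simpa using hbk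
    have hne : b ≠ workOnes a := by
      rintro rfl
      rw [workOnes_of_le (by rw [wire_val (by omega)]; omega)] at hbk'
      cases hbk'
    rw [hφ b k hk hbk', Pi.single_eq_of_ne hne]
    simp

theorem reflector_apply (n t : ℕ) (ω : Circle) {ψ : HState Ω (2 * a + 3)} (hψ : IsClean ψ) :
    circ hS (reflector ℓ a n t ω) ψ = ψ - (1 - (ω : ℂ)) •
      (circ hS (phaseEst ℓ a n t a))⁻¹ (WithLp.toLp 2 (Pi.single (workOnes a)
        (halfSumProd (fun k => walkPower ℓ S t (2 ^ (k % n))) a (ψ (workOnes a))))) := by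
  rw [reflector, circ_append, circ_append, phaseEstInv_eq]
  simp only [LinearIsometryEquiv.coe_mul, Function.comp_apply]
  rw [flag_phase_apply, map_sub, map_smul, phaseEst_apply hS n t hψ le_rfl fun w => workOnes_of_le]
  · congr 1
    exact (circ hS (phaseEst ℓ a n t a)).symm_apply_apply ψ
  · intro b k hk hb
    refine phaseEst_eq_zero hS n t hψ le_rfl (w := flag a k) ?_ hb fun k' hk' => ?_
    · rw [wire_val (by omega)]; omega
    · exact wire_ne (by omega) (by omega) (by omega)

end Reflector

/-! ### The code space and circuits that approximate unitary operators -/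

section CodeSpace

variable {Ω : Type u} [Fintype Ω] [DecidableEq Ω] {S : System Ω} {ℓ a : ℕ} {δ : ℝ}

/-- The registers in the state `v`, both work qubits in `|1⟩` and all other qubits in `|0⟩`. -/
def embed (a : ℕ) (v : Reg Ω) : HState Ω (2 * a + 3) :=
  WithLp.toLp 2 (Pi.single (workOnes a) v)

theorem embed_apply (v : Reg Ω) (b : Fin (2 * a + 3) → Bool) :
    embed a v b = if b = workOnes a then v else 0 := by
  rw [embed, PiLp.toLp_apply, Pi.single_apply]

theorem norm_embed (v : Reg Ω) : ‖embed a v‖ = ‖v‖ := by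
  have h : ‖embed a v‖ ^ 2 = ‖v‖ ^ 2 := by
    rw [PiLp.norm_sq_eq_of_L2, Finset.sum_eq_single (workOnes a)]
    · rw [embed_apply, if_pos rfl]
    · intro b _ hb; rw [embed_apply, if_neg hb]; simp
    · simp
  exact (sq_eq_sq₀ (norm_nonneg _) (norm_nonneg _)).1 h

theorem inner_embed (v : Reg Ω) (ψ : HState Ω (2 * a + 3)) :
    inner ℂ (embed a v) ψ = inner ℂ v (ψ (workOnes a)) := by
  rw [PiLp.inner_apply, Finset.sum_eq_single (workOnes a)]
  · rw [embed_apply, if_pos rfl]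
  · intro b _ hb; rw [embed_apply, if_neg hb, inner_zero_left]
  · simp

theorem embed_sub (v w : Reg Ω) : embed a (v - w) = embed a v - embed a w := by
  ext1 b
  simp only [PiLp.sub_apply, embed_apply]
  split_ifs <;> simp

theorem embed_smul (c : ℂ) (v : Reg Ω) : embed a (c • v) = c • embed a v := by
  ext1 b
  simp only [PiLp.smul_apply, embed_apply]
  split_ifs <;> simp

theorem norm_apply_le_norm {m : ℕ} (ψ : HState Ω m) (b : Fin m → Bool) : ‖ψ b‖ ≤ ‖ψ‖ :=
  PiLp.norm_apply_le ψ b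

variable (S) in
/-- The registers are in `𝒜` and all qubits but the work qubits in `|0⟩`. -/
def IsCode (ψ : HState Ω (2 * a + 3)) : Prop := IsClean ψ ∧ ∀ b, ψ b ∈ S.spaceA

theorem isCode_embed {v : Reg Ω} (hv : v ∈ S.spaceA) : IsCode S (embed a v) := by
  refine ⟨fun b w hw hb => ?_, fun b => ?_⟩
  · rw [embed_apply, if_neg]
    rintro rfl
    rw [workOnes_of_le hw] at hb; cases hb
  · rw [embed_apply]
    split_ifs
    · exact hv
    · exact Submodule.zero_mem _

theorem IsCode.sub {ψ φ : HState Ω (2 * a + 3)} (hψ : IsCode S ψ) (hφ : IsCode S φ) :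
    IsCode S (ψ - φ) := by
  refine ⟨fun b w hw hb => ?_, fun b => Submodule.sub_mem _ (hψ.2 b) (hφ.2 b)⟩
  rw [PiLp.sub_apply, hψ.1 b w hw hb, hφ.1 b w hw hb, sub_zero]

theorem IsCode.smul {ψ : HState Ω (2 * a + 3)} (c : ℂ) (hψ : IsCode S ψ) : IsCode S (c • ψ) := by
  refine ⟨fun b w hw hb => ?_, fun b => Submodule.smul_mem _ _ (hψ.2 b)⟩
  rw [PiLp.smul_apply, hψ.1 b w hw hb, smul_zero]

/-- On the code space, the circuit `c` is the unitary operator `U` up to `ε`. -/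
def Approx (hS : S.WeightsLeOne ℓ) (c : List (Gate ℓ (2 * a + 3)))
    (U : HState Ω (2 * a + 3) ≃ₗᵢ[ℂ] HState Ω (2 * a + 3)) (ε : ℝ) : Prop :=
  ∀ ψ, IsCode S ψ → IsCode S (U ψ) ∧ ‖circ hS c ψ - U ψ‖ ≤ ε * ‖ψ‖

variable {hS : S.WeightsLeOne ℓ}

theorem Approx.nil : Approx (a := a) hS [] 1 0 := fun ψ hψ => ⟨hψ, by simp⟩

/-- A unitary circuit does not enlarge the error it inherits, and the ideal intermediate state
remains in the code space, where the second bound applies. Errors thus add up. -/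
theorem Approx.append {c d : List (Gate ℓ (2 * a + 3))}
    {U V : HState Ω (2 * a + 3) ≃ₗᵢ[ℂ] HState Ω (2 * a + 3)} {ε ε' : ℝ} (hc : Approx hS c U ε)
    (hd : Approx hS d V ε') : Approx hS (c ++ d) (V * U) (ε + ε') := by
  intro ψ hψ
  obtain ⟨h1, h2⟩ := hc ψ hψ
  obtain ⟨h3, h4⟩ := hd _ h1
  refine ⟨h3, ?_⟩
  rw [circ_append, LinearIsometryEquiv.coe_mul, LinearIsometryEquiv.coe_mul, Function.comp_apply,
    Function.comp_apply]
  calc ‖circ hS d (circ hS c ψ) - V (U ψ)‖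
      = ‖circ hS d (circ hS c ψ - U ψ) + (circ hS d (U ψ) - V (U ψ))‖ := by
        rw [map_sub]; congr 1; abel
    _ ≤ ‖circ hS d (circ hS c ψ - U ψ)‖ + ‖circ hS d (U ψ) - V (U ψ)‖ := norm_add_le _ _
    _ ≤ ε * ‖ψ‖ + ε' * ‖U ψ‖ := by rw [LinearIsometryEquiv.norm_map]; exact add_le_add h2 h4
    _ = (ε + ε') * ‖ψ‖ := by rw [LinearIsometryEquiv.norm_map]; ring

theorem Approx.of_exact {c : List (Gate ℓ (2 * a + 3))}
    (h : ∀ ψ, IsCode S ψ → IsCode S (circ hS c ψ)) : Approx hS c (circ hS c) 0 :=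
  fun ψ hψ => ⟨h ψ hψ, by simp⟩

theorem start_eq_gibbs (h0 : S.β 0 = 0) : S.start = S.gibbs 0 := by
  rw [System.start, System.gibbs]
  refine Finset.sum_congr rfl fun x _ => ?_
  have : S.boltzmann 0 x = 1 / Fintype.card Ω := by simp [System.boltzmann, System.Z, h0]
  rw [this]
  congr 2
  rw [one_div, one_div, Real.sqrt_inv]

theorem walkPower_gibbs (h : S.IsAnnealing ℓ δ) {t : ℕ} (ht : t < ℓ) (k : ℕ) :
    walkPower ℓ S t k (S.gibbs t) = S.gibbs t := by
  rw [walkPower]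
  split_ifs with h1
  · induction k with
    | zero => rfl
    | succ k ih =>
      rw [pow_succ, LinearIsometryEquiv.coe_mul, Function.comp_apply,
        System.walk_gibbs (h.chain t h1.1 ht), ih]
  · have h0 : t = 0 := by omega
    subst h0
    rw [Submodule.reflection_mem_subspace_eq_self]
    rw [start_eq_gibbs h.start_temperature]
    exact Submodule.mem_span_singleton_self _

theorem halfSumProd_eq_zero {E : Type*} [NormedAddCommGroup E] [InnerProductSpace ℂ E]
    {T : ℕ → (E ≃ₗᵢ[ℂ] E)} {v : E} (h : T 0 v = -v) {j : ℕ} (hj : 1 ≤ j) :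
    halfSumProd T j v = 0 := by
  induction j, hj using Nat.le_induction with
  | base => simp [halfSumProd, h]
  | succ j _ ih => rw [halfSumProd_succ, Module.End.mul_apply, ih, map_zero]

theorem norm_halfSumProd_walkPower_le (h : S.IsAnnealing ℓ δ) (hδ : 0 < δ) (hδ1 : δ ≤ 1) {t : ℕ}
    (ht : t < ℓ) {n : ℕ} (hn : 4 ≤ (2 ^ n) ^ 2 * δ) {s : ℕ} (hs : 1 ≤ s) {v : Reg Ω}
    (hv : v ∈ S.spaceA) (hvg : inner ℂ (S.gibbs t) v = 0) :
    ‖halfSumProd (fun k => walkPower ℓ S t (2 ^ (k % n))) (n * (2 * s)) v‖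
      ≤ (1 / 4) ^ s * ‖v‖ := by
  by_cases h1 : 1 ≤ t ∧ t < ℓ
  · simp only [walkPower, if_pos h1]
    exact System.norm_halfSumProd_walk_le (h.chain t h1.1 ht) hδ hδ1 hn s hv hvg
  · have h0 : t = 0 := by omega
    subst h0
    -- For `n = 0` the condition `hn` would read `4 ≤ δ`. At least one factor is needed in the
    -- product, and one factor already annihilates `v`.
    have hn0 : 1 ≤ n := by
      rcases Nat.eq_zero_or_pos n with rfl | hn'
      · norm_num at hn; linarith
      · exact hn'
    rw [halfSumProd_eq_zero]
    · simp
    · rw [walkPower, if_neg h1]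
      refine Submodule.reflection_mem_subspace_orthogonalComplement_eq_neg ?_
      rw [Submodule.mem_orthogonal_singleton_iff_inner_right,
        start_eq_gibbs h.start_temperature, hvg]
    · nlinarith

variable (S a) in
/-- The state `|π_t⟩|0⟩` with both work qubits in `|1⟩`. -/
def gibbsState (t : ℕ) : HState Ω (2 * a + 3) := embed a (S.gibbs t)

theorem norm_gibbsState (t : ℕ) : ‖gibbsState S a t‖ = 1 := by
  rw [gibbsState, norm_embed, S.norm_gibbs]

theorem isCode_gibbsState (t : ℕ) : IsCode S (gibbsState S a t) := isCode_embed (S.gibbs_mem t)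

theorem norm_one_sub_circle_le (ω : Circle) : ‖1 - (ω : ℂ)‖ ≤ 2 := by
  calc ‖1 - (ω : ℂ)‖ ≤ ‖(1 : ℂ)‖ + ‖(ω : ℂ)‖ := norm_sub_le _ _
    _ = 2 := by rw [norm_one, Circle.norm_coe]; norm_num

/-- The Gibbs component passes through phase estimation unchanged and receives the exact phase. The
whole error is `(1 - ω)` times what the averages leave of the orthogonal component, at most `2 ·
4^(-s)`. -/
theorem approx_reflector (h : S.IsAnnealing ℓ δ) (hδ : 0 < δ) (hδ1 : δ ≤ 1) {t : ℕ} (ht : t < ℓ)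
    {n : ℕ} (hn : 4 ≤ (2 ^ n) ^ 2 * δ) {s : ℕ} (hs : 1 ≤ s) (ha : a = n * (2 * s)) (ω : Circle) :
    Approx hS (reflector ℓ a n t ω) (phaseRefl (gibbsState S a t) (norm_gibbsState t) ω)
      (2 * (1 / 4) ^ s) := by
  intro ψ hψ
  refine ⟨hψ.sub ((isCode_gibbsState t).smul _), ?_⟩
  set K := halfSumProd (fun k => walkPower ℓ S t (2 ^ (k % n))) a with hK
  set F := circ hS (phaseEst ℓ a n t a) with hF
  set v := ψ (workOnes a) with hv
  set g := S.gibbs t with hg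
  have hFe : F⁻¹ (gibbsState S a t) = gibbsState S a t :=
    F.symm_apply_eq.2
      (phaseEst_single_of_fixed hS n t (fun k => walkPower_gibbs h ht k) le_rfl).symm
  have hKg : K g = g := halfSumProd_apply_of_fixed (fun j => walkPower_gibbs h ht _) a
  have hgg : inner ℂ g g = 1 := inner_self_of_norm_one (S.norm_gibbs t)
  set w := v - inner ℂ g v • g with hw
  have hwA : w ∈ S.spaceA :=
    Submodule.sub_mem _ (hψ.2 _) (Submodule.smul_mem _ _ (S.gibbs_mem t))
  have hwg : inner ℂ g w = 0 := by
    rw [hw, inner_sub_right, inner_smul_right, hgg, mul_one, sub_self]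
  have hKw : ‖K w‖ ≤ (1 / 4) ^ s * ‖w‖ := by
    rw [hK, ha]; exact norm_halfSumProd_walkPower_le h hδ hδ1 ht hn hs hwA hwg
  have hwv : ‖w‖ ≤ ‖v‖ := by
    have h1 : v = w + inner ℂ g v • g := by rw [hw]; abel
    have h2 : ‖v‖ * ‖v‖ = ‖w‖ * ‖w‖ + ‖inner ℂ g v • g‖ * ‖inner ℂ g v • g‖ := by
      conv_lhs => rw [h1]
      refine norm_add_sq_eq_norm_sq_add_norm_sq_of_inner_eq_zero (𝕜 := ℂ) _ _ ?_
      rw [inner_smul_right, ← inner_conj_symm w, hwg, map_zero, mul_zero]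
    nlinarith [norm_nonneg w, norm_nonneg v, mul_self_nonneg ‖inner ℂ g v • g‖]
  have hdiff : circ hS (reflector ℓ a n t ω) ψ
      - phaseRefl (gibbsState S a t) (norm_gibbsState t) ω ψ
      = -((1 - (ω : ℂ)) • F⁻¹ (embed a (K w))) := by
    rw [reflector_apply hS n t ω hψ.1, phaseRefl_apply, gibbsState, inner_embed, ← gibbsState]
    have h1 : embed a (K w) = embed a (K v) - inner ℂ g v • gibbsState S a t := by
      rw [hw, map_sub, map_smul, hKg, embed_sub, embed_smul, gibbsState]
    rw [h1, map_sub, map_smul, hFe, smul_sub, smul_smul, embed]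
    abel
  rw [hdiff, norm_neg, norm_smul, LinearIsometryEquiv.norm_map, norm_embed]
  calc ‖1 - (ω : ℂ)‖ * ‖K w‖ ≤ 2 * ((1 / 4) ^ s * ‖ψ‖) := by
        refine mul_le_mul (norm_one_sub_circle_le ω) ?_ (norm_nonneg _) (by norm_num)
        refine hKw.trans ?_
        gcongr
        exact hwv.trans (norm_apply_le_norm ψ _)
    _ = _ := by ring

end CodeSpace

/-! ### Preparation of the Gibbs states along the schedule -/

section Preparation

variable {ℓ a : ℕ}

/-- Fixed-point search from `|π_t⟩` to `|π_{t+1}⟩`, and its inverse. -/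
def searchCircuits (ℓ a n t : ℕ) (ω : Circle) :
    ℕ → List (Gate ℓ (2 * a + 3)) × List (Gate ℓ (2 * a + 3))
  | 0 => ([], [])
  | k + 1 =>
    ((searchCircuits ℓ a n t ω k).1 ++ reflector ℓ a n (t + 1) ω ++ (searchCircuits ℓ a n t ω k).2
        ++ reflector ℓ a n t ω ++ (searchCircuits ℓ a n t ω k).1,
      (searchCircuits ℓ a n t ω k).2 ++ reflector ℓ a n t ω⁻¹ ++ (searchCircuits ℓ a n t ω k).1
        ++ reflector ℓ a n (t + 1) ω⁻¹ ++ (searchCircuits ℓ a n t ω k).2)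

/-- Preparation of `|π_t⟩` from `|π_0⟩`. -/
def prepare (ℓ a n μ : ℕ) : ℕ → List (Gate ℓ (2 * a + 3))
  | 0 => []
  | t + 1 => prepare ℓ a n μ t ++ (searchCircuits ℓ a n t sixthRoot μ).1

variable {Ω : Type u} [Fintype Ω] [DecidableEq Ω] {S : System Ω} {δ : ℝ} {hS : S.WeightsLeOne ℓ}

theorem System.weight_mul_boltzmann (i : ℕ) (σ : Ω) :
    S.weight i σ * S.boltzmann i σ = S.Z (i + 1) / S.Z i * S.boltzmann (i + 1) σ := by
  have h1 := (S.Z_pos i).ne'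
  have h2 := (S.Z_pos (i + 1)).ne'
  have h3 : S.weight i σ * Real.exp (-(S.β i * S.energy σ))
      = Real.exp (-(S.β (i + 1) * S.energy σ)) := by
    rw [System.weight, ← Real.exp_add]; congr 1; ring
  rw [System.boltzmann, System.boltzmann, ← h3]
  field_simp

theorem System.sum_weight_mul_boltzmann (i : ℕ) :
    ∑ σ, S.weight i σ * S.boltzmann i σ = S.Z (i + 1) / S.Z i := by
  simp_rw [S.weight_mul_boltzmann, ← Finset.mul_sum, S.sum_boltzmann, mul_one]

/-- The overlap is the mean of `√y_i` under `π_i` divided by `√α_i`. As `0 ≤ y_i ≤ 1`, it is at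
least the mean of `y_i` divided by `√α_i`, which is `√α_i`. -/
theorem System.overlap_gibbs (h : S.WeightsLeOne ℓ) {i : ℕ} (hi : i < ℓ) :
    S.Z (i + 1) / S.Z i ≤ ‖inner ℂ (S.gibbs (i + 1)) (S.gibbs i)‖ ^ 2 := by
  set α := S.Z (i + 1) / S.Z i with hα
  have hα0 : 0 < α := div_pos (S.Z_pos _) (S.Z_pos _)
  have hsα := Real.sqrt_pos.2 hα0
  have h1 : inner ℂ (S.gibbs (i + 1)) (S.gibbs i)
      = ((∑ x, Real.sqrt (S.boltzmann (i + 1) x) * Real.sqrt (S.boltzmann i x) : ℝ) : ℂ) := by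
    rw [System.inner_gibbs]
    push_cast
    exact Finset.sum_congr rfl fun x _ => by rw [System.gibbs_apply, if_pos rfl]
  have h2 : Real.sqrt α
      ≤ ∑ x, Real.sqrt (S.boltzmann (i + 1) x) * Real.sqrt (S.boltzmann i x) := by
    have h3 : Real.sqrt α = ∑ x, S.weight i x * S.boltzmann i x / Real.sqrt α := by
      rw [← Finset.sum_div, S.sum_weight_mul_boltzmann, Real.div_sqrt]
    rw [h3]
    refine Finset.sum_le_sum fun x _ => ?_
    have hw := S.weight_pos i x
    have hp := S.boltzmann_pos i x
    have hp' := S.boltzmann_pos (i + 1) x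
    have h4 : S.boltzmann (i + 1) x = S.weight i x * S.boltzmann i x / α := by
      rw [S.weight_mul_boltzmann, mul_div_cancel_left₀ _ hα0.ne']
    rw [h4, Real.sqrt_div (mul_pos hw hp).le, Real.sqrt_mul hw.le, div_mul_eq_mul_div]
    refine div_le_div_of_nonneg_right ?_ hsα.le
    rw [mul_assoc, Real.mul_self_sqrt hp.le]
    refine mul_le_mul_of_nonneg_right ?_ hp.le
    exact Real.le_sqrt_of_sq_le (by nlinarith [h i hi x])
  rw [h1, Complex.norm_real, Real.norm_eq_abs, sq_abs]
  calc α = Real.sqrt α ^ 2 := (Real.sq_sqrt hα0.le).symm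
    _ ≤ _ := by gcongr

/-- Search and inverse search are treated together because each recursion calls the other. The
approximate inverse is built from reflectors with the inverse phase. The recursion `c ↦ 3c + 2` for
the number of reflectors has the solution `3^k - 1`. -/
theorem approx_searchCircuits {n t : ℕ} {ω : Circle} {ε : ℝ}
    (h0 : ∀ ω, Approx hS (reflector ℓ a n t ω)
      (phaseRefl (gibbsState S a t) (norm_gibbsState t) ω) ε)
    (h1 : ∀ ω, Approx hS (reflector ℓ a n (t + 1) ω)
      (phaseRefl (gibbsState S a (t + 1)) (norm_gibbsState (t + 1)) ω) ε) (k : ℕ) :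
    Approx hS (searchCircuits ℓ a n t ω k).1 (fixedPoint (gibbsState S a t)
      (gibbsState S a (t + 1)) (norm_gibbsState t) (norm_gibbsState (t + 1)) ω k)
      ((3 ^ k - 1) * ε) ∧
    Approx hS (searchCircuits ℓ a n t ω k).2 (fixedPoint (gibbsState S a t)
      (gibbsState S a (t + 1)) (norm_gibbsState t) (norm_gibbsState (t + 1)) ω k)⁻¹
      ((3 ^ k - 1) * ε) := by
  induction k with
  | zero =>
    simp only [searchCircuits, fixedPoint, pow_zero, sub_self, zero_mul, inv_one]
    exact ⟨Approx.nil, Approx.nil⟩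
  | succ k ih =>
    obtain ⟨ih1, ih2⟩ := ih
    constructor
    · have := (((ih1.append (h1 ω)).append ih2).append (h0 ω)).append ih1
      simp only [searchCircuits, fixedPoint]
      convert this using 1
      ring
    · have := (((ih2.append (h0 ω⁻¹)).append ih1).append (h1 ω⁻¹)).append ih2
      simp only [searchCircuits, fixedPoint, mul_inv_rev, inv_inv, phaseRefl_inv]
      convert this using 1
      · group
      · ring

variable (S a) in
/-- The exact counterpart of `prepare`. -/
def prepareOp (μ : ℕ) : ℕ → (HState Ω (2 * a + 3) ≃ₗᵢ[ℂ] HState Ω (2 * a + 3))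
  | 0 => 1
  | t + 1 => fixedPoint (gibbsState S a t) (gibbsState S a (t + 1)) (norm_gibbsState t)
      (norm_gibbsState (t + 1)) sixthRoot μ * prepareOp μ t

theorem approx_prepare {n μ : ℕ} {ε : ℝ}
    (h : ∀ t < ℓ, ∀ ω, Approx hS (reflector ℓ a n t ω)
      (phaseRefl (gibbsState S a t) (norm_gibbsState t) ω) ε) {t : ℕ} (ht : t < ℓ) :
    Approx hS (prepare ℓ a n μ t) (prepareOp a S μ t) (t * ((3 ^ μ - 1) * ε)) := by
  induction t with
  | zero => simp only [prepare, prepareOp, Nat.cast_zero, zero_mul]; exact Approx.nil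
  | succ t ih =>
    have := (ih (by omega)).append
      (approx_searchCircuits (h t (by omega)) (h (t + 1) ht) μ (ω := sixthRoot)).1
    simp only [prepare, prepareOp]
    convert this using 1
    push_cast; ring

theorem inner_gibbsState (t t' : ℕ) :
    inner ℂ (gibbsState S a t) (gibbsState S a t') = inner ℂ (S.gibbs t) (S.gibbs t') := by
  rw [gibbsState, inner_embed, gibbsState, embed_apply, if_pos rfl]

/-- Each search introduces an unknown phase. The phases multiply into one global factor, invisible
to measurement, while the distances add. -/
theorem exists_phase_norm_prepareOp_sub_le (h : S.IsAnnealing ℓ δ) (μ : ℕ) {t : ℕ} (ht : t < ℓ) :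
    ∃ c : ℂ, ‖c‖ = 1 ∧ ‖prepareOp a S μ t (gibbsState S a 0) - c • gibbsState S a t‖
      ≤ t * Real.sqrt (2 * (1 / 2) ^ 3 ^ μ) := by
  induction t with
  | zero => exact ⟨1, by simp, by simp [prepareOp]⟩
  | succ t ih =>
    obtain ⟨c, hc, hle⟩ := ih (by omega)
    obtain ⟨d, hd, hle'⟩ := exists_phase_norm_fixedPoint_sub_le (gibbsState S a t)
      (gibbsState S a (t + 1)) (norm_gibbsState t) (norm_gibbsState (t + 1)) (by
        rw [inner_gibbsState]
        exact (h.ratio t (by omega)).trans (System.overlap_gibbs h.weightsLeOne (by omega))) μ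
    set U := fixedPoint (gibbsState S a t) (gibbsState S a (t + 1)) (norm_gibbsState t)
      (norm_gibbsState (t + 1)) sixthRoot μ
    refine ⟨c * d, by rw [norm_mul, hc, hd, mul_one], ?_⟩
    have hle2 := Real.le_sqrt_of_sq_le hle'
    rw [prepareOp, LinearIsometryEquiv.coe_mul, Function.comp_apply]
    calc ‖U (prepareOp a S μ t (gibbsState S a 0)) - (c * d) • gibbsState S a (t + 1)‖
        = ‖U (prepareOp a S μ t (gibbsState S a 0) - c • gibbsState S a t)
            + c • (U (gibbsState S a t) - d • gibbsState S a (t + 1))‖ := by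
          rw [map_sub, map_smul, smul_sub, smul_smul]; congr 1; abel
      _ ≤ ‖U (prepareOp a S μ t (gibbsState S a 0) - c • gibbsState S a t)‖
            + ‖c • (U (gibbsState S a t) - d • gibbsState S a (t + 1))‖ := norm_add_le _ _
      _ ≤ t * Real.sqrt (2 * (1 / 2) ^ 3 ^ μ) + 1 * Real.sqrt (2 * (1 / 2) ^ 3 ^ μ) := by
          rw [LinearIsometryEquiv.norm_map, norm_smul, hc]
          gcongr
      _ = _ := by push_cast; ring

end Preparation

/-! ### Marking and Grover iterations -/

section AmplitudeEstimation

variable {ℓ a : ℕ}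

/-- The rotation `V_i` on the first work qubit and the tilt on the second one. -/
def mark (a : ℕ) {i : ℕ} (hi : i < ℓ) : List (Gate ℓ (2 * a + 3)) :=
  [.rotate i hi (wire a 0)] ++ [ctrlGate ∅ (wire a 1) tiltGate]

/-- The inverse of `mark`. -/
def markInv (a : ℕ) {i : ℕ} (hi : i < ℓ) : List (Gate ℓ (2 * a + 3)) :=
  [ctrlGate ∅ (wire a 1) tiltGate⁻¹] ++ ([ctrlGate ∅ (wire a 0) (phaseGate negOne)]
    ++ [.rotate i hi (wire a 0)] ++ [ctrlGate ∅ (wire a 0) (phaseGate negOne)])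

/-- One Grover iteration. -/
def groverStep (a n : ℕ) {i : ℕ} (hi : i < ℓ) : List (Gate ℓ (2 * a + 3)) :=
  [ctrlGate {wire a 0} (wire a 1) (phaseGate negOne)] ++ markInv a hi ++ reflector ℓ a n i negOne
    ++ mark a hi

/-- `k` Grover iterations. -/
def groverSteps (a n : ℕ) {i : ℕ} (hi : i < ℓ) : ℕ → List (Gate ℓ (2 * a + 3))
  | 0 => []
  | k + 1 => groverSteps a n hi k ++ groverStep a n hi

/-- Prepare `|π_i⟩`, mark it and perform `k` Grover iterations. -/
def sampleCircuit (a n μ : ℕ) {i : ℕ} (hi : i < ℓ) (k : ℕ) : List (Gate ℓ (2 * a + 3)) :=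
  -- The reflectors act on patterns with both work qubits in `|1⟩`, whereas circuits start with all
  -- qubits in `|0⟩`.
  ([ctrlGate ∅ (wire a 0) notGate] ++ [ctrlGate ∅ (wire a 1) notGate]) ++
    (prepare ℓ a n μ i ++ mark a hi ++ groverSteps a n hi k)

variable {Ω : Type u} [Fintype Ω] [DecidableEq Ω] {S : System Ω} {δ : ℝ} {hS : S.WeightsLeOne ℓ}

theorem isCode_ctrlGate {ctrl : Finset (Fin (2 * a + 3))} {t : Fin (2 * a + 3)}
    (hc : ctrl.card ≤ 2) (ht : t ∉ ctrl) (ht2 : t.val < 2) (v : Matrix.unitaryGroup Bool ℂ)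
    {ψ : HState Ω (2 * a + 3)} (hψ : IsCode S ψ) : IsCode S (circ hS [ctrlGate ctrl t v] ψ) := by
  refine ⟨fun b w hw hb => ?_, fun b => ?_⟩
  · rw [ctrlGate_apply hS hc ht]
    have hne : w ≠ t := by rintro rfl; omega
    split_ifs
    · refine Finset.sum_eq_zero fun x _ => ?_
      rw [hψ.1 _ w hw (by rw [Function.update_of_ne hne, hb]), smul_zero]
    · exact hψ.1 b w hw hb
  · rw [ctrlGate_apply hS hc ht]
    split_ifs
    · exact Submodule.sum_mem _ fun x _ => Submodule.smul_mem _ _ (hψ.2 _)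
    · exact hψ.2 b

theorem rotate_apply {i : ℕ} (hi : i < ℓ) (t : Fin (2 * a + 3)) (ψ : HState Ω (2 * a + 3))
    (b : Fin (2 * a + 3) → Bool) (z : Ω × Ω) :
    circ hS [.rotate i hi t] ψ b z
      = ∑ x : Bool, ((S.rotation i z.1 (b t) x : ℝ) : ℂ) * ψ (Function.update b t x) z := by
  rw [circ_singleton]; rfl

theorem isCode_rotate {i : ℕ} (hi : i < ℓ) {ψ : HState Ω (2 * a + 3)} (hψ : IsCode S ψ) :
    IsCode S (circ hS [.rotate i hi (wire a 0)] ψ) := by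
  refine ⟨fun b w hw hb => ?_, fun b => ?_⟩
  · ext z
    rw [rotate_apply]
    have hne : w ≠ wire a 0 := by
      rintro rfl; rw [wire_val (by omega)] at hw; omega
    refine Finset.sum_eq_zero fun x _ => ?_
    rw [hψ.1 _ w hw (by rw [Function.update_of_ne hne, hb])]
    simp
  · rw [System.mem_spaceA]
    intro z hz
    rw [rotate_apply]
    refine Finset.sum_eq_zero fun x _ => ?_
    rw [S.mem_spaceA.1 (hψ.2 _) z hz, mul_zero]

/-- Conjugation by the sign flip on `|1⟩` reverses the angle of a real rotation. -/
theorem rotate_conj_inv {i : ℕ} (hi : i < ℓ) :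
    circ hS ([ctrlGate ∅ (wire a 0) (phaseGate negOne)] ++ [.rotate i hi (wire a 0)]
      ++ [ctrlGate ∅ (wire a 0) (phaseGate negOne)])
      = (circ hS [Gate.rotate i hi (wire a 0)])⁻¹ := by
  rw [eq_inv_iff_mul_eq_one, circ_append, circ_append]
  refine LinearIsometryEquiv.ext fun ψ => ?_
  ext b z
  have h0 := (S.weight_pos i z.1).le
  have hs : Real.sqrt (S.weight i z.1) * Real.sqrt (S.weight i z.1)
      + Real.sqrt (1 - S.weight i z.1) * Real.sqrt (1 - S.weight i z.1) = 1 := by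
    rw [Real.mul_self_sqrt h0, Real.mul_self_sqrt (by linarith [hS i hi z.1])]; ring
  have hs' : (Real.sqrt (S.weight i z.1) : ℂ) * Real.sqrt (S.weight i z.1)
      + Real.sqrt (1 - S.weight i z.1) * Real.sqrt (1 - S.weight i z.1) = 1 := by exact_mod_cast hs
  simp only [LinearIsometryEquiv.coe_mul, Function.comp_apply]
  rw [ctrlGate_phase_apply hS (by simp) (by simp), PiLp.smul_apply, rotate_apply]
  simp only [ctrlGate_phase_apply hS (ctrl := ∅) (by simp) (Finset.notMem_empty _),
    PiLp.smul_apply, rotate_apply, Fintype.sum_bool, Function.update_self, Function.update_idem]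
  have hone : (1 : HState Ω (2 * a + 3) ≃ₗᵢ[ℂ] HState Ω (2 * a + 3)) ψ = ψ := rfl
  rw [hone]
  cases hb : b (wire a 0)
  · have : Function.update b (wire a 0) false = b := by rw [← hb]; simp
    simp [this, System.rotation, negOne_coe]
    linear_combination (ψ b z) * hs'
  · have : Function.update b (wire a 0) true = b := by rw [← hb]; simp
    simp [this, System.rotation, negOne_coe]
    linear_combination (ψ b z) * hs'

theorem markInv_eq {i : ℕ} (hi : i < ℓ) : circ hS (markInv a hi) = (circ hS (mark a hi))⁻¹ := by
  rw [markInv, mark, circ_append, rotate_conj_inv, circ_append,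
    ctrlGate_inv hS (by simp) (by simp), mul_inv_rev]

theorem isCode_mark {i : ℕ} (hi : i < ℓ) {ψ : HState Ω (2 * a + 3)} (hψ : IsCode S ψ) :
    IsCode S (circ hS (mark a hi) ψ) := by
  rw [mark, circ_append, LinearIsometryEquiv.coe_mul, Function.comp_apply]
  exact isCode_ctrlGate (by simp) (by simp) (by rw [wire_val (by omega)]; omega) _
    (isCode_rotate hi hψ)

theorem isCode_markInv {i : ℕ} (hi : i < ℓ) {ψ : HState Ω (2 * a + 3)} (hψ : IsCode S ψ) :
    IsCode S (circ hS (markInv a hi) ψ) := by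
  simp only [markInv, circ_append, LinearIsometryEquiv.coe_mul, Function.comp_apply]
  refine isCode_ctrlGate (by simp) (by simp) (by rw [wire_val (by omega)]; omega) _
    (isCode_rotate hi (isCode_ctrlGate (by simp) (by simp) (by rw [wire_val (by omega)]; omega) _
      (isCode_ctrlGate (by simp) (by simp) (by rw [wire_val (by omega)]; omega) _ hψ)))

theorem conj_phaseRefl {E : Type*} [NormedAddCommGroup E] [InnerProductSpace ℂ E]
    (V : E ≃ₗᵢ[ℂ] E) (e : E) (he : ‖e‖ = 1) (ω : Circle) :
    V * (phaseRefl e he ω * V⁻¹) = phaseRefl (V e) (by rw [V.norm_map, he]) ω := by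
  refine LinearIsometryEquiv.ext fun x => ?_
  have h1 : V (V⁻¹ x) = x := V.apply_symm_apply x
  have h2 : inner ℂ e (V⁻¹ x) = inner ℂ (V e) x := by
    rw [← V.inner_map_map e, h1]
  simp only [LinearIsometryEquiv.coe_mul, Function.comp_apply, phaseRefl_apply, map_sub, map_smul,
    h1, h2]

/-- The negation of the marked states. -/
abbrev markedSign (hS : S.WeightsLeOne ℓ) (a : ℕ) :
    HState Ω (2 * a + 3) ≃ₗᵢ[ℂ] HState Ω (2 * a + 3) :=
  circ hS [ctrlGate {wire a 0} (wire a 1) (phaseGate negOne)]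

theorem norm_mark_gibbsState {i : ℕ} (hi : i < ℓ) :
    ‖circ hS (mark a hi) (gibbsState S a i)‖ = 1 := by
  rw [LinearIsometryEquiv.norm_map, norm_gibbsState]

theorem wire_one_notMem : wire a 1 ∉ ({wire a 0} : Finset (Fin (2 * a + 3))) := by
  rw [Finset.mem_singleton]
  exact wire_ne (by omega) (by omega) (by omega)

theorem approx_groverStep {n i : ℕ} (hi : i < ℓ) {ε : ℝ}
    (h : Approx hS (reflector ℓ a n i negOne)
      (phaseRefl (gibbsState S a i) (norm_gibbsState i) negOne) ε) :
    Approx hS (groverStep a n hi) (phaseRefl (circ hS (mark a hi) (gibbsState S a i))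
      (norm_mark_gibbsState hi) negOne * markedSign hS a) ε := by
  have h1 : Approx hS [ctrlGate {wire a 0} (wire a 1) (phaseGate negOne)] (markedSign hS a) 0 :=
    Approx.of_exact fun ψ hψ => isCode_ctrlGate (by simp) wire_one_notMem
      (by rw [wire_val (by omega)]; omega) _ hψ
  have h2 : Approx hS (markInv a hi) (circ hS (mark a hi))⁻¹ 0 := by
    rw [← markInv_eq]; exact Approx.of_exact fun ψ hψ => isCode_markInv hi hψ
  have h3 : Approx hS (mark a hi) (circ hS (mark a hi)) 0 :=
    Approx.of_exact fun ψ hψ => isCode_mark hi hψ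
  have h4 := ((h1.append h2).append h).append h3
  rw [groverStep]
  convert h4 using 1
  · rw [← conj_phaseRefl _ _ (norm_gibbsState i)]
    simp only [mul_assoc]
  · ring

theorem approx_groverSteps {n i : ℕ} (hi : i < ℓ) {ε : ℝ}
    (h : Approx hS (reflector ℓ a n i negOne)
      (phaseRefl (gibbsState S a i) (norm_gibbsState i) negOne) ε) (k : ℕ) :
    Approx hS (groverSteps a n hi k) ((phaseRefl (circ hS (mark a hi) (gibbsState S a i))
      (norm_mark_gibbsState hi) negOne * markedSign hS a) ^ k) (k * ε) := by
  induction k with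
  | zero => simp only [groverSteps, pow_zero, Nat.cast_zero, zero_mul]; exact Approx.nil
  | succ k ih =>
    have := ih.append (approx_groverStep hi h)
    rw [groverSteps]
    convert this using 1
    · rw [pow_succ']
    · push_cast; ring

end AmplitudeEstimation

/-! ### The probability of a marked outcome -/

section MarkedProbability

variable {Ω : Type u} [Fintype Ω] [DecidableEq Ω] {S : System Ω} {ℓ a : ℕ} {δ : ℝ}
  {hS : S.WeightsLeOne ℓ}

/-- Whether both work qubits are `1`. -/
def isMarked (b : Fin (2 * a + 3) → Bool) : Bool := b (wire a 0) && b (wire a 1)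

/-- The projection onto the states with both work qubits in `|1⟩`. -/
def markedPart : HState Ω (2 * a + 3) →ₗ[ℂ] HState Ω (2 * a + 3) where
  toFun ψ := WithLp.toLp 2 fun b => if isMarked b then ψ b else 0
  map_add' ψ φ := by
    ext1 b
    simp only [PiLp.add_apply]
    split_ifs <;> simp
  map_smul' c ψ := by
    ext1 b
    simp only [PiLp.smul_apply, RingHom.id_apply]
    split_ifs <;> simp

theorem markedPart_apply (ψ : HState Ω (2 * a + 3)) (b : Fin (2 * a + 3) → Bool) :
    markedPart ψ b = if isMarked b then ψ b else 0 := rfl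

theorem norm_markedPart_sq (ψ : HState Ω (2 * a + 3)) :
    ‖markedPart ψ‖ ^ 2 = ∑ b, if isMarked b then ‖ψ b‖ ^ 2 else 0 := by
  rw [PiLp.norm_sq_eq_of_L2]
  refine Finset.sum_congr rfl fun b _ => ?_
  rw [markedPart_apply]
  split_ifs <;> simp

theorem norm_markedPart_le (ψ : HState Ω (2 * a + 3)) : ‖markedPart ψ‖ ≤ ‖ψ‖ := by
  refine le_of_sq_le_sq ?_ (norm_nonneg _)
  rw [norm_markedPart_sq, PiLp.norm_sq_eq_of_L2]
  refine Finset.sum_le_sum fun b _ => ?_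
  split_ifs
  · exact le_rfl
  · positivity

theorem abs_norm_markedPart_sq_sub_le {x y : HState Ω (2 * a + 3)} (hx : ‖x‖ = 1) (hy : ‖y‖ = 1) :
    |‖markedPart x‖ ^ 2 - ‖markedPart y‖ ^ 2| ≤ 2 * ‖x - y‖ := by
  rw [sq_sub_sq, abs_mul]
  have h1 : |‖markedPart x‖ + ‖markedPart y‖| ≤ 2 := by
    rw [abs_of_nonneg (by positivity)]
    linarith [norm_markedPart_le x, norm_markedPart_le y]
  have h2 : |‖markedPart x‖ - ‖markedPart y‖| ≤ ‖x - y‖ := by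
    refine (abs_norm_sub_norm_le _ _).trans ?_
    rw [← map_sub]
    exact norm_markedPart_le _
  exact mul_le_mul h1 h2 (abs_nonneg _) (by norm_num)

theorem markedPart_markedPart (ψ : HState Ω (2 * a + 3)) :
    markedPart (markedPart ψ) = markedPart ψ := by
  ext1 b
  rw [markedPart_apply, markedPart_apply]
  split_ifs <;> rfl

theorem inner_markedPart_sub (ψ φ : HState Ω (2 * a + 3)) :
    inner ℂ (markedPart ψ) (φ - markedPart φ) = 0 := by
  rw [PiLp.inner_apply]
  refine Finset.sum_eq_zero fun b _ => ?_
  rw [PiLp.sub_apply, markedPart_apply, markedPart_apply]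
  split_ifs <;> simp

theorem markedSign_apply (ψ : HState Ω (2 * a + 3)) :
    markedSign hS a ψ = ψ - (2 : ℂ) • markedPart ψ := by
  ext1 b
  rw [markedSign, ctrlGate_phase_apply hS (by simp) wire_one_notMem]
  simp only [PiLp.sub_apply, PiLp.smul_apply, markedPart_apply, isMarked, Finset.mem_singleton,
    forall_eq, Bool.and_eq_true]
  split_ifs
  · rw [negOne_coe]; module
  · simp

/-- Both work qubits start and end in `|1⟩`, so only the corresponding diagonal entries `√y_i` and
`1/2` of rotation and tilt contribute. -/
theorem markedPart_mark {i : ℕ} (hi : i < ℓ) :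
    markedPart (circ hS (mark a hi) (gibbsState S a i))
      = embed a (WithLp.toLp 2 fun z =>
        ((1 / 2 * Real.sqrt (S.weight i z.1) : ℝ) : ℂ) * S.gibbs i z) := by
  ext b z
  rw [markedPart_apply, embed_apply]
  by_cases h : isMarked b = true
  · rw [if_pos h]
    rw [isMarked, Bool.and_eq_true] at h
    have hu0 : Function.update b (wire a 0) true = b := by rw [← h.1]; simp
    have hu1 : Function.update b (wire a 1) true = b := by rw [← h.2]; simp
    have hne : ∀ x : Bool, x = false → ∀ w, (w = wire a 0 ∨ w = wire a 1) →
        ∀ b' : Fin (2 * a + 3) → Bool, b' w = x → gibbsState S a i b' = 0 := by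
      rintro x rfl w hw b' hb'
      rw [gibbsState, embed_apply, if_neg]
      rintro rfl
      rcases hw with rfl | rfl
      · rw [workOnes_wire_zero] at hb'; cases hb'
      · rw [workOnes_wire_one] at hb'; cases hb'
    rw [mark, circ_append, LinearIsometryEquiv.coe_mul, Function.comp_apply,
      ctrlGate_apply hS (by simp) (by simp)]
    simp only [Finset.notMem_empty, false_imp_iff, implies_true, if_true, Fintype.sum_bool, hu1,
      PiLp.add_apply, PiLp.smul_apply, rotate_apply, hu0, h.1, h.2]
    rw [hne false rfl (wire a 0) (Or.inl rfl) (Function.update b (wire a 0) false) (by simp),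
      hne false rfl (wire a 1) (Or.inr rfl) (Function.update _ (wire a 0) true) (by
        rw [Function.update_of_ne (wire_ne (by omega) (by omega) (by omega))]; simp),
      hne false rfl (wire a 1) (Or.inr rfl) (Function.update _ (wire a 0) false) (by
        rw [Function.update_of_ne (wire_ne (by omega) (by omega) (by omega))]; simp)]
    simp only [gibbsState, embed_apply]
    split_ifs
    · simp [tiltGate, System.rotation, mul_assoc]
    · simp
  · rw [if_neg h, if_neg]
    rintro rfl
    exact h (by rw [isMarked, workOnes_wire_zero, workOnes_wire_one]; rfl)

theorem norm_markedPart_mark_sq {i : ℕ} (hi : i < ℓ) :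
    ‖markedPart (circ hS (mark a hi) (gibbsState S a i))‖ ^ 2 = S.Z (i + 1) / S.Z i / 4 := by
  rw [markedPart_mark hi, norm_embed, S.norm_sq_of_mem_spaceA, ← S.sum_weight_mul_boltzmann,
    Finset.sum_div]
  · refine Finset.sum_congr rfl fun x _ => ?_
    have h1 := Real.sq_sqrt (S.weight_pos i x).le
    have h2 := Real.sq_sqrt (S.boltzmann_pos i x).le
    rw [PiLp.toLp_apply, System.gibbs_apply, if_pos rfl, ← Complex.ofReal_mul, Complex.norm_real, Real.norm_eq_abs,
      sq_abs, mul_pow, mul_pow, h1, h2]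
    ring
  · rw [System.mem_spaceA]
    intro z hz
    simp [System.gibbs_apply, hz]

variable (S) in
/-- The angle with `cos φ = α_i / 2 - 1`. -/
def angle (i : ℕ) : ℝ := Real.arccos (S.Z (i + 1) / S.Z i / 2 - 1)

theorem cos_angle {i : ℕ} (h : S.Z (i + 1) / S.Z i ≤ 1) :
    Real.cos (angle S i) = S.Z (i + 1) / S.Z i / 2 - 1 := by
  have := div_pos (S.Z_pos (i + 1)) (S.Z_pos i)
  exact Real.cos_arccos (by linarith) (by linarith)

theorem ratio_le_one (h : S.WeightsLeOne ℓ) {i : ℕ} (hi : i < ℓ) : S.Z (i + 1) / S.Z i ≤ 1 := by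
  rw [← S.sum_weight_mul_boltzmann, ← S.sum_boltzmann i]
  refine Finset.sum_le_sum fun x _ => ?_
  have := S.boltzmann_pos i x
  nlinarith [h i hi x]

/-- With `θ` half of `angle S i`, the marked part has squared norm `cos² θ = α_i / 4`. After `k`
iterations it is `cos² ((2k + 1) θ)`, rewritten by the double-angle formula. -/
theorem norm_markedPart_grover_sq {i : ℕ} (hi : i < ℓ) (k : ℕ) :
    ‖markedPart (((phaseRefl (circ hS (mark a hi) (gibbsState S a i))
      (norm_mark_gibbsState hi) negOne * markedSign hS a) ^ k)
        (circ hS (mark a hi) (gibbsState S a i)))‖ ^ 2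
      = (1 + Real.cos ((2 * k + 1) * angle S i)) / 2 := by
  set ψ := circ hS (mark a hi) (gibbsState S a i) with hψ
  have hψn : ‖ψ‖ = 1 := norm_mark_gibbsState hi
  set g := markedPart ψ with hg
  set h := ψ - markedPart ψ with hh
  have hsum : ψ = g + h := by rw [hg, hh]; abel
  have hr1 := ratio_le_one hS hi
  have hr0 := div_pos (S.Z_pos (i + 1)) (S.Z_pos i)
  set θ := angle S i / 2 with hθ
  have hcos : Real.cos (2 * θ) = S.Z (i + 1) / S.Z i / 2 - 1 := by
    rw [← cos_angle hr1, hθ]; congr 1; ring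
  have hcos2 : Real.cos θ ^ 2 = S.Z (i + 1) / S.Z i / 4 := by
    rw [Real.cos_two_mul] at hcos; linarith
  have hsin2 : Real.sin θ ^ 2 = 1 - S.Z (i + 1) / S.Z i / 4 := by
    rw [Real.sin_sq, hcos2]
  have hgn : ‖g‖ ^ 2 = Real.cos θ ^ 2 := by rw [hcos2]; exact norm_markedPart_mark_sq hi
  have hgh : inner ℂ g h = 0 := inner_markedPart_sub ψ ψ
  have hhn : ‖h‖ ^ 2 = Real.sin θ ^ 2 := by
    have h1 := norm_add_sq_eq_norm_sq_add_norm_sq_of_inner_eq_zero (𝕜 := ℂ) g h hgh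
    rw [← hsum, hψn] at h1
    rw [Real.sin_sq, ← hgn]; linarith
  have hc : Real.cos θ ≠ 0 := by intro h0; rw [h0] at hcos2; norm_num at hcos2; linarith
  have hs : Real.sin θ ≠ 0 := by intro h0; rw [h0] at hsin2; norm_num at hsin2; linarith
  have hgm : markedPart g = g := markedPart_markedPart ψ
  have hhm : markedPart h = 0 := by rw [hh, map_sub, markedPart_markedPart, sub_self]
  have hCg : markedSign hS a g = -g := by rw [markedSign_apply, hgm]; module
  have hCh : markedSign hS a h = h := by rw [markedSign_apply, hhm, smul_zero, sub_zero]
  have hn : ‖g + h‖ = 1 := by rw [← hsum, hψn]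
  have key := grover_iterate hgh hgn hhn hc hs hn negOne_coe hCg hCh k
  have hrefl : phaseRefl ψ hψn negOne = phaseRefl (g + h) hn negOne := by
    congr 1
  have key2 : ((phaseRefl ψ hψn negOne * markedSign hS a) ^ k) ψ
      = ((phaseRefl (g + h) hn negOne * markedSign hS a) ^ k) (g + h) := by
    rw [hrefl]; exact congrArg _ hsum
  rw [key2, key, map_add, map_smul, map_smul, hgm, hhm, smul_zero, add_zero, norm_smul, mul_pow,
    hgn, Complex.norm_real, Real.norm_eq_abs, sq_abs, div_pow, div_mul_cancel₀ _ (pow_ne_zero 2 hc)]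
  have h2 : (2 * (k : ℝ) + 1) * angle S i = 2 * ((2 * k + 1) * θ) := by rw [hθ]; ring
  rw [h2, Real.cos_two_mul]
  ring

theorem initial_not_not (h0 : S.β 0 = 0) :
    circ hS ([ctrlGate ∅ (wire a 0) notGate] ++ [ctrlGate ∅ (wire a 1) notGate])
      (WithLp.toLp 2 (initial S)) = gibbsState S a 0 := by
  ext1 b
  rw [circ_append, LinearIsometryEquiv.coe_mul, Function.comp_apply,
    ctrlGate_not_apply hS (by simp) (by simp), ctrlGate_not_apply hS (by simp) (by simp),
    PiLp.toLp_apply, initial, gibbsState, embed_apply, start_eq_gibbs h0]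
  have hiff : flipIf ∅ (wire a 0) (flipIf ∅ (wire a 1) b) = (fun _ => false) ↔ b = workOnes a := by
    have hne : wire a 0 ≠ wire a 1 := wire_ne (by omega) (by omega) (by omega)
    constructor
    · intro h
      refine eq_workOnes ?_ ?_ fun w hw => ?_
      · have := congrFun h (wire a 0)
        rw [flipIf_self, flipIf_of_ne hne] at this
        simpa using this
      · have := congrFun h (wire a 1)
        rw [flipIf_of_ne hne.symm, flipIf_self] at this
        simpa using this
      · have := congrFun h w
        rwa [flipIf_of_ne, flipIf_of_ne] at this
        · rintro rfl; rw [wire_val (by omega)] at hw; omega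
        · rintro rfl; rw [wire_val (by omega)] at hw; omega
    · rintro rfl
      funext w
      by_cases hw0 : w = wire a 0
      · subst hw0
        rw [flipIf_self, flipIf_of_ne hne, workOnes_wire_zero]; simp
      · rw [flipIf_of_ne hw0]
        by_cases hw1 : w = wire a 1
        · subst hw1
          rw [flipIf_self, workOnes_wire_one]; simp
        · rw [flipIf_of_ne hw1, workOnes_of_le]
          by_contra hw
          have h2 : w.val = 0 ∨ w.val = 1 := by omega
          rcases h2 with h2 | h2
          · exact hw0 (by rw [eq_wire w, h2])
          · exact hw1 (by rw [eq_wire w, h2])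
  simp only [hiff]

theorem norm_initial (h0 : S.β 0 = 0) {m : ℕ} :
    ‖(WithLp.toLp 2 (initial S) : HState Ω m)‖ = 1 := by
  have h : ‖(WithLp.toLp 2 (initial S) : HState Ω m)‖ ^ 2 = 1 := by
    rw [PiLp.norm_sq_eq_of_L2, Finset.sum_eq_single fun _ => false]
    · simp [initial, start_eq_gibbs h0, S.norm_gibbs]
    · intro b _ hb; simp [initial, hb]
    · simp
  nlinarith [norm_nonneg (WithLp.toLp 2 (initial S) : HState Ω m)]

theorem sum_outcomeProb (hS : S.WeightsLeOne ℓ) (h0 : S.β 0 = 0) {m : ℕ} (c : List (Gate ℓ m)) :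
    ∑ b, outcomeProb S c b = 1 := by
  simp only [outcomeProb, runCircuit_eq hS]
  rw [← PiLp.norm_sq_eq_of_L2, LinearIsometryEquiv.norm_map, norm_initial h0, one_pow]

/-- The outcome of the measurement after `k` Grover iterations. -/
theorem abs_markedProb_sub_le (h : S.IsAnnealing ℓ δ) (hδ : 0 < δ) (hδ1 : δ ≤ 1)
    {n : ℕ} (hn : 4 ≤ (2 ^ n) ^ 2 * δ) {s : ℕ} (hs : 1 ≤ s) (ha : a = n * (2 * s)) (μ : ℕ)
    {i : ℕ} (hi : i < ℓ) (k : ℕ) :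
    |(∑ b, if isMarked b then outcomeProb S (sampleCircuit a n μ hi k) b else 0)
        - (1 + Real.cos ((2 * k + 1) * angle S i)) / 2|
      ≤ 2 * (i * Real.sqrt (2 * (1 / 2) ^ 3 ^ μ)
        + (i * (3 ^ μ - 1) + k) * (2 * (1 / 4) ^ s)) := by
  have hS := h.weightsLeOne
  set ε : ℝ := 2 * (1 / 4) ^ s with hε
  have hrefl : ∀ t < ℓ, ∀ ω, Approx hS (reflector ℓ a n t ω)
      (phaseRefl (gibbsState S a t) (norm_gibbsState t) ω) ε :=
    fun t ht ω => approx_reflector h hδ hδ1 ht hn hs ha ω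
  set V := circ hS (mark a hi) with hV
  set G := (phaseRefl (V (gibbsState S a i)) (norm_mark_gibbsState hi) negOne * markedSign hS a) ^ k
    with hG
  have hall : Approx hS (prepare ℓ a n μ i ++ mark a hi ++ groverSteps a n hi k)
      (G * (V * prepareOp a S μ i)) (i * ((3 ^ μ - 1) * ε) + 0 + k * ε) :=
    ((approx_prepare hrefl hi).append (Approx.of_exact fun ψ hψ => isCode_mark hi hψ)).append
      (approx_groverSteps hi (hrefl i hi negOne) k)
  obtain ⟨c, hc, hprep⟩ := exists_phase_norm_prepareOp_sub_le (a := a) h μ hi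
  set x := circ hS (sampleCircuit a n μ hi k) (WithLp.toLp 2 (initial S)) with hx
  set y := c • G (V (gibbsState S a i)) with hy
  have hxn : ‖x‖ = 1 := by rw [hx, LinearIsometryEquiv.norm_map, norm_initial h.start_temperature]
  have hyn : ‖y‖ = 1 := by
    rw [hy, norm_smul, hc, LinearIsometryEquiv.norm_map, LinearIsometryEquiv.norm_map,
      norm_gibbsState, one_mul]
  have hx' : x = circ hS (prepare ℓ a n μ i ++ mark a hi ++ groverSteps a n hi k)
      (gibbsState S a 0) := by
    rw [hx, sampleCircuit, circ_append, LinearIsometryEquiv.coe_mul, Function.comp_apply,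
      initial_not_not h.start_temperature]
  have hdist : ‖x - y‖ ≤ i * Real.sqrt (2 * (1 / 2) ^ 3 ^ μ) + (i * (3 ^ μ - 1) + k) * ε := by
    have h1 := (hall (gibbsState S a 0) (isCode_gibbsState 0)).2
    rw [norm_gibbsState, mul_one, ← hx'] at h1
    -- Marking and Grover iterations are unitary, so the preparation error is carried along
    -- unchanged; it is then added to the error of the approximate reflectors.
    have h2 : (G * (V * prepareOp a S μ i)) (gibbsState S a 0) - y
        = G (V (prepareOp a S μ i (gibbsState S a 0) - c • gibbsState S a i)) := by
      simp only [LinearIsometryEquiv.coe_mul, Function.comp_apply, map_sub, map_smul, hy]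
    calc ‖x - y‖ = ‖(x - (G * (V * prepareOp a S μ i)) (gibbsState S a 0))
          + ((G * (V * prepareOp a S μ i)) (gibbsState S a 0) - y)‖ := by congr 1; abel
      _ ≤ _ + _ := norm_add_le _ _
      _ ≤ (i * ((3 ^ μ - 1) * ε) + 0 + k * ε) + i * Real.sqrt (2 * (1 / 2) ^ 3 ^ μ) := by
          rw [h2, LinearIsometryEquiv.norm_map, LinearIsometryEquiv.norm_map]
          exact add_le_add h1 hprep
      _ = _ := by ring
  have hp : (∑ b, if isMarked b then outcomeProb S (sampleCircuit a n μ hi k) b else 0)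
      = ‖markedPart x‖ ^ 2 := by
    rw [norm_markedPart_sq]
    refine Finset.sum_congr rfl fun b _ => ?_
    rw [outcomeProb, runCircuit_eq hS]
  have hq : (1 + Real.cos ((2 * k + 1) * angle S i)) / 2 = ‖markedPart y‖ ^ 2 := by
    rw [hy, map_smul, norm_smul, hc, one_mul, norm_markedPart_grover_sq hi k]
  rw [hp, hq]
  exact (abs_norm_markedPart_sq_sub_le hxn hyn).trans
    (mul_le_mul_of_nonneg_left hdist (by norm_num))

end MarkedProbability

/-! ### Counting walks and gates -/

section GateCounts

variable {ℓ m a : ℕ}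

/-- The number of controlled walk operators in a circuit. -/
def walks (c : List (Gate ℓ m)) : ℕ := c.countP Gate.isWalk

theorem walks_nil : walks ([] : List (Gate ℓ m)) = 0 := rfl

theorem walks_append (c d : List (Gate ℓ m)) : walks (c ++ d) = walks c + walks d :=
  List.countP_append

theorem walks_cons_ctrlGate (ctrl : Finset (Fin m)) (t : Fin m) (v : Matrix.unitaryGroup Bool ℂ)
    (c : List (Gate ℓ m)) : walks (ctrlGate ctrl t v :: c) = walks c := by
  rw [walks, List.countP_cons_of_neg (by rw [isWalk_ctrlGate]; simp), walks]

theorem walks_reflectZero (c : Fin m) : walks [(.reflectZero c : Gate ℓ m)] = 0 := rfl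

theorem walks_rotate {i : ℕ} (hi : i < ℓ) (t : Fin m) : walks [Gate.rotate i hi t] = 0 := rfl

theorem walks_ctrlWalk_le (t n : ℕ) (c : Fin m) : walks (ctrlWalk (ℓ := ℓ) t n c) ≤ n := by
  rw [ctrlWalk]
  split_ifs
  · exact List.countP_le_length.trans (by simp)
  · simp [walks, Gate.isWalk]

theorem length_ctrlWalk_le (t n : ℕ) (c : Fin m) : (ctrlWalk (ℓ := ℓ) t n c).length ≤ n + 1 := by
  rw [ctrlWalk]
  split_ifs <;> simp

theorem walks_phaseBit_le (t n : ℕ) (c : Fin m) : walks (phaseBit (ℓ := ℓ) t n c) ≤ n := by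
  simpa only [phaseBit, walks_append, walks_cons_ctrlGate, walks_nil, zero_add, add_zero]
    using walks_ctrlWalk_le t n c

theorem walks_phaseBitInv_le (t n : ℕ) (c : Fin m) : walks (phaseBitInv (ℓ := ℓ) t n c) ≤ n := by
  simpa only [phaseBitInv, ctrlWalkInv, walks_append, walks_cons_ctrlGate, walks_nil, zero_add,
    add_zero, walks_reflectZero] using walks_ctrlWalk_le t n c

theorem length_phaseBit_le (t n : ℕ) (c : Fin m) : (phaseBit (ℓ := ℓ) t n c).length ≤ n + 5 := by
  have := length_ctrlWalk_le (ℓ := ℓ) t n c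
  simp [phaseBit]; omega

theorem length_phaseBitInv_le (t n : ℕ) (c : Fin m) :
    (phaseBitInv (ℓ := ℓ) t n c).length ≤ n + 5 := by
  have := length_ctrlWalk_le (ℓ := ℓ) t n c
  simp [phaseBitInv, ctrlWalkInv]; omega

theorem sum_two_pow_mod_le (n r : ℕ) : ∑ k ∈ Finset.range (n * r), 2 ^ (k % n) ≤ r * 2 ^ n := by
  induction r with
  | zero => simp
  | succ r ih =>
    rw [mul_add, mul_one, Finset.sum_range_add]
    have h : ∑ x ∈ Finset.range n, 2 ^ ((n * r + x) % n) ≤ 2 ^ n := by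
      have h1 : ∑ x ∈ Finset.range n, 2 ^ ((n * r + x) % n) = ∑ x ∈ Finset.range n, 2 ^ x := by
        refine Finset.sum_congr rfl fun x hx => ?_
        rw [Nat.mul_add_mod, Nat.mod_eq_of_lt (Finset.mem_range.1 hx)]
      rw [h1, Nat.geomSum_eq le_rfl]
      simp
    calc _ ≤ r * 2 ^ n + 2 ^ n := add_le_add ih h
      _ = _ := by ring

theorem walks_phaseEst_le (n t j : ℕ) :
    walks (phaseEst ℓ a n t j) ≤ ∑ k ∈ Finset.range j, 2 ^ (k % n) := by
  induction j with
  | zero => simp [phaseEst, walks_nil]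
  | succ j ih =>
    rw [phaseEst, walks_append, Finset.sum_range_succ]
    exact add_le_add ih (walks_phaseBit_le _ _ _)

theorem walks_phaseEstInv_le (n t j : ℕ) :
    walks (phaseEstInv ℓ a n t j) ≤ ∑ k ∈ Finset.range j, 2 ^ (k % n) := by
  induction j with
  | zero => simp [phaseEstInv, walks_nil]
  | succ j ih =>
    rw [phaseEstInv, walks_append, Finset.sum_range_succ, add_comm]
    exact add_le_add ih (walks_phaseBitInv_le _ _ _)

theorem length_phaseEst_le (n t j : ℕ) :
    (phaseEst ℓ a n t j).length ≤ ∑ k ∈ Finset.range j, 2 ^ (k % n) + 5 * j := by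
  induction j with
  | zero => simp [phaseEst]
  | succ j ih =>
    rw [phaseEst, List.length_append, Finset.sum_range_succ]
    have := length_phaseBit_le (ℓ := ℓ) t (2 ^ (j % n)) (phaseWire a j)
    omega

theorem length_phaseEstInv_le (n t j : ℕ) :
    (phaseEstInv ℓ a n t j).length ≤ ∑ k ∈ Finset.range j, 2 ^ (k % n) + 5 * j := by
  induction j with
  | zero => simp [phaseEstInv]
  | succ j ih =>
    rw [phaseEstInv, List.length_append, Finset.sum_range_succ]
    have := length_phaseBitInv_le (ℓ := ℓ) t (2 ^ (j % n)) (phaseWire a j)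
    omega

theorem walks_ladder (j : ℕ) : walks (ladder ℓ a j) = 0 := by
  induction j with
  | zero => simp only [ladder, walks_cons_ctrlGate, walks_nil]
  | succ j ih => simp only [ladder, walks_append, walks_cons_ctrlGate, walks_nil, ih, add_zero]

theorem walks_ladderInv (j : ℕ) : walks (ladderInv ℓ a j) = 0 := by
  induction j with
  | zero => simp only [ladderInv, walks_cons_ctrlGate, walks_nil]
  | succ j ih => simp only [ladderInv, walks_append, walks_cons_ctrlGate, walks_nil, ih, add_zero]

theorem length_ladder (j : ℕ) : (ladder ℓ a j).length = 2 * j + 1 := by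
  induction j with
  | zero => simp [ladder]
  | succ j ih => rw [ladder, List.length_append, ih]; simp; omega

theorem length_ladderInv (j : ℕ) : (ladderInv ℓ a j).length = 2 * j + 1 := by
  induction j with
  | zero => simp [ladderInv]
  | succ j ih => rw [ladderInv, List.length_append, ih]; simp; omega

theorem walks_reflector_le {n s : ℕ} (ha : a = n * (2 * s)) (t : ℕ) (ω : Circle) :
    walks (reflector ℓ a n t ω) ≤ 4 * s * 2 ^ n := by
  have h1 := walks_phaseEst_le (ℓ := ℓ) (a := a) n t a
  have h2 := walks_phaseEstInv_le (ℓ := ℓ) (a := a) n t a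
  have h3 := walks_ladder (ℓ := ℓ) (a := a) a
  have h4 := walks_ladderInv (ℓ := ℓ) (a := a) a
  have h5 := sum_two_pow_mod_le n (2 * s)
  rw [← ha] at h5
  simp only [reflector, walks_append, walks_cons_ctrlGate, walks_nil]
  nlinarith

theorem length_reflector_le {n s : ℕ} (ha : a = n * (2 * s)) (t : ℕ) (ω : Circle) :
    (reflector ℓ a n t ω).length ≤ 4 * s * 2 ^ n + 14 * a + 3 := by
  have h1 := length_phaseEst_le (ℓ := ℓ) (a := a) n t a
  have h2 := length_phaseEstInv_le (ℓ := ℓ) (a := a) n t a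
  have h5 := sum_two_pow_mod_le n (2 * s)
  rw [← ha] at h5
  simp only [reflector, List.length_append, length_ladder, length_ladderInv, List.length_singleton]
  nlinarith

/-- Adding `R` on the left expresses the count `3^k - 1` without subtraction. The additive measure
`f` is arbitrary so that walk counts and circuit lengths share one proof. -/
theorem searchCircuits_le {f : List (Gate ℓ (2 * a + 3)) → ℕ} (f_nil : f [] = 0)
    (f_append : ∀ c d, f (c ++ d) = f c + f d)
    {n t R : ℕ} (hR : ∀ t ω, f (reflector ℓ a n t ω) ≤ R) (ω : Circle)
    (k : ℕ) : f (searchCircuits ℓ a n t ω k).1 + R ≤ 3 ^ k * R ∧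
      f (searchCircuits ℓ a n t ω k).2 + R ≤ 3 ^ k * R := by
  induction k with
  | zero => simp [searchCircuits, f_nil]
  | succ k ih =>
    obtain ⟨h1, h2⟩ := ih
    simp only [searchCircuits, f_append, pow_succ]
    have h3 := hR (t + 1) ω
    have h4 := hR t ω
    have h5 := hR (t + 1) ω⁻¹
    have h6 := hR t ω⁻¹
    constructor <;> nlinarith

theorem prepare_le {f : List (Gate ℓ (2 * a + 3)) → ℕ} (f_nil : f [] = 0)
    (f_append : ∀ c d, f (c ++ d) = f c + f d)
    {n R : ℕ} (hR : ∀ t ω, f (reflector ℓ a n t ω) ≤ R) (μ t : ℕ) :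
    f (prepare ℓ a n μ t) ≤ t * 3 ^ μ * R := by
  induction t with
  | zero => simp [prepare, f_nil]
  | succ t ih =>
    rw [prepare, f_append]
    have := (searchCircuits_le f_nil f_append hR (t := t) sixthRoot μ).1
    nlinarith

theorem groverSteps_le {f : List (Gate ℓ (2 * a + 3)) → ℕ} (f_nil : f [] = 0)
    (f_append : ∀ c d, f (c ++ d) = f c + f d)
    {n R i : ℕ} (hi : i < ℓ) (hR : f (groverStep a n hi) ≤ R) (k : ℕ) :
    f (groverSteps a n hi k) ≤ k * R := by
  induction k with
  | zero => simp [groverSteps, f_nil]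
  | succ k ih => rw [groverSteps, f_append]; nlinarith

theorem walks_sampleCircuit_le {n s : ℕ} (ha : a = n * (2 * s)) (μ : ℕ) {i : ℕ} (hi : i < ℓ)
    (k : ℕ) : walks (sampleCircuit a n μ hi k) ≤ (i * 3 ^ μ + k) * (4 * s * 2 ^ n) := by
  have h1 := prepare_le (ℓ := ℓ) (a := a) (f := walks) walks_nil walks_append (fun t ω => walks_reflector_le ha t ω) μ i
  have hstep : walks (groverStep a n hi) ≤ 4 * s * 2 ^ n := by
    have := walks_reflector_le (ℓ := ℓ) ha i negOne
    simpa only [groverStep, mark, markInv, walks_append, walks_cons_ctrlGate, walks_nil, zero_add,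
      add_zero, walks_rotate] using this
  have h2 := groverSteps_le (ℓ := ℓ) (a := a) (f := walks) walks_nil walks_append hi hstep k
  simp only [sampleCircuit, mark, walks_append, walks_cons_ctrlGate, walks_nil, walks_rotate]
  nlinarith

theorem length_sampleCircuit_le {n s : ℕ} (ha : a = n * (2 * s)) (μ : ℕ) {i : ℕ} (hi : i < ℓ)
    (k : ℕ) : (sampleCircuit a n μ hi k).length
      ≤ (i * 3 ^ μ + k + 1) * (4 * s * 2 ^ n + 14 * a + 10) := by
  have h1 := prepare_le (ℓ := ℓ) (a := a) (f := List.length) rfl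
    (fun c d => List.length_append) (fun t ω => length_reflector_le ha t ω) μ i
  have hstep : (groverStep a n hi).length ≤ 4 * s * 2 ^ n + 14 * a + 10 := by
    have := length_reflector_le (ℓ := ℓ) ha i negOne
    simp [groverStep, mark, markInv]
    omega
  have h2 := groverSteps_le (ℓ := ℓ) (a := a) (f := List.length) rfl
    (fun c d => List.length_append) hi hstep k
  have h3 : (prepare ℓ a n μ i).length ≤ i * 3 ^ μ * (4 * s * 2 ^ n + 14 * a + 10) :=
    h1.trans (Nat.mul_le_mul_left _ (by omega))
  simp only [sampleCircuit, List.length_append, mark, List.length_singleton]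
  have h4 : (i * 3 ^ μ + k + 1) * (4 * s * 2 ^ n + 14 * a + 10)
      = i * 3 ^ μ * (4 * s * 2 ^ n + 14 * a + 10) + k * (4 * s * 2 ^ n + 14 * a + 10)
        + (4 * s * 2 ^ n + 14 * a + 10) := by ring
  rw [h4]
  have h5 : 4 ≤ 4 * s * 2 ^ n + 14 * a + 10 := by omega
  linarith

end GateCounts

/-! ### Recovering an angle from cosines of its multiples -/

section AngleRecovery

/-- The interval lies within distance `1` of `3π/2`, where `|sin|` is `1`. It is the range of `x +
y` for two angles in `[2, 5/2]`; the tilted qubit puts the angles there. -/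
theorem half_le_abs_sin {x : ℝ} (h4 : 4 ≤ x) (h5 : x ≤ 5) : 1 / 2 ≤ |Real.sin x| := by
  have hpi := Real.pi_gt_d2
  have hpi' := Real.pi_lt_d2
  have h1 : Real.sin x = -Real.cos (x - 3 * Real.pi / 2) := by
    have : x - 3 * Real.pi / 2 = x - Real.pi - Real.pi / 2 := by ring
    rw [this, Real.cos_sub_pi_div_two, Real.sin_sub_pi, neg_neg]
  have h2 := Real.one_sub_sq_div_two_le_cos (x := x - 3 * Real.pi / 2)
  have h3 : (x - 3 * Real.pi / 2) ^ 2 ≤ 1 := by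
    rw [sq_le_one_iff_abs_le_one, abs_le]; constructor <;> linarith
  rw [h1, abs_neg]
  exact le_trans (by linarith) (le_abs_self _)

theorem abs_le_of_abs_sin_le {x c : ℝ} (hx : |x| ≤ Real.pi / 2) (hc : |Real.sin x| ≤ c) :
    |x| ≤ Real.pi / 2 * c := by
  have h1 := Real.mul_le_sin (abs_nonneg x) hx
  have h2 : Real.sin |x| ≤ |Real.sin x| := by
    rcases abs_cases x with ⟨h, -⟩ | ⟨h, -⟩
    · rw [h]; exact le_abs_self _
    · rw [h, Real.sin_neg]; exact neg_le_abs _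
  have h3 : 2 / Real.pi * |x| ≤ c := h1.trans (h2.trans hc)
  have hpi := Real.pi_pos
  calc |x| = Real.pi / 2 * (2 / Real.pi * |x|) := by field_simp
    _ ≤ _ := by gcongr

theorem abs_sin_mul_abs_sin (u x y : ℝ) :
    |Real.cos (u * x) - Real.cos (u * y)|
      = 2 * |Real.sin (u * ((x + y) / 2))| * |Real.sin (u * ((x - y) / 2))| := by
  rw [Real.cos_sub_cos, abs_mul, abs_mul]
  have h1 : (u * x + u * y) / 2 = u * ((x + y) / 2) := by ring
  have h2 : (u * x - u * y) / 2 = u * ((x - y) / 2) := by ring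
  rw [h1, h2]
  norm_num

/-- Cosines of the odd multiples `2 N ± 1` of an angle in `[2, 5 / 2]` determine the angle up to
`O (1 / N)`, once it is known up to a larger multiple of `1 / N`. -/
theorem mul_abs_sub_le_of_cos {x y N : ℝ} (hN : 1 ≤ N) (hx : x ∈ Set.Icc (2 : ℝ) (5 / 2))
    (hy : y ∈ Set.Icc (2 : ℝ) (5 / 2)) (hd : (2 * N + 1) * (|x - y| / 2) ≤ Real.pi / 2)
    (hp : |Real.cos ((2 * N + 1) * x) - Real.cos ((2 * N + 1) * y)| ≤ 1 / 10)
    (hm : |Real.cos ((2 * N - 1) * x) - Real.cos ((2 * N - 1) * y)| ≤ 1 / 10) :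
    N * |x - y| ≤ Real.pi / 5 := by
  obtain ⟨hx1, hx2⟩ := hx
  obtain ⟨hy1, hy2⟩ := hy
  set σ := (x + y) / 2 with hσ
  rw [abs_sin_mul_abs_sin, ← hσ] at hp hm
  -- A cosine difference says nothing about `x - y` when its cofactor `sin (uσ)` is small. The two
  -- multiples of `σ` differ by `2σ`, whose sine is at least `1/2` in modulus, so the cofactors are
  -- not both below `1/4`.
  have hsin : 1 / 2 ≤ |Real.sin ((2 * N + 1) * σ)| + |Real.sin ((2 * N - 1) * σ)| := by
    have h1 := half_le_abs_sin (x := 2 * σ) (by linarith) (by linarith)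
    have h2 : 2 * σ = (2 * N + 1) * σ - (2 * N - 1) * σ := by ring
    rw [h2, Real.sin_sub] at h1
    refine h1.trans ((abs_sub _ _).trans (add_le_add ?_ ?_))
    · rw [abs_mul]; exact mul_le_of_le_one_right (abs_nonneg _) (Real.abs_cos_le_one _)
    · rw [abs_mul]; exact mul_le_of_le_one_left (abs_nonneg _) (Real.abs_cos_le_one _)
  have key : ∀ u : ℝ, N ≤ u → u ≤ 2 * N + 1 → 1 / 4 ≤ |Real.sin (u * σ)| →
      2 * |Real.sin (u * σ)| * |Real.sin (u * ((x - y) / 2))| ≤ 1 / 10 →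
      N * |x - y| ≤ Real.pi / 5 := by
    intro u hu1 hu2 hs hle
    have hu0 : 0 ≤ u := by linarith
    have habs : |u * ((x - y) / 2)| = u * (|x - y| / 2) := by
      rw [abs_mul, abs_div, abs_of_nonneg hu0]; norm_num
    have h1 : |Real.sin (u * ((x - y) / 2))| ≤ 1 / 5 := by
      nlinarith [abs_nonneg (Real.sin (u * ((x - y) / 2)))]
    have h2 : |u * ((x - y) / 2)| ≤ Real.pi / 2 := by
      rw [habs]
      exact (mul_le_mul_of_nonneg_right hu2 (by positivity)).trans hd
    have h3 := abs_le_of_abs_sin_le h2 h1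
    rw [habs] at h3
    have h4 : N * (|x - y| / 2) ≤ u * (|x - y| / 2) :=
      mul_le_mul_of_nonneg_right hu1 (by positivity)
    linarith
  rcases le_total (1 / 4) |Real.sin ((2 * N + 1) * σ)| with h | h
  · exact key _ (by linarith) le_rfl h hp
  · exact key _ (by linarith) (by linarith) (by linarith) hm

/-- The precision doubles with every `j`: the bound at level `j` excludes aliasing of the multiples
at level `j + 1`. -/
theorem two_pow_mul_abs_sub_le {x y : ℝ} (hx : x ∈ Set.Icc (2 : ℝ) (5 / 2))
    (hy : y ∈ Set.Icc (2 : ℝ) (5 / 2)) {J : ℕ}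
    (hp : ∀ j ≤ J, |Real.cos ((2 * 2 ^ j + 1) * x) - Real.cos ((2 * 2 ^ j + 1) * y)| ≤ 1 / 10)
    (hm : ∀ j ≤ J, |Real.cos ((2 * 2 ^ j - 1) * x) - Real.cos ((2 * 2 ^ j - 1) * y)| ≤ 1 / 10) :
    2 ^ J * |x - y| ≤ 1 := by
  have hpi := Real.pi_gt_d2
  have hpi' := Real.pi_lt_d2
  have hall : ∀ j ≤ J, (2 : ℝ) ^ j * |x - y| ≤ Real.pi / 5 := by
    intro j
    induction j with
    | zero =>
      intro hj
      refine mul_abs_sub_le_of_cos (by simp) hx hy ?_ (hp 0 hj) (hm 0 hj)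
      have : |x - y| ≤ 1 / 2 := by
        rw [abs_le]; constructor <;> linarith [hx.1, hx.2, hy.1, hy.2]
      norm_num
      linarith
    | succ j ih =>
      intro hj
      refine mul_abs_sub_le_of_cos (one_le_pow₀ (by norm_num)) hx hy ?_ (hp _ hj) (hm _ hj)
      have h1 := ih (by omega)
      have h2 : (1 : ℝ) ≤ 2 ^ j := one_le_pow₀ (by norm_num)
      rw [pow_succ]
      -- The previous level gives `2 · 2^j |x - y| ≤ 2π/5` and `|x - y| / 2 ≤ π/10`. The sum is
      -- exactly `π/2`, so the constant `π/5` reproduces itself.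
      nlinarith [abs_nonneg (x - y)]
  have := hall J le_rfl
  linarith

theorem arccos_mem_Icc {α : ℝ} (h1 : 1 / 2 ≤ α) (h2 : α ≤ 1) :
    Real.arccos (α / 2 - 1) ∈ Set.Icc (2 : ℝ) (5 / 2) := by
  have hpi := Real.pi_gt_d2
  have hpi' := Real.pi_lt_d2
  constructor
  · refine (Real.arccos_cos (x := 2) (by norm_num) (by linarith)).symm.le.trans
      (Real.arccos_le_arccos ?_)
    have : Real.cos (2 * Real.pi / 3) = -(1 / 2) := by
      have h3 : 2 * Real.pi / 3 = Real.pi - Real.pi / 3 := by ring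
      rw [h3, Real.cos_pi_sub, Real.cos_pi_div_three]
    have h4 : Real.cos (2 * Real.pi / 3) ≤ Real.cos 2 :=
      Real.cos_le_cos_of_nonneg_of_le_pi (by norm_num) (by linarith) (by linarith)
    linarith
  · refine (Real.arccos_le_arccos ?_).trans
      (Real.arccos_cos (x := 5 / 2) (by norm_num) (by linarith)).le
    have h3 := Real.one_sub_sq_div_two_le_cos (x := Real.pi - 5 / 2)
    rw [Real.cos_pi_sub] at h3
    nlinarith

end AngleRecovery

/-! ### Chernoff and union bounds for independent runs -/

section Concentration

variable {ι β : Type*} [Fintype ι] [DecidableEq ι] [Fintype β]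

/-- The indicator of a boolean. -/
def ind (x : Bool) : ℝ := if x then 1 else 0

theorem ind_nonneg (x : Bool) : 0 ≤ ind x := by cases x <;> simp [ind]

theorem ind_le_one (x : Bool) : ind x ≤ 1 := by cases x <;> simp [ind]

/-- On `[-1, 1]` one has `exp x ≤ 1 + x + x²`, and the linear term has mean zero. -/
theorem sum_exp_le {w : β → ℝ} (hw : ∀ b, 0 ≤ w b) (hw1 : ∑ b, w b = 1) (X : β → Bool) {t : ℝ}
    (ht : |t| ≤ 1) :
    ∑ b, w b * Real.exp (t * (ind (X b) - ∑ b, w b * ind (X b))) ≤ Real.exp (t ^ 2) := by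
  set p := ∑ b, w b * ind (X b) with hp
  have hp0 : 0 ≤ p := Finset.sum_nonneg fun b _ => mul_nonneg (hw b) (ind_nonneg _)
  have hp1 : p ≤ 1 := by
    rw [← hw1, hp]
    exact Finset.sum_le_sum fun b _ => mul_le_of_le_one_right (hw b) (ind_le_one _)
  have hx : ∀ b, |ind (X b) - p| ≤ 1 := by
    intro b
    rw [abs_le]
    constructor <;> linarith [ind_nonneg (X b), ind_le_one (X b)]
  have hexp : ∀ b, Real.exp (t * (ind (X b) - p)) ≤ 1 + t * (ind (X b) - p) + t ^ 2 := by
    intro b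
    have h1 : |t * (ind (X b) - p)| ≤ 1 := by
      rw [abs_mul]; exact mul_le_one₀ ht (abs_nonneg _) (hx b)
    have h2 := Real.abs_exp_sub_one_sub_id_le h1
    have h3 : (t * (ind (X b) - p)) ^ 2 ≤ t ^ 2 := by
      rw [mul_pow]
      exact mul_le_of_le_one_right (sq_nonneg _) (by rw [sq_le_one_iff_abs_le_one]; exact hx b)
    linarith [le_abs_self (Real.exp (t * (ind (X b) - p)) - 1 - t * (ind (X b) - p))]
  calc ∑ b, w b * Real.exp (t * (ind (X b) - p))
      ≤ ∑ b, w b * (1 + t * (ind (X b) - p) + t ^ 2) :=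
        Finset.sum_le_sum fun b _ => mul_le_mul_of_nonneg_left (hexp b) (hw b)
    _ = ∑ b, ((1 - t * p + t ^ 2) * w b + t * (w b * ind (X b))) :=
        Finset.sum_congr rfl fun b _ => by ring
    _ = 1 + t ^ 2 := by
        rw [Finset.sum_add_distrib, ← Finset.mul_sum, ← Finset.mul_sum, hw1, ← hp]; ring
    _ ≤ Real.exp (t ^ 2) := by linarith [Real.add_one_le_exp (t ^ 2)]

theorem sum_prod_exp_le {w : ι → β → ℝ} (hw : ∀ r b, 0 ≤ w r b) (hw1 : ∀ r, ∑ b, w r b = 1)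
    (X : β → Bool) (T : Finset ι) {p : ℝ} (hp : ∀ r ∈ T, ∑ b, w r b * ind (X b) = p) {t : ℝ}
    (ht : |t| ≤ 1) :
    ∑ ω : ι → β, (∏ r, w r (ω r)) * Real.exp (t * ∑ r ∈ T, (ind (X (ω r)) - p))
      ≤ Real.exp (t ^ 2) ^ T.card := by
  have h1 : ∀ ω : ι → β, (∏ r, w r (ω r)) * Real.exp (t * ∑ r ∈ T, (ind (X (ω r)) - p))
      = ∏ r, w r (ω r) * (if r ∈ T then Real.exp (t * (ind (X (ω r)) - p)) else 1) := by
    intro ω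
    rw [Finset.prod_mul_distrib, Finset.mul_sum, Real.exp_sum, Finset.prod_ite_mem]
    simp
  simp_rw [h1]
  have h2 := Finset.prod_univ_sum (fun _ : ι => (Finset.univ : Finset β))
    (fun r b => w r b * (if r ∈ T then Real.exp (t * (ind (X b) - p)) else 1))
  rw [Fintype.piFinset_univ] at h2
  rw [← h2]
  have h3 : Real.exp (t ^ 2) ^ T.card = ∏ r, if r ∈ T then Real.exp (t ^ 2) else 1 := by
    rw [Finset.prod_ite_mem]; simp
  rw [h3]
  refine Finset.prod_le_prod (fun r _ => Finset.sum_nonneg fun b _ => mul_nonneg (hw r b) ?_)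
    fun r _ => ?_
  · split_ifs <;> positivity
  · split_ifs with hr
    · rw [← hp r hr]
      exact sum_exp_le (hw r) (hw1 r) X ht
    · simp [hw1]

open scoped Classical in
/-- A Chernoff bound for independent samples. -/
theorem sum_prod_deviation_le {w : ι → β → ℝ} (hw : ∀ r b, 0 ≤ w r b)
    (hw1 : ∀ r, ∑ b, w r b = 1) (X : β → Bool) (T : Finset ι) {p : ℝ}
    (hp : ∀ r ∈ T, ∑ b, w r b * ind (X b) = p) {η : ℝ} (hη : 0 ≤ η) (hη1 : η ≤ 1) :
    ∑ ω : ι → β, (if T.card * η < |∑ r ∈ T, (ind (X (ω r)) - p)| then ∏ r, w r (ω r) else 0)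
      ≤ 2 * Real.exp (-(T.card * η ^ 2 / 4)) := by
  have hN : (0 : ℝ) ≤ T.card := by positivity
  have hnn : ∀ ω : ι → β, 0 ≤ ∏ r, w r (ω r) := fun ω => Finset.prod_nonneg fun r _ => hw r _
  set c := Real.exp (-(T.card * η ^ 2 / 2)) with hc
  have hpt : ∀ ω : ι → β,
      (if T.card * η < |∑ r ∈ T, (ind (X (ω r)) - p)| then ∏ r, w r (ω r) else 0)
        ≤ c * ((∏ r, w r (ω r)) * Real.exp (η / 2 * ∑ r ∈ T, (ind (X (ω r)) - p)))
          + c * ((∏ r, w r (ω r)) * Real.exp (-(η / 2) * ∑ r ∈ T, (ind (X (ω r)) - p))) := by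
    intro ω
    set Y := ∑ r ∈ T, (ind (X (ω r)) - p)
    have e1 := mul_nonneg (Real.exp_pos (-(T.card * η ^ 2 / 2))).le
      (mul_nonneg (hnn ω) (Real.exp_pos (η / 2 * Y)).le)
    have e2 := mul_nonneg (Real.exp_pos (-(T.card * η ^ 2 / 2))).le
      (mul_nonneg (hnn ω) (Real.exp_pos (-(η / 2) * Y)).le)
    have hone : ∀ Y' : ℝ, T.card * η ≤ Y' →
        ∏ r, w r (ω r) ≤ c * ((∏ r, w r (ω r)) * Real.exp (η / 2 * Y')) := by
      intro Y' hY'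
      have h1 : 1 ≤ c * Real.exp (η / 2 * Y') := by
        rw [hc, ← Real.exp_add]
        refine Real.one_le_exp ?_
        nlinarith
      calc ∏ r, w r (ω r) = (∏ r, w r (ω r)) * 1 := (mul_one _).symm
        _ ≤ (∏ r, w r (ω r)) * (c * Real.exp (η / 2 * Y')) :=
            mul_le_mul_of_nonneg_left h1 (hnn ω)
        _ = _ := by ring
    split_ifs with h
    · rcases lt_abs.1 h with h' | h'
      · linarith [hone Y h'.le]
      · have := hone (-Y) h'.le
        rw [show η / 2 * -Y = -(η / 2) * Y by ring] at this
        linarith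
    · linarith
  refine (Finset.sum_le_sum fun ω _ => hpt ω).trans ?_
  rw [Finset.sum_add_distrib, ← Finset.mul_sum, ← Finset.mul_sum]
  -- The value `t = η / 2` minimizes `t² - tη`, leaving `-η² / 4` in the exponent for each sample.
  have b1 := sum_prod_exp_le hw hw1 X T hp (t := η / 2)
    (by rw [abs_of_nonneg (by linarith)]; linarith)
  have b2 := sum_prod_exp_le hw hw1 X T hp (t := -(η / 2))
    (by rw [abs_neg, abs_of_nonneg (by linarith)]; linarith)
  rw [neg_sq] at b2
  have b3 : c * Real.exp ((η / 2) ^ 2) ^ T.card = Real.exp (-(T.card * η ^ 2 / 4)) := by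
    rw [hc, ← Real.exp_nat_mul, ← Real.exp_add]; congr 1; ring
  have hc0 : 0 ≤ c := (Real.exp_pos _).le
  calc _ ≤ c * Real.exp ((η / 2) ^ 2) ^ T.card + c * Real.exp ((η / 2) ^ 2) ^ T.card :=
        add_le_add (mul_le_mul_of_nonneg_left b1 hc0) (mul_le_mul_of_nonneg_left b2 hc0)
    _ = _ := by rw [b3]; ring

theorem sum_prod_eq_one {w : ι → β → ℝ} (hw1 : ∀ r, ∑ b, w r b = 1) :
    ∑ ω : ι → β, ∏ r, w r (ω r) = 1 := by
  have h2 := Finset.prod_univ_sum (fun _ : ι => (Finset.univ : Finset β)) w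
  rw [Fintype.piFinset_univ] at h2
  rw [← h2]
  simp [hw1]

open scoped Classical in
/-- A union bound over finitely many averages of independent samples. -/
theorem one_sub_le_sum_prod {τ : Type*} [Fintype τ] {w : ι → β → ℝ} (hw : ∀ r b, 0 ≤ w r b)
    (hw1 : ∀ r, ∑ b, w r b = 1) (X : β → Bool) (T : τ → Finset ι) {N : ℕ}
    (hT : ∀ x, (T x).card = N) {p : τ → ℝ} (hp : ∀ x, ∀ r ∈ T x, ∑ b, w r b * ind (X b) = p x)
    {η : ℝ} (hη : 0 ≤ η) (hη1 : η ≤ 1) (good : (ι → β) → Prop)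
    (hgood : ∀ ω, (∀ x, |∑ r ∈ T x, (ind (X (ω r)) - p x)| ≤ N * η) → good ω) :
    1 - Fintype.card τ * (2 * Real.exp (-(N * η ^ 2 / 4)))
      ≤ ∑ ω : ι → β, if good ω then ∏ r, w r (ω r) else 0 := by
  have hnn : ∀ ω : ι → β, 0 ≤ ∏ r, w r (ω r) := fun ω => Finset.prod_nonneg fun r _ => hw r _
  have hbad : ∀ x, ∑ ω : ι → β,
      (if N * η < |∑ r ∈ T x, (ind (X (ω r)) - p x)| then ∏ r, w r (ω r) else 0)
        ≤ 2 * Real.exp (-(N * η ^ 2 / 4)) := by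
    intro x
    have := sum_prod_deviation_le hw hw1 X (T x) (hp x) hη hη1
    rwa [hT] at this
  have hpt : ∀ ω : ι → β, ∏ r, w r (ω r) ≤ (if good ω then ∏ r, w r (ω r) else 0)
      + ∑ x, if N * η < |∑ r ∈ T x, (ind (X (ω r)) - p x)| then ∏ r, w r (ω r) else 0 := by
    intro ω
    have hs0 : ∀ x, 0 ≤ if N * η < |∑ r ∈ T x, (ind (X (ω r)) - p x)|
        then ∏ r, w r (ω r) else 0 := by
      intro x; split_ifs
      · exact hnn ω
      · exact le_rfl
    by_cases h : good ω
    · rw [if_pos h]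
      linarith [Finset.sum_nonneg fun x (_ : x ∈ (Finset.univ : Finset τ)) => hs0 x]
    · have : ∃ x, N * η < |∑ r ∈ T x, (ind (X (ω r)) - p x)| := by
        by_contra hcon
        push Not at hcon
        exact h (hgood ω hcon)
      obtain ⟨x, hx⟩ := this
      have := Finset.single_le_sum (fun x _ => hs0 x) (Finset.mem_univ x)
      rw [if_pos hx] at this
      rw [if_neg h, zero_add]
      exact this
  have hsum := Finset.sum_le_sum fun ω (_ : ω ∈ (Finset.univ : Finset (ι → β))) => hpt ω
  rw [sum_prod_eq_one hw1, Finset.sum_add_distrib, Finset.sum_comm] at hsum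
  have h2 := Finset.sum_le_sum fun x (_ : x ∈ (Finset.univ : Finset τ)) => hbad x
  rw [Finset.sum_const, Finset.card_univ, nsmul_eq_mul] at h2
  linarith

end Concentration

/-! ### Arithmetic expressions for lists -/

namespace Expr

variable {ι : Type}

/-- The sum of a list of expressions. -/
def sumList : List (Expr ι) → Expr ι
  | [] => const 0
  | e :: l => add e (sumList l)

/-- The product of a list of expressions. -/
def prodList : List (Expr ι) → Expr ι
  | [] => const 1
  | e :: l => mul e (prodList l)

/-- Whether all inequalities of a list hold, as a number. -/
def allLe : List (Expr ι × Expr ι) → Expr ι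
  | [] => const 1
  | p :: l => mul (ifLe p.1 p.2 (const 1) (const 0)) (allLe l)

/-- The value paired with the first condition that is at least `1`. -/
def firstOf : List (Expr ι × Expr ι) → Expr ι
  | [] => const 0
  | p :: l => ifLe (const 1) p.1 p.2 (firstOf l)

variable (ω : ι → Bool)

theorem eval_sumList (l : List (Expr ι)) : (sumList l).eval ω = (l.map (eval ω)).sum := by
  induction l with
  | nil => simp [sumList, eval]
  | cons e l ih => simp [sumList, eval, ih]

theorem eval_prodList (l : List (Expr ι)) : (prodList l).eval ω = (l.map (eval ω)).prod := by
  induction l with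
  | nil => simp [prodList, eval]
  | cons e l ih => simp [prodList, eval, ih]

theorem one_le_eval_allLe (l : List (Expr ι × Expr ι)) :
    1 ≤ (allLe l).eval ω ↔ ∀ p ∈ l, p.1.eval ω ≤ p.2.eval ω := by
  have h : (allLe l).eval ω = if ∀ p ∈ l, p.1.eval ω ≤ p.2.eval ω then 1 else 0 := by
    induction l with
    | nil => simp [allLe, eval]
    | cons p l ih =>
      simp only [allLe, eval, ih, List.forall_mem_cons]
      by_cases h1 : p.1.eval ω ≤ p.2.eval ω
      · simp only [h1, true_and, if_true, Rat.cast_one, one_mul]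
      · simp only [h1, false_and, if_false, Rat.cast_zero, zero_mul]
  rw [h]
  split_ifs with h'
  · simp only [le_refl, true_iff]; exact h'
  · simp only [h', iff_false, not_le]; norm_num

theorem exists_eval_firstOf {l : List (Expr ι × Expr ι)} (h : ∃ p ∈ l, 1 ≤ p.1.eval ω) :
    ∃ p ∈ l, 1 ≤ p.1.eval ω ∧ (firstOf l).eval ω = p.2.eval ω := by
  induction l with
  | nil => obtain ⟨p, hp, -⟩ := h; cases hp
  | cons q l ih =>
    by_cases hq : 1 ≤ q.1.eval ω
    · exact ⟨q, by simp, hq, by simp [firstOf, eval, hq]⟩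
    · obtain ⟨p, hp, hp1⟩ := h
      have hpl : p ∈ l := by
        rcases List.mem_cons.1 hp with rfl | hp
        · exact absurd hp1 hq
        · exact hp
      obtain ⟨p', hp', h1, h2⟩ := ih ⟨p, hpl, hp1⟩
      refine ⟨p', List.mem_cons_of_mem _ hp', h1, ?_⟩
      rw [← h2]
      simp [firstOf, eval, hq]

theorem size_sumList_le {l : List (Expr ι)} {B : ℕ} (h : ∀ e ∈ l, e.size ≤ B) :
    (sumList l).size ≤ l.length * (B + 1) + 1 := by
  induction l with
  | nil => simp [sumList, size]
  | cons e l ih =>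
    rw [List.forall_mem_cons] at h
    have := ih h.2
    simp only [sumList, size, List.length_cons]
    nlinarith [h.1]

theorem size_prodList_le {l : List (Expr ι)} {B : ℕ} (h : ∀ e ∈ l, e.size ≤ B) :
    (prodList l).size ≤ l.length * (B + 1) + 1 := by
  induction l with
  | nil => simp [prodList, size]
  | cons e l ih =>
    rw [List.forall_mem_cons] at h
    have := ih h.2
    simp only [prodList, size, List.length_cons]
    nlinarith [h.1]

theorem size_allLe_le {l : List (Expr ι × Expr ι)} {B : ℕ} (h : ∀ p ∈ l, p.1.size + p.2.size ≤ B) :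
    (allLe l).size ≤ l.length * (B + 4) + 1 := by
  induction l with
  | nil => simp [allLe, size]
  | cons p l ih =>
    rw [List.forall_mem_cons] at h
    have := ih h.2
    simp only [allLe, size, List.length_cons]
    nlinarith [h.1]

theorem size_firstOf_le {l : List (Expr ι × Expr ι)} {B : ℕ}
    (h : ∀ p ∈ l, p.1.size + p.2.size ≤ B) : (firstOf l).size ≤ l.length * (B + 2) + 1 := by
  induction l with
  | nil => simp [firstOf, size]
  | cons p l ih =>
    rw [List.forall_mem_cons] at h
    have := ih h.2
    simp only [firstOf, size, List.length_cons]
    nlinarith [h.1]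

end Expr

/-! ### Exhaustive search over candidate angles -/

section Search

variable {ι : Type}

/-- The `g`-th candidate for the angle. -/
def candidate (J g : ℕ) : ℚ := 2 + g / (150 * 2 ^ J)

/-- The number of Grover iterations in the test `(j, s)`. -/
def iterations {J : ℕ} (x : Fin (J + 1) × Bool) : ℕ := 2 ^ (x.1 : ℕ) - if x.2 then 1 else 0

/-- The marked probability after the iterations of the test `x`, for the `g`-th candidate. -/
def predicted {J : ℕ} (g : ℕ) (x : Fin (J + 1) × Bool) : Expr ι :=
  .mul (.const (1 / 2)) (.add (.const 1)
    (.cos (.const ((2 * iterations x + 1) * candidate J g))))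

/-- The deviation of an observed frequency from the predicted one. -/
def deviation {J : ℕ} (freq : Fin (J + 1) × Bool → Expr ι) (g : ℕ) (x : Fin (J + 1) × Bool) :
    Expr ι :=
  .add (freq x) (.mul (.const (-1)) (predicted g x))

/-- Whether the `g`-th candidate agrees with all observed frequencies. -/
def consistent {J : ℕ} (freq : Fin (J + 1) × Bool → Expr ι) (g : ℕ) : Expr ι :=
  .allLe ((Finset.univ : Finset (Fin (J + 1) × Bool)).toList.map fun x =>
    -- The expression language has no absolute value: deviations are squared and compared with
    -- `(3/100)²`.
    (.mul (deviation freq g x) (deviation freq g x), .const (9 / 10000)))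

/-- The ratio belonging to the first candidate that agrees with all observed frequencies. -/
def ratioExpr {J : ℕ} (freq : Fin (J + 1) × Bool → Expr ι) : Expr ι :=
  -- `75 · 2^J` steps of length `1 / (150 · 2^J)` cover the interval `[2, 5/2]`, endpoints included.
  .firstOf ((List.range (75 * 2 ^ J + 1)).map fun g =>
    (consistent freq g, .mul (.const 2) (.add (.const 1) (.cos (.const (candidate J g))))))

theorem cast_iterations {J : ℕ} (x : Fin (J + 1) × Bool) :
    (iterations x : ℝ) = 2 ^ (x.1 : ℕ) - if x.2 then 1 else 0 := by
  have h : 1 ≤ 2 ^ (x.1 : ℕ) := Nat.one_le_two_pow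
  rw [iterations]
  split_ifs
  · push_cast [Nat.cast_sub h]; ring
  · simp

theorem iterations_le {J : ℕ} (x : Fin (J + 1) × Bool) : iterations x ≤ 2 ^ J :=
  (Nat.sub_le _ _).trans (Nat.pow_le_pow_right (by norm_num) (by omega))

theorem eval_predicted (ω : ι → Bool) {J : ℕ} (g : ℕ) (x : Fin (J + 1) × Bool) :
    (predicted g x).eval ω
      = (1 + Real.cos ((2 * iterations x + 1) * (candidate J g : ℝ))) / 2 := by
  simp [predicted, Expr.eval]
  ring

theorem one_le_eval_consistent (ω : ι → Bool) {J : ℕ} (freq : Fin (J + 1) × Bool → Expr ι)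
    (g : ℕ) : 1 ≤ (consistent freq g).eval ω ↔ ∀ x, |(freq x).eval ω
      - (1 + Real.cos ((2 * iterations x + 1) * (candidate J g : ℝ))) / 2| ≤ 3 / 100 := by
  rw [consistent, Expr.one_le_eval_allLe]
  simp only [List.forall_mem_map, Finset.mem_toList, Finset.mem_univ, true_imp_iff]
  refine forall_congr' fun x => ?_
  simp only [Expr.eval, deviation, eval_predicted]
  push_cast
  constructor
  · intro h
    exact abs_le_of_sq_le_sq (by linarith) (by norm_num)
  · intro h
    have := pow_le_pow_left₀ (abs_nonneg _) h 2
    rw [sq_abs] at this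
    linarith

theorem candidate_mem {J g : ℕ} (hg : g ≤ 75 * 2 ^ J) :
    (candidate J g : ℝ) ∈ Set.Icc (2 : ℝ) (5 / 2) := by
  have h0 : (0 : ℝ) < 150 * 2 ^ J := by positivity
  have h1 : (g : ℝ) ≤ 75 * 2 ^ J := by exact_mod_cast hg
  rw [candidate]
  push_cast
  constructor
  · have : (0 : ℝ) ≤ g / (150 * 2 ^ J) := by positivity
    linarith
  · have : (g : ℝ) / (150 * 2 ^ J) ≤ 1 / 2 := by rw [div_le_iff₀ h0]; linarith
    linarith

theorem exists_candidate {φ : ℝ} (hφ : φ ∈ Set.Icc (2 : ℝ) (5 / 2)) (J : ℕ) :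
    ∃ g ≤ 75 * 2 ^ J, |φ - candidate J g| ≤ 1 / (150 * 2 ^ J) := by
  have h0 : (0 : ℝ) < 150 * 2 ^ J := by positivity
  have h1 : 0 ≤ (φ - 2) * (150 * 2 ^ J) := mul_nonneg (by linarith [hφ.1]) h0.le
  refine ⟨⌊(φ - 2) * (150 * 2 ^ J)⌋₊, ?_, ?_⟩
  · have h2 := Nat.floor_le h1
    have h3 : (⌊(φ - 2) * (150 * 2 ^ J)⌋₊ : ℝ) ≤ ((75 * 2 ^ J : ℕ) : ℝ) := by
      push_cast
      nlinarith [hφ.2]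
    exact_mod_cast h3
  · have h2 := Nat.floor_le h1
    have h3 := Nat.lt_floor_add_one ((φ - 2) * (150 * 2 ^ J))
    set f := ⌊(φ - 2) * (150 * 2 ^ J)⌋₊
    have h4 : φ - candidate J f = ((φ - 2) * (150 * 2 ^ J) - f) / (150 * 2 ^ J) := by
      rw [candidate]; push_cast; field_simp; ring
    rw [h4, abs_div, abs_of_pos h0]
    gcongr
    rw [abs_le]
    constructor <;> linarith

/-- The exhaustive search finds the angle if all frequencies are close to the exact
probabilities. -/
theorem exists_eval_ratioExpr (ω : ι → Bool) {J : ℕ} (freq : Fin (J + 1) × Bool → Expr ι) {φ : ℝ}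
    (hφ : φ ∈ Set.Icc (2 : ℝ) (5 / 2))
    (h : ∀ x, |(freq x).eval ω - (1 + Real.cos ((2 * iterations x + 1) * φ)) / 2| ≤ 2 / 100) :
    |(ratioExpr freq).eval ω - 2 * (1 + Real.cos φ)| ≤ 2 / 2 ^ J := by
  have hJ : (0 : ℝ) < 2 ^ J := by positivity
  obtain ⟨g, hg, hgφ⟩ := exists_candidate hφ J
  have hcons : 1 ≤ (consistent freq g).eval ω := by
    rw [one_le_eval_consistent]
    intro x
    have h1 := Real.abs_cos_sub_cos_le ((2 * iterations x + 1) * φ)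
      ((2 * iterations x + 1) * (candidate J g : ℝ))
    rw [← mul_sub, abs_mul, abs_of_nonneg (by positivity : (0 : ℝ) ≤ 2 * iterations x + 1)] at h1
    -- Multipliers are at most `3 · 2^J`, so rounding to the grid moves a probability by at most
    -- `1/100`. With the observational error `2/100` the rounded angle still passes the test at
    -- `3/100`.
    have h2 : (2 * (iterations x : ℝ) + 1) * |φ - candidate J g| ≤ 1 / 50 := by
      have h3 : (iterations x : ℝ) ≤ 2 ^ J := by exact_mod_cast iterations_le x
      have h4 : (1 : ℝ) ≤ 2 ^ J := one_le_pow₀ (by norm_num)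
      calc _ ≤ (3 * 2 ^ J) * (1 / (150 * 2 ^ J)) :=
            mul_le_mul (by linarith) hgφ (abs_nonneg _) (by positivity)
        _ = 1 / 50 := by field_simp; norm_num
    have h5 := abs_le.1 (h x)
    have h6 := abs_le.1 (h1.trans h2)
    rw [abs_le]
    constructor <;> linarith [h5.1, h5.2, h6.1, h6.2]
  obtain ⟨p, hp, hp1, hp2⟩ := Expr.exists_eval_firstOf ω
    (l := (List.range (75 * 2 ^ J + 1)).map fun g =>
      (consistent freq g, .mul (.const 2) (.add (.const 1) (.cos (.const (candidate J g))))))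
    ⟨_, List.mem_map.2 ⟨g, List.mem_range.2 (by omega), rfl⟩, hcons⟩
  obtain ⟨g', hg', rfl⟩ := List.mem_map.1 hp
  rw [List.mem_range] at hg'
  rw [one_le_eval_consistent] at hp1
  have hval : (ratioExpr freq).eval ω = 2 * (1 + Real.cos (candidate J g' : ℝ)) := by
    rw [ratioExpr, hp2]; simp [Expr.eval]
  -- Any accepted candidate deviates in probability by at most `2/100 + 3/100`, hence in cosine by
  -- at most `1/10`, the tolerance of the angle recovery.
  have hclose : ∀ x : Fin (J + 1) × Bool, |Real.cos ((2 * iterations x + 1) * φ)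
      - Real.cos ((2 * iterations x + 1) * (candidate J g' : ℝ))| ≤ 1 / 10 := by
    intro x
    have h1 := abs_le.1 (h x)
    have h2 := abs_le.1 (hp1 x)
    rw [abs_le]
    constructor <;> linarith [h1.1, h1.2, h2.1, h2.2]
  have hd := two_pow_mul_abs_sub_le (J := J) hφ (candidate_mem (J := J) (g := g') (by omega))
    (fun j hj => by
      have := hclose (⟨j, by omega⟩, false)
      rw [cast_iterations] at this
      simpa using this)
    (fun j hj => by
      have := hclose (⟨j, by omega⟩, true)
      rw [cast_iterations] at this
      simp only [if_true] at this
      rwa [show 2 * ((2 : ℝ) ^ j - 1) + 1 = 2 * 2 ^ j - 1 by ring] at this)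
  rw [hval, le_div_iff₀ hJ]
  have h1 := Real.abs_cos_sub_cos_le (candidate J g' : ℝ) φ
  rw [abs_sub_comm (candidate J g' : ℝ)] at h1
  have h2 : 2 * (1 + Real.cos (candidate J g' : ℝ)) - 2 * (1 + Real.cos φ)
      = 2 * (Real.cos (candidate J g' : ℝ) - Real.cos φ) := by ring
  rw [h2, abs_mul, abs_of_pos (by norm_num : (0 : ℝ) < 2)]
  nlinarith

theorem size_ratioExpr_le {J : ℕ} (freq : Fin (J + 1) × Bool → Expr ι) {B : ℕ}
    (hB : ∀ x, (freq x).size ≤ B) :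
    (ratioExpr freq).size ≤ (75 * 2 ^ J + 1) * (2 * (J + 1) * (2 * B + 24) + 9) + 1 := by
  have hdev : ∀ g x, (deviation freq g x).size ≤ B + 9 := by
    intro g x
    have := hB x
    simp only [deviation, predicted, Expr.size]
    omega
  have hcons : ∀ g, (consistent freq g).size ≤ 2 * (J + 1) * (2 * B + 24) + 1 := by
    intro g
    have h1 := Expr.size_allLe_le (B := 2 * B + 20)
      (l := (Finset.univ : Finset (Fin (J + 1) × Bool)).toList.map fun x =>
        (Expr.mul (deviation freq g x) (deviation freq g x), .const (9 / 10000))) (by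
          simp only [List.forall_mem_map]
          intro x _
          have := hdev g x
          simp only [Expr.size]
          omega)
    rw [List.length_map, Finset.length_toList, Finset.card_univ, Fintype.card_prod,
      Fintype.card_fin, Fintype.card_bool] at h1
    refine h1.trans (le_of_eq ?_)
    ring
  have h2 := Expr.size_firstOf_le (B := 2 * (J + 1) * (2 * B + 24) + 7)
    (l := (List.range (75 * 2 ^ J + 1)).map fun g =>
      (consistent freq g, .mul (.const 2) (.add (.const 1) (.cos (.const (candidate J g)))))) (by
        simp only [List.forall_mem_map]
        intro g _
        have := hcons g
        simp only [Expr.size]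
        omega)
  rw [List.length_map, List.length_range] at h2
  exact h2

end Search

/-! ### Errors in a product of ratios -/

section RelativeErrors

/-- Bernoulli's inequality gives the lower bound. The upper bound uses `(1 + c)^ℓ ≤ exp (ε/2) ≤ 1 +
ε/2 + ε²/4`, which is at most `1 + ε` for `ε ≤ 1`. -/
theorem prod_mem_Icc_of_relative_error {ℓ : ℕ} (hℓ : 1 ≤ ℓ) {ε : ℝ} (hε : 0 < ε) (hε1 : ε ≤ 1)
    {x y : Fin ℓ → ℝ} (hx : ∀ i, 0 < x i) (h : ∀ i, |y i - x i| ≤ ε / (2 * ℓ) * x i) :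
    ∏ i, y i ∈ Set.Icc ((1 - ε) * ∏ i, x i) ((1 + ε) * ∏ i, x i) := by
  have hℓ' : (1 : ℝ) ≤ ℓ := by exact_mod_cast hℓ
  set c := ε / (2 * ℓ) with hc
  have hc0 : 0 < c := by positivity
  have hcℓ : ℓ * c = ε / 2 := by rw [hc]; field_simp
  have hc1 : c ≤ 1 / 2 := by rw [hc, div_le_iff₀ (by positivity)]; nlinarith
  have hP : 0 < ∏ i, x i := Finset.prod_pos fun i _ => hx i
  have hlow : ∀ i, (1 - c) * x i ≤ y i := fun i => by linarith [(abs_le.1 (h i)).1]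
  have hup : ∀ i, y i ≤ (1 + c) * x i := fun i => by linarith [(abs_le.1 (h i)).2]
  have hnn : ∀ i, 0 ≤ (1 - c) * x i := fun i => mul_nonneg (by linarith) (hx i).le
  constructor
  · have h1 := Finset.prod_le_prod (s := Finset.univ) (fun i _ => hnn i) fun i _ => hlow i
    rw [Finset.prod_mul_distrib, Finset.prod_const, Finset.card_univ, Fintype.card_fin] at h1
    refine le_trans (mul_le_mul_of_nonneg_right ?_ hP.le) h1
    have h2 := one_add_mul_le_pow (a := -c) (by linarith) ℓ
    have h3 : (1 + -c) ^ ℓ = (1 - c) ^ ℓ := by ring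
    rw [h3] at h2
    linarith
  · have h1 := Finset.prod_le_prod (s := Finset.univ)
      (fun i _ => (hnn i).trans (hlow i)) fun i _ => hup i
    rw [Finset.prod_mul_distrib, Finset.prod_const, Finset.card_univ, Fintype.card_fin] at h1
    refine h1.trans (mul_le_mul_of_nonneg_right ?_ hP.le)
    have h2 : (1 + c) ^ ℓ ≤ Real.exp (ε / 2) := by
      rw [← hcℓ, Real.exp_nat_mul]
      refine pow_le_pow_left₀ (by linarith) ?_ ℓ
      linarith [Real.add_one_le_exp c]
    have h3 := Real.abs_exp_sub_one_sub_id_le (x := ε / 2)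
      (by rw [abs_of_pos (by linarith)]; linarith)
    have h4 := (abs_le.1 h3).2
    nlinarith

variable {Ω : Type u} [Fintype Ω] [DecidableEq Ω] {S : System Ω}

theorem card_mul_prod_ratio (h0 : S.β 0 = 0) (ℓ : ℕ) :
    (Fintype.card Ω : ℝ) * ∏ i : Fin ℓ, S.Z (i + 1) / S.Z i = S.Z ℓ := by
  have hZ0 : S.Z 0 = Fintype.card Ω := by simp [System.Z, h0]
  rw [Fin.prod_univ_eq_prod_range (fun i => S.Z (i + 1) / S.Z i), ← hZ0]
  induction ℓ with
  | zero => simp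
  | succ ℓ ih =>
    rw [Finset.prod_range_succ, ← mul_assoc, ih, mul_div_cancel₀ _ (S.Z_pos ℓ).ne']

end RelativeErrors

/-! ### The scheme, its accuracy and its cost -/

section Scheme

/-- The tests: a cooling step, and a number of Grover iterations. -/
abbrev Test (ℓ J : ℕ) := Fin ℓ × (Fin (J + 1) × Bool)

/-- The runs are indexed by a test and a repetition. -/
def runIndex (ℓ J N : ℕ) : Fin (Fintype.card (Test ℓ J × Fin N)) ≃ Test ℓ J × Fin N :=
  (Fintype.equivFin _).symm

/-- The frequency of marked outcomes in the runs of a test. -/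
def freqExpr (a : ℕ) {ℓ J : ℕ} (N : ℕ) (x : Test ℓ J) :
    Expr (Fin (Fintype.card (Test ℓ J × Fin N)) × Fin (2 * a + 3)) :=
  .mul (.const (1 / N)) (.sumList ((List.finRange N).map fun v =>
    .mul (.bit ((runIndex ℓ J N).symm (x, v), wire a 0))
      (.bit ((runIndex ℓ J N).symm (x, v), wire a 1))))

/-- The approximation scheme with `2 n s` phase bits, `n` of them for each of `2 s` repetitions,
`3 ^ μ - 1` reflections for every step of the preparation, at most `2 ^ J` Grover iterations and
`N` repetitions of each test. -/
def scheme (ℓ n s μ J N : ℕ) : Scheme ℓ where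
  runs := Fintype.card (Test ℓ J × Fin N)
  qubits := 2 * (n * (2 * s)) + 3
  circuit r := sampleCircuit (n * (2 * s)) n μ (runIndex ℓ J N r).1.1.isLt
    (iterations (runIndex ℓ J N r).1.2)
  post := .prodList ((List.finRange ℓ).map fun i =>
    ratioExpr fun x => freqExpr (n * (2 * s)) N (i, x))

theorem eval_freqExpr {a ℓ J N : ℕ} (x : Test ℓ J)
    (ω : Fin (Fintype.card (Test ℓ J × Fin N)) → Fin (2 * a + 3) → Bool) :
    (freqExpr a N x).eval (fun j => ω j.1 j.2)
      = 1 / N * ∑ v, ind (isMarked (ω ((runIndex ℓ J N).symm (x, v)))) := by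
  rw [freqExpr, Expr.eval, Expr.eval_sumList, List.map_map, Expr.eval, ← List.ofFn_eq_map,
    List.sum_ofFn]
  push_cast
  congr 1
  refine Finset.sum_congr rfl fun v _ => ?_
  have hind : ∀ y z : Bool, ((if y then 1 else 0) * if z then 1 else 0 : ℝ) = ind (y && z) := by
    intro y z; cases y <;> cases z <;> simp [ind]
  exact hind _ _

theorem size_freqExpr_le {a ℓ J N : ℕ} (x : Test ℓ J) : (freqExpr a N x).size ≤ 4 * N + 3 := by
  have := Expr.size_sumList_le (B := 3) (l := (List.finRange N).map fun v =>
    Expr.mul (.bit ((runIndex ℓ J N).symm (x, v), wire a 0))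
      (.bit ((runIndex ℓ J N).symm (x, v), wire a 1))) (by
        simp only [List.forall_mem_map]; intro v _; simp [Expr.size])
  rw [List.length_map, List.length_finRange] at this
  rw [freqExpr, Expr.size, Expr.size]
  omega

/-- The estimate is accurate if all frequencies are. -/
theorem estimate_mem {Ω : Type u} [Fintype Ω] [DecidableEq Ω] {S : System Ω} {ℓ : ℕ} {δ ε : ℝ}
    (hℓ : 1 ≤ ℓ) (hε : 0 < ε) (hε1 : ε ≤ 1) (h : S.IsAnnealing ℓ δ) {n s μ J N : ℕ}
    (hJ : 8 * ℓ / ε ≤ 2 ^ J)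
    (ω : Fin (scheme ℓ n s μ J N).runs → Fin (scheme ℓ n s μ J N).qubits → Bool)
    (hω : ∀ (i : Fin ℓ) x, |(freqExpr (n * (2 * s)) N (i, x)).eval (fun j => ω j.1 j.2)
      - (1 + Real.cos ((2 * iterations x + 1) * angle S i)) / 2| ≤ 2 / 100) :
    (scheme ℓ n s μ J N).estimate Ω ω ∈ Set.Icc ((1 - ε) * S.Z ℓ) ((1 + ε) * S.Z ℓ) := by
  have hS := h.weightsLeOne
  have hcard : (0 : ℝ) ≤ Fintype.card Ω := by positivity
  set y : Fin ℓ → ℝ := fun i =>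
    (ratioExpr fun x => freqExpr (n * (2 * s)) N (i, x)).eval (fun j => ω j.1 j.2) with hy
  have hest : (scheme ℓ n s μ J N).estimate Ω ω = Fintype.card Ω * ∏ i, y i := by
    have hpost : (scheme ℓ n s μ J N).post.eval (fun j => ω j.1 j.2) = ∏ i, y i := by
      refine (Expr.eval_prodList _ _).trans ?_
      refine (congrArg List.prod (List.map_map ..)).trans ?_
      rw [← List.prod_ofFn, List.ofFn_eq_map]
      rfl
    rw [Scheme.estimate, hpost]
  have hrel : ∀ i : Fin ℓ, |y i - S.Z (i + 1) / S.Z i| ≤ ε / (2 * ℓ) * (S.Z (i + 1) / S.Z i) := by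
    intro i
    have hr := h.ratio i i.isLt
    have hr1 := ratio_le_one hS i.isLt
    have h1 := exists_eval_ratioExpr (fun j => ω j.1 j.2)
      (fun x => freqExpr (n * (2 * s)) N (i, x)) (φ := angle S i) (arccos_mem_Icc hr hr1) (hω i)
    rw [cos_angle hr1] at h1
    have h2 : 2 * (1 + (S.Z (i + 1) / S.Z i / 2 - 1)) = S.Z (i + 1) / S.Z i := by ring
    rw [h2] at h1
    refine h1.trans ?_
    have hℓ' : (1 : ℝ) ≤ ℓ := by exact_mod_cast hℓ
    -- The search has an absolute error; `α_i ≥ 1/2` converts `ε / (4ℓ)` into the relative error `ε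
    -- / (2ℓ)`.
    have h3 : 2 / 2 ^ J ≤ ε / (4 * ℓ) := by
      rw [div_le_div_iff₀ (by positivity) (by positivity)]
      rw [div_le_iff₀ hε] at hJ
      linarith
    have h4 : ε / (4 * ℓ) = ε / (2 * ℓ) * (1 / 2) := by field_simp; norm_num
    refine h3.trans ?_
    rw [h4]
    gcongr
  have hmem := prod_mem_Icc_of_relative_error hℓ hε hε1
    (fun i : Fin ℓ => div_pos (S.Z_pos (i + 1)) (S.Z_pos i)) hrel
  rw [hest, ← card_mul_prod_ratio h.start_temperature ℓ]
  constructor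
  · have := mul_le_mul_of_nonneg_left hmem.1 hcard
    linarith
  · have := mul_le_mul_of_nonneg_left hmem.2 hcard
    linarith

/-- The tolerance `2/100` per test is shared equally between imperfect circuits (`herr`) and
sampling (`η = 1/100`, whence `N / 40000` in the exponent). The constant `16` leaves failure
probability `1/4` after the union bound over `2ℓ(J + 1)` two-sided tests. -/
theorem three_quarters_le_prob {Ω : Type u} [Fintype Ω] [DecidableEq Ω] {S : System Ω} {ℓ : ℕ}
    {δ ε : ℝ} (hℓ : 1 ≤ ℓ) (hδ : 0 < δ) (hδ1 : δ ≤ 1) (hε : 0 < ε) (hε1 : ε ≤ 1)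
    (h : S.IsAnnealing ℓ δ) {n s μ J N : ℕ} (hn : 4 ≤ (2 ^ n) ^ 2 * δ) (hs : 1 ≤ s) (hN : 1 ≤ N)
    (hJ : 8 * ℓ / ε ≤ 2 ^ J)
    (herr : 2 * (ℓ * Real.sqrt (2 * (1 / 2) ^ 3 ^ μ)
      + (ℓ * (3 ^ μ - 1) + 2 ^ J) * (2 * (1 / 4) ^ s)) ≤ 1 / 100)
    (hNN : 16 * ℓ * (J + 1) ≤ Real.exp (N / 40000)) :
    3 / 4 ≤ (scheme ℓ n s μ J N).prob S (Set.Icc ((1 - ε) * S.Z ℓ) ((1 + ε) * S.Z ℓ)) := by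
  have hS := h.weightsLeOne
  set a := n * (2 * s) with ha
  have hN' : (0 : ℝ) < N := by exact_mod_cast hN
  let e := runIndex ℓ J N
  let p : Test ℓ J → ℝ := fun x =>
    ∑ b, if isMarked b then outcomeProb S (sampleCircuit a n μ x.1.isLt (iterations x.2)) b else 0
  let emb : Test ℓ J → Fin N ↪ Fin (Fintype.card (Test ℓ J × Fin N)) := fun x =>
    ⟨fun v => e.symm (x, v), fun v w hvw => by have := e.symm.injective hvw; simpa using this⟩
  let T : Test ℓ J → Finset (Fin (Fintype.card (Test ℓ J × Fin N))) := fun x =>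
    Finset.univ.map (emb x)
  have hp : ∀ x : Test ℓ J,
      |p x - (1 + Real.cos ((2 * iterations x.2 + 1) * angle S x.1)) / 2| ≤ 1 / 100 := by
    intro x
    refine (abs_markedProb_sub_le h hδ hδ1 hn hs ha μ x.1.isLt (iterations x.2)).trans
      (le_trans ?_ herr)
    have h1 : ((x.1 : ℕ) : ℝ) ≤ ℓ := by exact_mod_cast x.1.isLt.le
    have h2 : (iterations x.2 : ℝ) ≤ 2 ^ J := by exact_mod_cast iterations_le x.2
    have h3 : (0 : ℝ) ≤ 3 ^ μ - 1 := by
      have : (1 : ℝ) ≤ 3 ^ μ := one_le_pow₀ (by norm_num)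
      linarith
    gcongr
  have key := one_sub_le_sum_prod (ι := Fin (scheme ℓ n s μ J N).runs)
    (w := fun r b => outcomeProb S ((scheme ℓ n s μ J N).circuit r) b)
    (fun r b => sq_nonneg _) (fun r => sum_outcomeProb hS h.start_temperature _)
    (isMarked (a := a)) T (N := N) (p := p)
    (fun x => (Finset.card_map _).trans (by rw [Finset.card_univ, Fintype.card_fin])) (by
      intro x r hr
      obtain ⟨v, -, rfl⟩ := Finset.mem_map.1 hr
      have hx : (runIndex ℓ J N (e.symm (x, v))).1 = x := by
        rw [Equiv.apply_symm_apply]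
      refine Finset.sum_congr rfl fun b _ => ?_
      have hy : ∀ y : Test ℓ J, y = x →
          outcomeProb S (sampleCircuit a n μ y.1.isLt (iterations y.2)) b * ind (isMarked b)
            = if isMarked b then
              outcomeProb S (sampleCircuit a n μ x.1.isLt (iterations x.2)) b else 0 := by
        rintro _ rfl
        rw [ind, mul_ite, mul_one, mul_zero]
      exact hy _ hx) (η := 1 / 100) (by norm_num) (by norm_num)
    (fun ω => (scheme ℓ n s μ J N).estimate Ω ω ∈ Set.Icc ((1 - ε) * S.Z ℓ) ((1 + ε) * S.Z ℓ)) (by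
      intro ω hω
      refine estimate_mem hℓ hε hε1 h hJ ω fun i x => ?_
      have h1 : |∑ v, (ind (isMarked (ω (e.symm ((i, x), v)))) - p (i, x))| ≤ N * (1 / 100) := by
        refine le_of_eq_of_le (congrArg _ ?_) (hω (i, x))
        exact (Finset.sum_map (M := ℝ) Finset.univ (emb (i, x))
          (fun r : Fin (Fintype.card (Test ℓ J × Fin N)) => ind (isMarked (ω r)) - p (i, x))).symm
      have h2 := hp (i, x)
      rw [Finset.sum_sub_distrib, Finset.sum_const, Finset.card_univ, Fintype.card_fin,
        nsmul_eq_mul] at h1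
      have hfe := eval_freqExpr (a := a) (N := N) (i, x) ω
      have h3 : |(freqExpr a N (i, x)).eval (fun j => ω j.1 j.2) - p (i, x)| ≤ 1 / 100 := by
        rw [hfe]
        have h4 : ∀ A : ℝ, 1 / N * A - p (i, x) = (A - N * p (i, x)) / N := by
          intro A; field_simp
        rw [h4, abs_div, abs_of_pos hN', div_le_iff₀ hN']
        rw [mul_comm (1 / 100 : ℝ)]
        exact h1
      have h5 := abs_le.1 h2
      have h6 := abs_le.1 h3
      rw [abs_le]
      constructor <;> linarith [h5.1, h5.2, h6.1, h6.2])
  rw [Scheme.prob]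
  refine le_trans ?_ key
  have hcard : (Fintype.card (Test ℓ J) : ℝ) = 2 * ℓ * (J + 1) := by
    simp only [Test, Fintype.card_prod, Fintype.card_fin, Fintype.card_bool]
    push_cast; ring
  rw [hcard]
  have h1 : -((N : ℝ) * (1 / 100) ^ 2 / 4) = -(N / 40000) := by ring
  rw [h1, Real.exp_neg]
  have h2 := Real.exp_pos (N / 40000 : ℝ)
  have h3 : 2 * (ℓ : ℝ) * (J + 1) * (2 * (Real.exp (N / 40000))⁻¹) ≤ 1 / 4 := by
    have h4 : 2 * (ℓ : ℝ) * (J + 1) * (2 * (Real.exp (N / 40000))⁻¹)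
        = 16 * ℓ * (J + 1) / Real.exp (N / 40000) / 4 := by field_simp; norm_num
    rw [h4]
    have : 16 * (ℓ : ℝ) * (J + 1) / Real.exp (N / 40000) ≤ 1 := by
      rw [div_le_one h2]; exact hNN
    linarith
  linarith

/-- The factors are the number of runs, the reflectors in one run (preparation plus Grover
iterations) and the walks in one reflector. -/
theorem walkCount_scheme_le (ℓ n s μ J N : ℕ) :
    (scheme ℓ n s μ J N).walkCount
      ≤ (2 * ℓ * (J + 1) * N) * ((ℓ * 3 ^ μ + 2 ^ J) * (4 * s * 2 ^ n)) := by
  have h1 : ∀ r, ((scheme ℓ n s μ J N).circuit r).countP Gate.isWalk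
      ≤ (ℓ * 3 ^ μ + 2 ^ J) * (4 * s * 2 ^ n) := by
    intro r
    refine (walks_sampleCircuit_le rfl μ (runIndex ℓ J N r).1.1.isLt
      (iterations (runIndex ℓ J N r).1.2)).trans ?_
    have h2 := (runIndex ℓ J N r).1.1.isLt.le
    have h3 := iterations_le (runIndex ℓ J N r).1.2
    gcongr
  have h2 := Finset.sum_le_card_nsmul Finset.univ _ _ fun r _ => h1 r
  rw [Finset.card_univ, Fintype.card_fin, smul_eq_mul] at h2
  refine h2.trans (le_of_eq ?_)
  congr 1
  simp only [scheme, Test, Fintype.card_prod, Fintype.card_fin, Fintype.card_bool]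
  ring

theorem size_scheme_le (ℓ n s μ J N : ℕ) :
    (scheme ℓ n s μ J N).size ≤ 2 * ℓ * (J + 1) * N + (2 * (n * (2 * s)) + 3)
      + (2 * ℓ * (J + 1) * N) * ((ℓ * 3 ^ μ + 2 ^ J + 1)
        * (4 * s * 2 ^ n + 14 * (n * (2 * s)) + 10))
      + (ℓ * ((75 * 2 ^ J + 1) * (2 * (J + 1) * (2 * (4 * N + 3) + 24) + 9) + 2) + 1) := by
  have hcard : (scheme ℓ n s μ J N).runs = 2 * ℓ * (J + 1) * N := by
    simp only [scheme, Test, Fintype.card_prod, Fintype.card_fin, Fintype.card_bool]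
    ring
  have h1 : ∀ r, ((scheme ℓ n s μ J N).circuit r).length
      ≤ (ℓ * 3 ^ μ + 2 ^ J + 1) * (4 * s * 2 ^ n + 14 * (n * (2 * s)) + 10) := by
    intro r
    refine (length_sampleCircuit_le rfl μ (runIndex ℓ J N r).1.1.isLt
      (iterations (runIndex ℓ J N r).1.2)).trans ?_
    have h2 := (runIndex ℓ J N r).1.1.isLt.le
    have h3 := iterations_le (runIndex ℓ J N r).1.2
    gcongr
  have h2 := Finset.sum_le_card_nsmul Finset.univ _ _ fun r _ => h1 r
  rw [Finset.card_univ, Fintype.card_fin, smul_eq_mul] at h2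
  have h2' := h2.trans (Nat.mul_le_mul_right _ hcard.le)
  have h3 : (scheme ℓ n s μ J N).post.size
      ≤ ℓ * ((75 * 2 ^ J + 1) * (2 * (J + 1) * (2 * (4 * N + 3) + 24) + 9) + 2) + 1 := by
    have := Expr.size_prodList_le
      (B := (75 * 2 ^ J + 1) * (2 * (J + 1) * (2 * (4 * N + 3) + 24) + 9) + 1)
      (l := (List.finRange ℓ).map fun i =>
        ratioExpr fun x => freqExpr (n * (2 * s)) N ((i, x) : Test ℓ J)) (by
          simp only [List.forall_mem_map]
          intro i _
          exact size_ratioExpr_le _ fun x => size_freqExpr_le _)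
    rwa [List.length_map, List.length_finRange] at this
  have h4 : (scheme ℓ n s μ J N).qubits = 2 * (n * (2 * s)) + 3 := rfl
  rw [Scheme.size]
  exact add_le_add (add_le_add (add_le_add hcard.le h4.le) h2') h3

end Scheme

/-! ### Choice of parameters -/

section Parameters

theorem exists_pow_mem_Icc {b x : ℝ} (hb : 1 < b) (hx : 1 ≤ x) :
    ∃ m : ℕ, x ≤ b ^ m ∧ b ^ m ≤ b * x := by
  obtain ⟨m, h1, h2⟩ := exists_nat_pow_near hx hb
  exact ⟨m + 1, h2.le, by rw [pow_succ']; gcongr⟩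

/-- The cost parameter `ℓ ^ 2 / (√δ ε)`. -/
def cost (ℓ : ℕ) (δ ε : ℝ) : ℝ := (ℓ : ℝ) ^ 2 / (Real.sqrt δ * ε)

/-- Parameters for which the scheme is accurate and cheap. -/
structure Parameters (ℓ : ℕ) (δ ε : ℝ) where
  (L n s μ J N : ℕ)
  cost_le : cost ℓ δ ε ≤ 2 ^ L
  L_le : (L : ℝ) ≤ 2 * (1 + Real.log (cost ℓ δ ε))
  le_pow_n : 2 / Real.sqrt δ ≤ 2 ^ n
  pow_n_le : (2 : ℝ) ^ n ≤ 4 / Real.sqrt δ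
  le_pow_J : 8 * ℓ / ε ≤ 2 ^ J
  pow_J_le : (2 : ℝ) ^ J ≤ 16 * ℓ / ε
  -- Chosen for the preparation error: its square is at most `2^L · 2 · 2^(-(L + 19)) = 2^(-18)`,
  -- below `(1/400)²`.
  le_pow_μ : L + 19 ≤ 3 ^ μ
  pow_μ_le : 3 ^ μ ≤ 3 * (L + 19)
  -- The error sum has at most `73 · 4^L` reflector terms of size `2 · 4^(-s)`, and `146 · 4^(-8) ≤
  -- 1/400`.
  s_eq : s = L + 8
  -- Makes the exponential in the union bound at least `2^(2L + 7)`, a product of `16 · 2^L` for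
  -- `16ℓ` and `8 · 2^L` for `J + 1`.
  N_eq : N = 40000 * (2 * L + 7)

variable {ℓ : ℕ} {δ ε : ℝ}

theorem one_le_inv_sqrt (hδ : 0 < δ) (hδ1 : δ ≤ 1) : 1 ≤ (Real.sqrt δ)⁻¹ :=
  (one_le_inv₀ (Real.sqrt_pos.2 hδ)).2 (Real.sqrt_le_one.2 hδ1)

theorem cost_eq : cost ℓ δ ε = ℓ * ℓ * ε⁻¹ * (Real.sqrt δ)⁻¹ := by
  rw [cost, div_eq_mul_inv, mul_inv]; ring

theorem one_le_cost (hℓ : 1 ≤ ℓ) (hδ : 0 < δ) (hδ1 : δ ≤ 1) (hε : 0 < ε) (hε1 : ε ≤ 1) :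
    1 ≤ cost ℓ δ ε := by
  have h1 := one_le_inv_sqrt hδ hδ1
  have h2 : 1 ≤ ε⁻¹ := (one_le_inv₀ hε).2 hε1
  have h3 : (1 : ℝ) ≤ ℓ := by exact_mod_cast hℓ
  rw [cost_eq]
  exact one_le_mul_of_one_le_of_one_le (one_le_mul_of_one_le_of_one_le
    (one_le_mul_of_one_le_of_one_le h3 h3) h2) h1

theorem nonempty_parameters (hℓ : 1 ≤ ℓ) (hδ : 0 < δ) (hδ1 : δ ≤ 1) (hε : 0 < ε) (hε1 : ε ≤ 1) :
    Nonempty (Parameters ℓ δ ε) := by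
  have h1 := one_le_inv_sqrt hδ hδ1
  have h2 : 1 ≤ ε⁻¹ := (one_le_inv₀ hε).2 hε1
  have h3 : (1 : ℝ) ≤ ℓ := by exact_mod_cast hℓ
  have hf := one_le_cost hℓ hδ hδ1 hε hε1
  have hℓε : 1 ≤ ℓ * ε⁻¹ := one_le_mul_of_one_le_of_one_le h3 h2
  obtain ⟨L, hL1, hL2⟩ := exists_pow_mem_Icc one_lt_two hf
  obtain ⟨n, hn1, hn2⟩ := exists_pow_mem_Icc (x := 2 / Real.sqrt δ) one_lt_two
    (by rw [div_eq_mul_inv]; linarith)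
  obtain ⟨J, hJ1, hJ2⟩ := exists_pow_mem_Icc (x := 8 * ℓ / ε) one_lt_two
    (by rw [div_eq_mul_inv, mul_assoc]; linarith)
  obtain ⟨μ, hμ1, hμ2⟩ := exists_pow_mem_Icc (b := 3) (x := (L : ℝ) + 19) (by norm_num)
    (by have : (0 : ℝ) ≤ L := by positivity
        linarith)
  refine ⟨⟨L, n, L + 8, μ, J, 40000 * (2 * L + 7), hL1, ?_, hn1, hn2.trans (le_of_eq (by ring)),
    hJ1, hJ2.trans (le_of_eq (by ring)), by exact_mod_cast hμ1, by exact_mod_cast hμ2, rfl, rfl⟩⟩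
  have h4 := Real.log_le_log (by positivity) hL2
  rw [Real.log_pow, Real.log_mul (by norm_num) (by positivity)] at h4
  -- From `2^L ≤ 2f` follows `L ≤ 1 + log f / log 2`; the factor `2` in the claim only needs `log 2
  -- > 1/2`.
  have h5 := Real.log_two_gt_d9
  have h6 := Real.log_nonneg hf
  by_contra! h7
  nlinarith

end Parameters

/-! ### Error and cost bounds for the chosen parameters -/

namespace Parameters

variable {ℓ : ℕ} {δ ε : ℝ} (q : Parameters ℓ δ ε)

theorem ℓ_mul_inv_le_cost (hδ : 0 < δ) (hδ1 : δ ≤ 1) (hε : 0 < ε) : ℓ * ε⁻¹ ≤ cost ℓ δ ε := by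
  have h1 := one_le_inv_sqrt hδ hδ1
  have h2 : (ℓ : ℝ) ≤ ℓ * ℓ := by exact_mod_cast Nat.le_mul_self ℓ
  rw [cost_eq]
  calc (ℓ : ℝ) * ε⁻¹ ≤ ℓ * ℓ * ε⁻¹ := by gcongr
    _ ≤ _ := le_mul_of_one_le_right (by positivity) h1

theorem sq_le_cost (hδ : 0 < δ) (hδ1 : δ ≤ 1) (hε : 0 < ε) (hε1 : ε ≤ 1) :
    (ℓ : ℝ) ^ 2 ≤ cost ℓ δ ε := by
  have h1 := one_le_inv_sqrt hδ hδ1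
  have h2 : 1 ≤ ε⁻¹ := (one_le_inv₀ hε).2 hε1
  rw [cost_eq, mul_assoc, sq]
  exact le_mul_of_one_le_right (by positivity) (one_le_mul_of_one_le_of_one_le h2 h1)

theorem inv_sqrt_le_cost (hℓ : 1 ≤ ℓ) (hε : 0 < ε) (hε1 : ε ≤ 1) :
    (Real.sqrt δ)⁻¹ ≤ cost ℓ δ ε := by
  have h2 : 1 ≤ ε⁻¹ := (one_le_inv₀ hε).2 hε1
  have h3 : (1 : ℝ) ≤ ℓ := by exact_mod_cast hℓ
  rw [cost_eq]
  exact le_mul_of_one_le_left (by positivity) (one_le_mul_of_one_le_of_one_le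
    (one_le_mul_of_one_le_of_one_le h3 h3) h2)

theorem J_le (hδ : 0 < δ) (hδ1 : δ ≤ 1) (hε : 0 < ε) : q.J ≤ q.L + 4 := by
  have h1 : (2 : ℝ) ^ q.J ≤ 2 ^ (q.L + 4) := by
    calc (2 : ℝ) ^ q.J ≤ 16 * (ℓ * ε⁻¹) := q.pow_J_le.trans (le_of_eq (by ring))
      _ ≤ 16 * 2 ^ q.L := by
        have := (ℓ_mul_inv_le_cost hδ hδ1 hε).trans q.cost_le
        linarith
      _ = 2 ^ (q.L + 4) := by ring
  exact (pow_le_pow_iff_right₀ one_lt_two).1 h1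

theorem n_le (hℓ : 1 ≤ ℓ) (hε : 0 < ε) (hε1 : ε ≤ 1) : q.n ≤ q.L + 2 := by
  have h1 : (2 : ℝ) ^ q.n ≤ 2 ^ (q.L + 2) := by
    calc (2 : ℝ) ^ q.n ≤ 4 * (Real.sqrt δ)⁻¹ := q.pow_n_le.trans (le_of_eq (by ring))
      _ ≤ 4 * 2 ^ q.L := by
        have := (inv_sqrt_le_cost hℓ hε hε1).trans q.cost_le
        linarith
      _ = 2 ^ (q.L + 2) := by ring
  exact (pow_le_pow_iff_right₀ one_lt_two).1 h1

theorem L_add_one_le : (q.L : ℝ) + 1 ≤ 2 ^ q.L := by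
  exact_mod_cast Nat.lt_two_pow_self (n := q.L)

theorem ℓ_le_pow (hδ : 0 < δ) (hδ1 : δ ≤ 1) (hε : 0 < ε) (hε1 : ε ≤ 1) : (ℓ : ℝ) ≤ 2 ^ q.L := by
  have h1 : (ℓ : ℝ) ≤ (ℓ : ℝ) ^ 2 := by exact_mod_cast Nat.le_self_pow two_ne_zero ℓ
  exact h1.trans ((sq_le_cost hδ hδ1 hε hε1).trans q.cost_le)

theorem preparation_error_le (hδ : 0 < δ) (hδ1 : δ ≤ 1) (hε : 0 < ε) (hε1 : ε ≤ 1) :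
    ℓ * Real.sqrt (2 * (1 / 2) ^ 3 ^ q.μ) ≤ 1 / 400 := by
  have h1 : ((1 : ℝ) / 2) ^ 3 ^ q.μ ≤ (1 / 2) ^ (q.L + 19) :=
    pow_le_pow_of_le_one (by norm_num) (by norm_num) q.le_pow_μ
  have h2 := (sq_le_cost hδ hδ1 hε hε1).trans q.cost_le
  refine abs_le_of_sq_le_sq' ?_ (by norm_num) |>.2
  rw [mul_pow, Real.sq_sqrt (by positivity)]
  calc (ℓ : ℝ) ^ 2 * (2 * (1 / 2) ^ 3 ^ q.μ) ≤ 2 ^ q.L * (2 * (1 / 2) ^ (q.L + 19)) := by gcongr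
    _ = (2 * (1 / 2)) ^ q.L * (2 * (1 / 2) ^ 19) := by rw [mul_pow, pow_add]; ring
    _ ≤ _ := by norm_num

theorem reflection_error_le (hδ : 0 < δ) (hδ1 : δ ≤ 1) (hε : 0 < ε) (hε1 : ε ≤ 1) :
    (ℓ * (3 ^ q.μ - 1) + 2 ^ q.J) * (2 * (1 / 4) ^ q.s) ≤ (1 : ℝ) / 400 := by
  have h1 := q.L_add_one_le
  have h2 : (3 : ℝ) ^ q.μ ≤ 3 * (q.L + 19) := by exact_mod_cast q.pow_μ_le
  have h3 := q.ℓ_le_pow hδ hδ1 hε hε1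
  have h4 : (2 : ℝ) ^ q.J ≤ 2 ^ (q.L + 4) :=
    pow_le_pow_right₀ one_le_two (q.J_le hδ hδ1 hε)
  have h5 : (0 : ℝ) ≤ q.L := by positivity
  have h6 : (3 : ℝ) ^ q.μ - 1 ≤ 57 * 2 ^ q.L := by linarith
  have h7 : (1 : ℝ) ≤ 2 ^ q.L := one_le_pow₀ one_le_two
  have h8 : ℓ * ((3 : ℝ) ^ q.μ - 1) ≤ 2 ^ q.L * (57 * 2 ^ q.L) := by
    have : (1 : ℝ) ≤ 3 ^ q.μ := one_le_pow₀ (by norm_num)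
    gcongr
  have h9 : ℓ * ((3 : ℝ) ^ q.μ - 1) + 2 ^ q.J ≤ 73 * (2 ^ q.L * 2 ^ q.L) := by
    rw [pow_add] at h4
    nlinarith
  calc _ ≤ 73 * ((2 : ℝ) ^ q.L * 2 ^ q.L) * (2 * (1 / 4) ^ q.s) := by gcongr
    _ = (2 * 2 * (1 / 4)) ^ q.L * (146 * (1 / 4) ^ 8) := by
      rw [q.s_eq, mul_pow, mul_pow, pow_add]; ring
    _ ≤ _ := by norm_num

theorem repetitions_suffice (hδ : 0 < δ) (hδ1 : δ ≤ 1) (hε : 0 < ε) (hε1 : ε ≤ 1) :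
    16 * ℓ * (q.J + 1) ≤ Real.exp (q.N / 40000) := by
  have h1 := q.L_add_one_le
  have h2 : (q.J : ℝ) ≤ q.L + 4 := by exact_mod_cast q.J_le hδ hδ1 hε
  have h3 := q.ℓ_le_pow hδ hδ1 hε hε1
  have h4 : (1 : ℝ) ≤ 2 ^ q.L := one_le_pow₀ one_le_two
  have h5 : (q.N : ℝ) / 40000 = ((2 * q.L + 7 : ℕ) : ℝ) * 1 := by
    rw [q.N_eq]; push_cast; ring
  rw [h5, Real.exp_nat_mul]
  calc 16 * ℓ * ((q.J : ℝ) + 1) ≤ 16 * 2 ^ q.L * (8 * 2 ^ q.L) := by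
        gcongr
        linarith
    _ = 2 ^ (2 * q.L + 7) := by ring
    _ ≤ Real.exp 1 ^ (2 * q.L + 7) := by
        gcongr
        linarith [Real.exp_one_gt_d9]

/-- The scheme with the given parameters. -/
def toScheme : Scheme ℓ := scheme ℓ q.n q.s q.μ q.J q.N

theorem three_quarters_le_prob_toScheme {Ω : Type u} [Fintype Ω] [DecidableEq Ω] {S : System Ω}
    (hℓ : 1 ≤ ℓ) (hδ : 0 < δ) (hδ1 : δ ≤ 1) (hε : 0 < ε) (hε1 : ε ≤ 1) (h : S.IsAnnealing ℓ δ) :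
    3 / 4 ≤ q.toScheme.prob S (Set.Icc ((1 - ε) * S.Z ℓ) ((1 + ε) * S.Z ℓ)) := by
  refine three_quarters_le_prob hℓ hδ hδ1 hε hε1 h ?_ (by rw [q.s_eq]; omega)
    (by rw [q.N_eq]; omega) q.le_pow_J ?_ (q.repetitions_suffice hδ hδ1 hε hε1)
  · have h1 := q.le_pow_n
    rw [div_le_iff₀ (Real.sqrt_pos.2 hδ)] at h1
    calc (4 : ℝ) = 2 ^ 2 := by norm_num
      _ ≤ (2 ^ q.n * Real.sqrt δ) ^ 2 := by gcongr
      _ = (2 ^ q.n) ^ 2 * δ := by rw [mul_pow, Real.sq_sqrt hδ.le]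
  · linarith [q.preparation_error_le hδ hδ1 hε hε1, q.reflection_error_le hδ hδ1 hε hε1]

/-- The number of tests contributes `ℓ`, preparation with Grover iterations `ℓ / ε`, and a reflector
`1 / √δ`. The four logarithms come from `J`, `N`, `3^μ` and `s`. -/
theorem walkCount_toScheme_le (hℓ : 1 ≤ ℓ) (hδ : 0 < δ) (hδ1 : δ ≤ 1) (hε : 0 < ε)
    (hε1 : ε ≤ 1) :
    (q.toScheme.walkCount : ℝ)
      ≤ 10 ^ 12 * cost ℓ δ ε * (1 + Real.log (cost ℓ δ ε)) ^ 4 := by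
  have hg : 1 ≤ 1 + Real.log (cost ℓ δ ε) := by
    linarith [Real.log_nonneg (one_le_cost hℓ hδ hδ1 hε hε1)]
  have hL := q.L_le
  set g := 1 + Real.log (cost ℓ δ ε)
  have hinv : 1 ≤ ε⁻¹ := (one_le_inv₀ hε).2 hε1
  have hJ : (q.J : ℝ) + 1 ≤ 7 * g := by
    have h2 : (q.J : ℝ) ≤ q.L + 4 := by exact_mod_cast q.J_le hδ hδ1 hε
    linarith
  have hN : (q.N : ℝ) ≤ 440000 * g := by rw [q.N_eq]; push_cast; linarith
  have hs : (q.s : ℝ) ≤ 10 * g := by rw [q.s_eq]; push_cast; linarith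
  have hμ : (3 : ℝ) ^ q.μ ≤ 63 * g := by
    have h2 : (3 : ℝ) ^ q.μ ≤ 3 * (q.L + 19) := by exact_mod_cast q.pow_μ_le
    linarith
  have hsum : ℓ * (3 : ℝ) ^ q.μ + 2 ^ q.J ≤ 79 * g * (ℓ * ε⁻¹) := by
    have h1 : ℓ * (3 : ℝ) ^ q.μ ≤ ℓ * ε⁻¹ * (63 * g) := by
      have : (ℓ : ℝ) ≤ ℓ * ε⁻¹ := le_mul_of_one_le_right (by positivity) hinv
      gcongr
    have h2 : (2 : ℝ) ^ q.J ≤ 16 * (ℓ * ε⁻¹) := q.pow_J_le.trans (le_of_eq (by ring))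
    have h3 : ℓ * ε⁻¹ ≤ ℓ * ε⁻¹ * g := le_mul_of_one_le_right (by positivity) hg
    linarith
  have hn : (2 : ℝ) ^ q.n ≤ 4 * (Real.sqrt δ)⁻¹ := q.pow_n_le.trans (le_of_eq (by ring))
  have hw := walkCount_scheme_le ℓ q.n q.s q.μ q.J q.N
  have hw' : (q.toScheme.walkCount : ℝ)
      ≤ (2 * ℓ * (q.J + 1) * q.N) * ((ℓ * 3 ^ q.μ + 2 ^ q.J) * (4 * q.s * 2 ^ q.n)) := by
    exact_mod_cast hw
  calc (q.toScheme.walkCount : ℝ) ≤ _ := hw'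
    _ ≤ (2 * ℓ * (7 * g) * (440000 * g))
        * ((79 * g * (ℓ * ε⁻¹)) * (4 * (10 * g) * (4 * (Real.sqrt δ)⁻¹))) := by gcongr
    _ = 77862400000 * cost ℓ δ ε * g ^ 4 := by rw [cost_eq]; ring
    _ ≤ _ := by
      have := zero_le_one.trans (one_le_cost hℓ hδ hδ1 hε hε1)
      gcongr
      norm_num

theorem size_toScheme_le (hℓ : 1 ≤ ℓ) (hδ : 0 < δ) (hδ1 : δ ≤ 1) (hε : 0 < ε) (hε1 : ε ≤ 1) :
    (q.toScheme.size : ℝ) ≤ 10 ^ 50 * cost ℓ δ ε ^ 7 := by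
  have hf := one_le_cost hℓ hδ hδ1 hε hε1
  have hg : 1 + Real.log (cost ℓ δ ε) ≤ cost ℓ δ ε := by
    linarith [Real.log_le_sub_one_of_pos (zero_lt_one.trans_le hf)]
  have hL : (q.L : ℝ) ≤ 2 * cost ℓ δ ε := by linarith [q.L_le]
  have h1 := sq_le_cost (ℓ := ℓ) hδ hδ1 hε hε1
  have h2 := ℓ_mul_inv_le_cost (ℓ := ℓ) hδ hδ1 hε
  have h3 := inv_sqrt_le_cost (δ := δ) hℓ hε hε1
  set f := cost ℓ δ ε
  -- One quantity dominates all parameters, of which `N ≤ 440000 f` is the largest. The size bound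
  -- becomes a polynomial of degree `7` in `B`.
  set B := 10 ^ 6 * f with hB
  have hB1 : 1 ≤ B := by linarith
  have hℓB : (ℓ : ℝ) ≤ B := by
    have h : (ℓ : ℝ) ≤ (ℓ : ℝ) ^ 2 := by exact_mod_cast Nat.le_self_pow two_ne_zero ℓ
    linarith
  have hJB : (q.J : ℝ) + 1 ≤ B := by
    have h2 : (q.J : ℝ) ≤ q.L + 4 := by exact_mod_cast q.J_le hδ hδ1 hε
    linarith
  have hnB : (q.n : ℝ) ≤ B := by
    have h2 : (q.n : ℝ) ≤ q.L + 2 := by exact_mod_cast q.n_le hℓ hε hε1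
    linarith
  have hNB : (q.N : ℝ) ≤ B := by rw [q.N_eq]; push_cast; linarith
  have hsB : (q.s : ℝ) ≤ B := by rw [q.s_eq]; push_cast; linarith
  have hμB : (3 : ℝ) ^ q.μ ≤ B := by
    have h2 : (3 : ℝ) ^ q.μ ≤ 3 * (q.L + 19) := by exact_mod_cast q.pow_μ_le
    linarith
  have hJB' : (2 : ℝ) ^ q.J ≤ B := by
    have h2 : (2 : ℝ) ^ q.J ≤ 16 * (ℓ * ε⁻¹) := q.pow_J_le.trans (le_of_eq (by ring))
    linarith
  have hnB' : (2 : ℝ) ^ q.n ≤ B := by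
    have h2 : (2 : ℝ) ^ q.n ≤ 4 * (Real.sqrt δ)⁻¹ := q.pow_n_le.trans (le_of_eq (by ring))
    linarith
  have hw := size_scheme_le ℓ q.n q.s q.μ q.J q.N
  have hw' : (q.toScheme.size : ℝ) ≤ 2 * ℓ * (q.J + 1) * q.N + (2 * (q.n * (2 * q.s)) + 3)
      + (2 * ℓ * (q.J + 1) * q.N) * ((ℓ * 3 ^ q.μ + 2 ^ q.J + 1)
        * (4 * q.s * 2 ^ q.n + 14 * (q.n * (2 * q.s)) + 10))
      + (ℓ * ((75 * 2 ^ q.J + 1) * (2 * (q.J + 1) * (2 * (4 * q.N + 3) + 24) + 9) + 2) + 1) := by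
    exact_mod_cast hw
  have hpow : ∀ j ≤ 7, B ^ j ≤ B ^ 7 := fun j hj => pow_le_pow_right₀ hB1 hj
  calc (q.toScheme.size : ℝ) ≤ _ := hw'
    _ ≤ 2 * B * B * B + (2 * (B * (2 * B)) + 3)
      + (2 * B * B * B) * ((B * B + B + 1) * (4 * B * B + 14 * (B * (2 * B)) + 10))
      + (B * ((75 * B + 1) * (2 * B * (2 * (4 * B + 3) + 24) + 9) + 2) + 1) := by gcongr
    _ ≤ 10 ^ 4 * B ^ 7 := by
      linarith [hpow 0 (by norm_num), hpow 1 (by norm_num), hpow 2 (by norm_num),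
        hpow 3 (by norm_num), hpow 4 (by norm_num), hpow 5 (by norm_num), hpow 6 (by norm_num)]
    _ = 10 ^ 46 * f ^ 7 := by rw [hB]; ring
    _ ≤ _ := by gcongr <;> norm_num

end Parameters

end QuantumAnnealing

end

theorem theorem1 :
    ∃ (C : ℝ) (k : ℕ), ∀ (ℓ : ℕ) (δ ε : ℝ), 1 ≤ ℓ → 0 < δ → δ ≤ 1 → 0 < ε → ε ≤ 1 →
      ∃ A : QuantumAnnealing.Scheme ℓ,
        (A.walkCount : ℝ) ≤ C * ((ℓ : ℝ) ^ 2 / (Real.sqrt δ * ε)) *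
            (1 + Real.log ((ℓ : ℝ) ^ 2 / (Real.sqrt δ * ε))) ^ k ∧
        (A.size : ℝ) ≤ C * ((ℓ : ℝ) ^ 2 / (Real.sqrt δ * ε)) ^ k ∧
        ∀ (Ω : Type*) [Fintype Ω] [DecidableEq Ω] (S : QuantumAnnealing.System Ω),
          S.IsAnnealing ℓ δ →
            3 / 4 ≤ A.prob S (Set.Icc ((1 - ε) * S.Z ℓ) ((1 + ε) * S.Z ℓ)) := by
  -- Both values are dictated by the size bound; the walk bound alone would hold with `10 ^ 12` and
  -- exponent `4`.
  refine ⟨10 ^ 50, 7, fun ℓ δ ε hℓ hδ hδ1 hε hε1 => ?_⟩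
  obtain ⟨q⟩ := QuantumAnnealing.nonempty_parameters hℓ hδ hδ1 hε hε1
  have hf := QuantumAnnealing.one_le_cost hℓ hδ hδ1 hε hε1
  refine ⟨q.toScheme, (q.walkCount_toScheme_le hℓ hδ hδ1 hε hε1).trans ?_,
    q.size_toScheme_le hℓ hδ hδ1 hε hε1, fun Ω _ _ S h =>
      q.three_quarters_le_prob_toScheme hℓ hδ hδ1 hε hε1 h⟩
  have hg := Real.log_nonneg hf
  rw [← QuantumAnnealing.cost]
  gcongr <;> norm_num
  linarith
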